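/- **Setting.** Consider a lossless power network with $n=n_d+n_g$ buses ($n_d$ load buses followed by $n_g$ generator buses) and $m$ lines. Let $E\in\mathbb R^{n\times m}$ be its incidence matrix (column $l$ has entries $1$ and $-1$ at the two distinct end buses of line $l$ and $0$ elsewhere), $D\in\mathbb R^{m\times m}$ the diagonal matrix of the (positive) line admittances, $P=[P_d^T\;P_g^T]^T\in\mathbb R^n$ the power injections, with $P_d\le 0$, $P_g>0$, $\mathbf 1^TP=0$, $K\in\mathbb N$ the number of lines out of service and $\rho>0$. For $\gamma\in\mathbb R^m$ and $z=[z_d^T\;z_g^T]^T,\theta\in\mathbb R^n$ put $\Gamma=\mathrm{diag}(\gamma)$ and $$H_\rho(\gamma,z,\theta)=-\mathbf 1^Tz_d+\tfrac{\rho}{2}\,\|ED\Gamma\sin(E^T\theta)-(P+z)\|_2^2,\qquad \Phi(\gamma,z,\theta)=\phi_1(\gamma)+\phi_2(z)+\phi_3(\theta)+H_\rho(\gamma,z,\theta),$$ where $\phi_1,\phi_2,\phi_3$ are the $\{0,+\infty\}$-valued indicator functions of $\{\gamma\in\{0,1\}^m: m-\mathbf 1^T\gamma=K\}$, $\{z: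 0\le z_d\le -P_d,\ -P_g\le z_g\le 0,\ \mathbf 1^Tz=0\}$ and $\{\theta: -\pi/2\le E^T\theta\le \pi/2\}$ (componentwise). Put $$L_1(z,\theta)=\rho\,\|(DE^TED)\circ(\sin(E^T\theta)\sin(E^T\theta)^T)\|,\quad L_2(\gamma,\theta)=\rho,\quad L_3(\gamma,z)=\rho\|E\|^2(2\|\Gamma DE^TED\Gamma\|+\|\Gamma DE^T(P+z)\|),$$ with $\|\cdot\|$ the maximum singular value and $\circ$ the elementwise product. **Algorithm (PALM).** Let $r_1,r_2,r_3>1$. From an arbitrary initial point, a sequence $x^k=(\gamma^k,z^k,\theta^k)$, $k\ge 0$, is generated by $$\gamma^{k+1}\in\arg\min_\gamma\{\phi_1(\gamma)+\tfrac{a_k}{2}\|\gamma-u^k\|_2^2\},\quad z^{k+1}\in\arg\min_z\{\phi_2(z)+\tfrac{b_k}{2}\|z-v^k\|_2^2\},\quad \theta^{k+1}\in\arg\min_\theta\{\phi_3(\theta)+\tfrac{c_k}{2}\|\theta-w^k\|_2^2\},$$ $$u^k=\gamma^k-\tfrac1{a_k}\nabla_\gamma H_\rho(\gamma^k,z^k,\theta^k),\quad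 v^k=z^k-\tfrac1{b_k}\nabla_zH_\rho(\gamma^{k+1},z^k,\theta^k),\quad w^k=\theta^k-\tfrac1{c_k}\nabla_\theta H_\rho(\gamma^{k+1},z^{k+1},\theta^k),$$ with $a_k=r_1L_1(z^k,\theta^k)$, $b_k=r_2L_2(\gamma^{k+1},\theta^k)$, $c_k=r_3L_3(\gamma^{k+1},z^{k+1})$, where all of these coefficients are positive. **Notions.** For $f:\mathbb R^d\to(-\infty,+\infty]$, $\partial f$ is the limiting subdifferential (limits of Fréchet subgradients $w^j\in\hat\partial f(y^j)$ with $y^j\to u$, $f(y^j)\to f(u)$; empty where $f=+\infty$), and $u$ is a critical point of $f$ if $0\in\partial f(u)$. A proper lower semicontinuous $f$ is a KL function if for each $\bar u$ with $\partial f(\bar u)\ne\emptyset$ there are $\eta\in(0,+\infty]$, a neighborhood $\mathcal N$ of $\bar u$ and a continuous concave $\psi:[0,\eta)\to[0,\infty)$ with $\psi(0)=0$, $\psi$ being $C^1$ with $\psi'>0$ on $(0,\eta)$, such that $\psi'(f(u)-f(\bar u))\cdot\mathrm{dist}(0,\partial f(u))\ge 1$ for all $u\in\mathcal N$ with $f(\bar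 u)<f(u)<f(\bar u)+\eta$ (where $\mathrm{dist}(0,\emptyset)=+\infty$). **Proposition.** Let $x^k=(\gamma^k,z^k,\theta^k)$ be a bounded sequence generated by PALM. Suppose that $\Phi$ is a KL function and that 1. $\inf\Phi$, $\inf\phi_1$, $\inf\phi_2$, $\inf\phi_3$ are all $>-\infty$; 2. $\|\nabla_\gamma H_\rho(\gamma_1,z,\theta)-\nabla_\gamma H_\rho(\gamma_2,z,\theta)\|\le L_1(z,\theta)\|\gamma_1-\gamma_2\|$, $\|\nabla_z H_\rho(\gamma,z_1,\theta)-\nabla_z H_\rho(\gamma,z_2,\theta)\|\le L_2(\gamma,\theta)\|z_1-z_2\|$ and $\|\nabla_\theta H_\rho(\gamma,z,\theta_1)-\nabla_\theta H_\rho(\gamma,z,\theta_2)\|\le L_3(\gamma,z)\|\theta_1-\theta_2\|$ for all values of the arguments; 3. there are positive constants $s_1,s_2,s_3$ with $L_1(z^k,\theta^k)\le s_1$, $L_2(\gamma^k,\theta^k)\le s_2$, $L_3(\gamma^k,z^k)\le s_3$ for all $k$; 4. $\nabla H_\rho$ is Lipschitz continuous on bounded subsets of $\mathbb R^m\times\mathbb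 R^n\times\mathbb R^n$. Then: 1. $\sum_{k}\|x^{k+1}-x^k\|_2<\infty$; 2. $x^k$ converges to a critical point $x^*=(\gamma^*,z^*,\theta^*)$ of $\Phi$; 3. $\Phi(x^k)$ is nonincreasing, and there is a constant $d>0$ with $\tfrac d2\|x^{k+1}-x^k\|_2^2\le\Phi(x^k)-\Phi(x^{k+1})$ for all $k\ge 0$. -/

import Mathlib

open Filter Topology

noncomputable section

namespace LoadShedding

/-! ### Extended-real-valued functions: subdifferentials and the Kurdyka-Lojasiewicz property -/

/-- The Frechet subdifferential of `f` at `x` (empty where `f x` is not finite): the vectors `v` with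
`liminf_{y → x, y ≠ x} (f y - f x - ⟪v, y - x⟫) / ‖y - x‖ ≥ 0`. -/
def frechetSubdiff {V : Type*} [NormedAddCommGroup V] [InnerProductSpace ℝ V]
    (f : V → EReal) (x : V) : Set V :=
  {v | f x ≠ ⊤ ∧ f x ≠ ⊥ ∧ ∀ ε : ℝ, 0 < ε → ∀ᶠ y in 𝓝 x,
    f x + ((inner ℝ v (y - x) - ε * ‖y - x‖ : ℝ) : EReal) ≤ f y}

/-- The (limiting) subdifferential of `f` at `x` (empty where `f x` is not finite). -/
def subdiff {V : Type*} [NormedAddCommGroup V] [InnerProductSpace ℝ V]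
    (f : V → EReal) (x : V) : Set V :=
  {v | f x ≠ ⊤ ∧ f x ≠ ⊥ ∧ ∃ (y : ℕ → V) (w : ℕ → V),
    Tendsto y atTop (𝓝 x) ∧ Tendsto (fun k => f (y k)) atTop (𝓝 (f x)) ∧
    (∀ k, w k ∈ frechetSubdiff f (y k)) ∧ Tendsto w atTop (𝓝 v)}

/-- A critical point of `f`. -/
def IsCriticalPoint {V : Type*} [NormedAddCommGroup V] [InnerProductSpace ℝ V]
    (f : V → EReal) (x : V) : Prop :=
  (0 : V) ∈ subdiff f x

/-- `f` takes values in `(-∞, +∞]` and is not identically `+∞`. -/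
def IsProper {V : Type*} (f : V → EReal) : Prop :=
  (∀ x, f x ≠ ⊥) ∧ ∃ x, f x ≠ ⊤

/-- Desingularizing functions on `[0, η)`, where `η ∈ (0, +∞]`: continuous and concave on `[0, η)`,
zero at `0`, continuously differentiable with positive derivative on `(0, η)`. -/
structure IsDesingularizing (η : EReal) (ψ : ℝ → ℝ) : Prop where
  continuousOn : ContinuousOn ψ {t : ℝ | 0 ≤ t ∧ (t : EReal) < η}
  concaveOn : ConcaveOn ℝ {t : ℝ | 0 ≤ t ∧ (t : EReal) < η} ψ
  map_zero : ψ 0 = 0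
  differentiableOn : DifferentiableOn ℝ ψ {t : ℝ | 0 < t ∧ (t : EReal) < η}
  continuousOn_deriv : ContinuousOn (deriv ψ) {t : ℝ | 0 < t ∧ (t : EReal) < η}
  deriv_pos : ∀ t : ℝ, 0 < t → (t : EReal) < η → 0 < deriv ψ t

/-- The KL property of `f` at `ubar`. The distance to the empty set is `+∞`. -/
def HasKLProperty {V : Type*} [NormedAddCommGroup V] [InnerProductSpace ℝ V]
    (f : V → EReal) (ubar : V) : Prop :=
  ∃ η : EReal, 0 < η ∧ ∃ U ∈ 𝓝 ubar, ∃ ψ : ℝ → ℝ, IsDesingularizing η ψ ∧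
    ∀ u ∈ U, f ubar < f u → f u < f ubar + η →
      1 ≤ ENNReal.ofReal (deriv ψ ((f u).toReal - (f ubar).toReal)) *
        Metric.infEDist (0 : V) (subdiff f u)

/-- KL functions: proper, lower semicontinuous, with the KL property at each point of the domain
of the subdifferential. -/
structure IsKLFunction {V : Type*} [NormedAddCommGroup V] [InnerProductSpace ℝ V]
    (f : V → EReal) : Prop where
  proper : IsProper f
  lowerSemicontinuous : LowerSemicontinuous f
  kl : ∀ u : V, (subdiff f u).Nonempty → HasKLProperty f u

/-- The spectral norm (maximum singular value) of a real matrix. -/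
def specNorm {ι κ : Type*} [Fintype ι] [Fintype κ] [DecidableEq κ] (A : Matrix ι κ ℝ) : ℝ :=
  ‖LinearMap.toContinuousLinearMap (Matrix.toEuclideanLin A)‖

/-! ### The network and the penalized load-shedding problem -/

/-- Buses: `nd` load buses followed by `ng` generator buses. -/
abbrev Bus (nd ng : ℕ) : Type := Fin nd ⊕ Fin ng

/-- The data of the penalized load-shedding problem on a lossless network with `m` lines. -/
structure Problem (nd ng m : ℕ) where
  /-- the two end buses of each line -/
  src : Fin m → Bus nd ng
  tgt : Fin m → Bus nd ng
  src_ne_tgt : ∀ l, src l ≠ tgt l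
  /-- line admittances -/
  adm : Fin m → ℝ
  adm_pos : ∀ l, 0 < adm l
  /-- real power injections -/
  P : Bus nd ng → ℝ
  load_nonpos : ∀ i, P (Sum.inl i) ≤ 0
  gen_pos : ∀ j, 0 < P (Sum.inr j)
  lossless : ∑ i, P i = 0
  /-- number of lines out of service -/
  K : ℕ
  /-- penalty coefficient -/
  ρ : ℝ
  ρ_pos : 0 < ρ

/-- The space of line variables. -/
abbrev LineVec (m : ℕ) : Type := EuclideanSpace ℝ (Fin m)

/-- The space of bus variables. -/
abbrev BusVec (nd ng : ℕ) : Type := EuclideanSpace ℝ (Bus nd ng)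

/-- The space of triples `(γ, z, θ)`, with the Euclidean norm and inner product. -/
abbrev State (nd ng m : ℕ) : Type :=
  WithLp 2 (LineVec m × WithLp 2 (BusVec nd ng × BusVec nd ng))

/-- The state with components `γ`, `z`, `θ`. -/
def mkState {nd ng m : ℕ} (γ : LineVec m) (z θ : BusVec nd ng) : State nd ng m :=
  WithLp.toLp 2 (γ, WithLp.toLp 2 (z, θ))

namespace Problem

/-- The incidence matrix: column `l` is `1` at one end of line `l` and `-1` at the other. -/
def E {nd ng m : ℕ} (N : Problem nd ng m) : Matrix (Bus nd ng) (Fin m) ℝ :=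
  Matrix.of fun i l => if i = N.src l then 1 else if i = N.tgt l then -1 else 0

/-- The diagonal matrix of admittances. -/
def D {nd ng m : ℕ} (N : Problem nd ng m) : Matrix (Fin m) (Fin m) ℝ :=
  Matrix.diagonal N.adm

/-- `diag(γ)`. -/
def Γ {m : ℕ} (γ : LineVec m) : Matrix (Fin m) (Fin m) ℝ :=
  Matrix.diagonal fun l => γ l

/-- The vector `Eᵀ θ` of angle differences. -/
def angleDiff {nd ng m : ℕ} (N : Problem nd ng m) (θ : BusVec nd ng) : Fin m → ℝ :=
  Matrix.mulVec N.E.transpose fun i => θ i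

/-- The vector `sin(Eᵀ θ)`. -/
def sinDiff {nd ng m : ℕ} (N : Problem nd ng m) (θ : BusVec nd ng) : Fin m → ℝ :=
  fun l => Real.sin (N.angleDiff θ l)

/-- The power flow residual `c(γ, z, θ) = E D diag(γ) sin(Eᵀ θ) - (P + z)`. -/
def residual {nd ng m : ℕ} (N : Problem nd ng m) (γ : LineVec m) (z θ : BusVec nd ng) :
    BusVec nd ng :=
  WithLp.toLp 2 fun i => Matrix.mulVec (N.E * N.D * Γ γ) (N.sinDiff θ) i - (N.P i + z i)

/-- `H_ρ(γ, z, θ) = - 1ᵀ z_d + (ρ / 2) ‖c(γ, z, θ)‖²`. -/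
def H {nd ng m : ℕ} (N : Problem nd ng m) (γ : LineVec m) (z θ : BusVec nd ng) : ℝ :=
  -(∑ i : Fin nd, z (Sum.inl i)) + N.ρ / 2 * ‖N.residual γ z θ‖ ^ 2

open Classical in
/-- Indicator of `γ ∈ {0, 1}^m`, `m - 1ᵀ γ = K`. -/
def φ₁ {nd ng m : ℕ} (N : Problem nd ng m) (γ : LineVec m) : EReal :=
  if (∀ l, γ l = 0 ∨ γ l = 1) ∧ (m : ℝ) - ∑ l, γ l = (N.K : ℝ) then 0 else ⊤

open Classical in
/-- Indicator of `0 ≤ z_d ≤ - P_d`, `- P_g ≤ z_g ≤ 0`, `1ᵀ z = 0`. -/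
def φ₂ {nd ng m : ℕ} (N : Problem nd ng m) (z : BusVec nd ng) : EReal :=
  if (∀ i : Fin nd, 0 ≤ z (Sum.inl i) ∧ z (Sum.inl i) ≤ -N.P (Sum.inl i)) ∧
      (∀ j : Fin ng, -N.P (Sum.inr j) ≤ z (Sum.inr j) ∧ z (Sum.inr j) ≤ 0) ∧
      ∑ i, z i = 0 then 0 else ⊤

open Classical in
/-- Indicator of `- π / 2 ≤ Eᵀ θ ≤ π / 2`. -/
def φ₃ {nd ng m : ℕ} (N : Problem nd ng m) (θ : BusVec nd ng) : EReal :=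
  if ∀ l, -(Real.pi / 2) ≤ N.angleDiff θ l ∧ N.angleDiff θ l ≤ Real.pi / 2 then 0 else ⊤

/-- `H_ρ` as a function of the joint variable. -/
def Hjoint {nd ng m : ℕ} (N : Problem nd ng m) (x : State nd ng m) : ℝ :=
  N.H x.fst x.snd.fst x.snd.snd

/-- The objective `Φ(γ, z, θ) = φ₁(γ) + φ₂(z) + φ₃(θ) + H_ρ(γ, z, θ)`. -/
def Φ {nd ng m : ℕ} (N : Problem nd ng m) (x : State nd ng m) : EReal :=
  N.φ₁ x.fst + N.φ₂ x.snd.fst + N.φ₃ x.snd.snd + ((N.Hjoint x : ℝ) : EReal)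

/-! ### Partial gradients and their moduli -/

/-- `∇_γ H_ρ`. -/
def gradγ {nd ng m : ℕ} (N : Problem nd ng m) (γ : LineVec m) (z θ : BusVec nd ng) : LineVec m :=
  gradient (fun γ' => N.H γ' z θ) γ

/-- `∇_z H_ρ`. -/
def gradz {nd ng m : ℕ} (N : Problem nd ng m) (γ : LineVec m) (z θ : BusVec nd ng) :
    BusVec nd ng :=
  gradient (fun z' => N.H γ z' θ) z

/-- `∇_θ H_ρ`. -/
def gradθ {nd ng m : ℕ} (N : Problem nd ng m) (γ : LineVec m) (z θ : BusVec nd ng) :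
    BusVec nd ng :=
  gradient (fun θ' => N.H γ z θ') θ

/-- `L₁(z, θ) = ρ ‖(D Eᵀ E D) ∘ (sin(Eᵀ θ) sin(Eᵀ θ)ᵀ)‖` (it does not depend on `z`). -/
def L₁ {nd ng m : ℕ} (N : Problem nd ng m) (_z θ : BusVec nd ng) : ℝ :=
  N.ρ * specNorm (Matrix.hadamard (N.D * N.E.transpose * N.E * N.D)
    (Matrix.vecMulVec (N.sinDiff θ) (N.sinDiff θ)))

/-- `L₂(γ, θ) = ρ` (it depends neither on `γ` nor on `θ`). -/
def L₂ {nd ng m : ℕ} (N : Problem nd ng m) (_γ : LineVec m) (_θ : BusVec nd ng) : ℝ :=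
  N.ρ

/-- `Q = diag(γ) D Eᵀ E D diag(γ)`. -/
def Q {nd ng m : ℕ} (N : Problem nd ng m) (γ : LineVec m) : Matrix (Fin m) (Fin m) ℝ :=
  Γ γ * N.D * N.E.transpose * N.E * N.D * Γ γ

/-- `R = diag(γ) D Eᵀ (P + z)`. -/
def R {nd ng m : ℕ} (N : Problem nd ng m) (γ : LineVec m) (z : BusVec nd ng) : LineVec m :=
  WithLp.toLp 2 (Matrix.mulVec (Γ γ * N.D * N.E.transpose) fun i => N.P i + z i)

/-- `L₃(γ, z) = ρ ‖E‖² (2 ‖Q‖ + ‖R‖)`. -/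
def L₃ {nd ng m : ℕ} (N : Problem nd ng m) (γ : LineVec m) (z : BusVec nd ng) : ℝ :=
  N.ρ * specNorm N.E ^ 2 * (2 * specNorm (N.Q γ) + ‖N.R γ z‖)

/-- The boundedness and Lipschitz conditions on `Φ` (and on its behaviour along the iterates
`(γ k, z k, θ k)`) under which the convergence of the method is studied. -/
structure LipschitzConditions {nd ng m : ℕ} (N : Problem nd ng m)
    (γ : ℕ → LineVec m) (z θ : ℕ → BusVec nd ng) : Prop where
  bddBelow_Φ : ⊥ < ⨅ x, N.Φ x
  bddBelow_φ₁ : ⊥ < ⨅ g, N.φ₁ g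
  bddBelow_φ₂ : ⊥ < ⨅ y, N.φ₂ y
  bddBelow_φ₃ : ⊥ < ⨅ t, N.φ₃ t
  lipschitz_γ : ∀ (y t : BusVec nd ng) (g₁ g₂ : LineVec m),
    ‖N.gradγ g₁ y t - N.gradγ g₂ y t‖ ≤ N.L₁ y t * ‖g₁ - g₂‖
  lipschitz_z : ∀ (g : LineVec m) (t y₁ y₂ : BusVec nd ng),
    ‖N.gradz g y₁ t - N.gradz g y₂ t‖ ≤ N.L₂ g t * ‖y₁ - y₂‖
  lipschitz_θ : ∀ (g : LineVec m) (y t₁ t₂ : BusVec nd ng),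
    ‖N.gradθ g y t₁ - N.gradθ g y t₂‖ ≤ N.L₃ g y * ‖t₁ - t₂‖
  moduli_bounded : ∃ s₁ s₂ s₃ : ℝ, 0 < s₁ ∧ 0 < s₂ ∧ 0 < s₃ ∧
    ∀ k, N.L₁ (z k) (θ k) ≤ s₁ ∧ N.L₂ (γ k) (θ k) ≤ s₂ ∧ N.L₃ (γ k) (z k) ≤ s₃
  lipschitz_bounded : ∀ S : Set (State nd ng m), Bornology.IsBounded S →
    ∃ C : NNReal, LipschitzOnWith C (gradient N.Hjoint) S

/-- `(γ k, z k, θ k)` is generated by the proximal alternating linearization method with step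
factors `r₁, r₂, r₃` and coefficients `a k = r₁ L₁`, `b k = r₂ L₂`, `c k = r₃ L₃`, which have to be
positive for the steps to make sense. The initial point is arbitrary. -/
structure IsPALM {nd ng m : ℕ} (N : Problem nd ng m) (r₁ r₂ r₃ : ℝ)
    (a b c : ℕ → ℝ) (γ : ℕ → LineVec m) (z θ : ℕ → BusVec nd ng) : Prop where
  a_eq : ∀ k, a k = r₁ * N.L₁ (z k) (θ k)
  b_eq : ∀ k, b k = r₂ * N.L₂ (γ (k + 1)) (θ k)
  c_eq : ∀ k, c k = r₃ * N.L₃ (γ (k + 1)) (z (k + 1))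
  a_pos : ∀ k, 0 < a k
  b_pos : ∀ k, 0 < b k
  c_pos : ∀ k, 0 < c k
  step_γ : ∀ k, IsMinOn (fun g => N.φ₁ g +
    ((a k / 2 * ‖g - (γ k - (1 / a k) • N.gradγ (γ k) (z k) (θ k))‖ ^ 2 : ℝ) : EReal))
    Set.univ (γ (k + 1))
  step_z : ∀ k, IsMinOn (fun y => N.φ₂ y +
    ((b k / 2 * ‖y - (z k - (1 / b k) • N.gradz (γ (k + 1)) (z k) (θ k))‖ ^ 2 : ℝ) : EReal))
    Set.univ (z (k + 1))
  step_θ : ∀ k, IsMinOn (fun t => N.φ₃ t +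
    ((c k / 2 * ‖t - (θ k - (1 / c k) • N.gradθ (γ (k + 1)) (z (k + 1)) (θ k))‖ ^ 2 : ℝ) : EReal))
    Set.univ (θ (k + 1))

end Problem

end LoadShedding

end

/-!
The iteration is a descent method, and the Kurdyka-Lojasiewicz inequality turns sufficient
decrease and subgradients bounded by the step lengths into finite length. The decrease in the `γ`
step is, however, only `(r₁ - 1) / 2 * L₁ * ‖γ' - γ‖²`, and nothing prevents `L₁(z, θ)`, which is
of the order of `‖sin(Eᵀ θ)‖²`, from approaching zero. The main point is therefore that `γ`
changes finitely often (`IsPALM.eventually_γ_eq`). After that `L₁` plays no role, and since the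
feasible set of `γ` is discrete, the `γ` component of a subgradient of `Φ` may be taken to be zero
(`mem_frechetSubdiff_Φ`).

Suppose `γ` changes infinitely often. Two distinct binary vectors have distance at least one, so
along the changes `L₁` and hence the angle differences become small. Shedding everything, `z =
-P`, is a sharp minimizer of the linear term of `H` on the feasible set, so the `z` step lands
exactly there once the flows and the `z` displacement are small (`eq_fullShed_of_nearest`). From
then on `H` is, up to constants, the square of the flow `F(γ, θ) = E D diag(γ) sin(Eᵀ θ)`, which
near zero is `A θ` with `A = E D diag(γ) Eᵀ` symmetric, and the `θ` step is an unconstrained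
gradient step, close to `θ ↦ θ - τ A² θ`. Three facts, with constants uniform over the finitely
many binary vectors, end the argument.

* The flow decreases at a linear rate in the `θ` steps (`IsPALM.flow_contraction`), so that sums
  of flows are controlled by telescoping. In particular, `‖θ‖ + C ‖F‖` does not increase, and the
  angles stay small.
* The quotient `‖A θ‖ / ‖θ‖` does not increase in exact linear steps when `τ ‖A‖² ≤ 1 / 2`
  (`rayleigh_step`), and increases by at most `C ‖F‖` in the actual ones
  (`LocalModel.angle_step`).
* Each change of `γ` lowers `‖F‖²` by a multiple of `‖θ‖²`, hence lowers the quotient by a fixed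
  amount (`LocalModel.quot_drop`).

So `‖A θ‖ / ‖θ‖ + C ‖F‖` is a nonnegative, nonincreasing potential which drops by a fixed amount
at each change of `γ` (`IsPALM.regime_step`). Angles are measured modulo the kernel of `Eᵀ`
throughout.

The modulus `L₃` needs no such care: it is bounded below because `γ` is binary and nonzero
(`exists_le_L₃`). The finite length property itself (`summable_of_kl`) also uses a potential: with
step lengths `Δ` and a desingularizing function `ψ`, the quantity `‖x (k + 1) - x*‖ + Δ k + c * ψ
(f (k + 1))` does not increase, which keeps the iterates in the neighborhood where the inequality
holds.
-/

namespace LoadShedding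

/-! ### Descent and proximal steps in inner product spaces -/

section InnerProduct

variable {V : Type*} [NormedAddCommGroup V] [InnerProductSpace ℝ V]

/-- The descent lemma. -/
theorem le_add_of_lipschitz_gradient [CompleteSpace V] {f : V → ℝ} (hf : Differentiable ℝ f)
    {L : ℝ} (hL : ∀ x y, ‖gradient f x - gradient f y‖ ≤ L * ‖x - y‖) (x y : V) :
    f y ≤ f x + inner ℝ (gradient f x) (y - x) + L / 2 * ‖y - x‖ ^ 2 := by
  set v := y - x with hv
  let p : ℝ → ℝ := fun t => f (x + t • v) - t * inner ℝ (gradient f x) v - L / 2 * t ^ 2 * ‖v‖ ^ 2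
  have hp : ∀ t, HasDerivAt p (inner ℝ (gradient f (x + t • v)) v - inner ℝ (gradient f x) v
      - L * t * ‖v‖ ^ 2) t := by
    intro t
    have h1 : HasDerivAt (fun t : ℝ => x + t • v) v t := by
      simpa using ((hasDerivAt_id t).smul_const v).const_add x
    have h2 : HasDerivAt (fun t : ℝ => f (x + t • v)) (inner ℝ (gradient f (x + t • v)) v) t := by
      have := (hf (x + t • v)).hasFDerivAt.comp_hasDerivAt t h1
      rwa [← inner_gradient_left] at this
    have h3 : HasDerivAt (fun t : ℝ => t * inner ℝ (gradient f x) v) (inner ℝ (gradient f x) v) t := by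
      simpa using (hasDerivAt_id t).mul_const (inner ℝ (gradient f x) v)
    have h4 : HasDerivAt (fun t : ℝ => L / 2 * t ^ 2 * ‖v‖ ^ 2) (L * t * ‖v‖ ^ 2) t := by
      refine (((hasDerivAt_pow 2 t).const_mul (L / 2)).mul_const (‖v‖ ^ 2)).congr_deriv ?_
      push_cast
      ring
    exact (h2.sub h3).sub h4
  have hanti : AntitoneOn p (Set.Icc 0 1) := by
    apply antitoneOn_of_deriv_nonpos (convex_Icc 0 1)
    · exact fun t _ => (hp t).continuousAt.continuousWithinAt
    · exact fun t _ => (hp t).differentiableAt.differentiableWithinAt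
    · intro t ht
      rw [interior_Icc] at ht
      rw [(hp t).deriv, ← inner_sub_left]
      have h1 := real_inner_le_norm (gradient f (x + t • v) - gradient f x) v
      have h2 := hL (x + t • v) x
      rw [add_sub_cancel_left, norm_smul, Real.norm_of_nonneg ht.1.le] at h2
      nlinarith [norm_nonneg v, mul_le_mul_of_nonneg_right h2 (norm_nonneg v)]
  have h01 := hanti (by simp) (by simp) zero_le_one
  simp only [p, one_smul, zero_smul, add_zero, hv, add_sub_cancel] at h01
  rw [hv]
  linarith

/-- A gradient step followed by a projection decreases a function with `L`-Lipschitz gradient, for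
the step coefficient `c = r * L`. -/
theorem prox_step_descent [CompleteSpace V] {f : V → ℝ} (hf : Differentiable ℝ f)
    {L r c : ℝ} (hL : ∀ x y, ‖gradient f x - gradient f y‖ ≤ L * ‖x - y‖) (hc : c = r * L)
    (hc0 : 0 < c) {u u' : V}
    (h : c / 2 * ‖u' - (u - (1 / c) • gradient f u)‖ ^ 2 ≤
      c / 2 * ‖u - (u - (1 / c) • gradient f u)‖ ^ 2) :
    f u' + (r - 1) / 2 * L * ‖u' - u‖ ^ 2 ≤ f u := by
  have h1 := le_add_of_lipschitz_gradient hf hL u u'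
  set g := gradient f u
  have h2 : ‖u' - (u - (1 / c) • g)‖ ^ 2 =
      ‖u' - u‖ ^ 2 + 2 * ((1 / c) * inner ℝ g (u' - u)) + ‖(1 / c) • g‖ ^ 2 := by
    rw [show u' - (u - (1 / c) • g) = (u' - u) + (1 / c) • g by abel, norm_add_sq_real,
      inner_smul_right, real_inner_comm]
  rw [h2, sub_sub_cancel] at h
  have h3 : c / 2 * ‖u' - u‖ ^ 2 + inner ℝ g (u' - u) ≤ 0 := by
    have : c / 2 * (2 * ((1 / c) * inner ℝ g (u' - u))) = inner ℝ g (u' - u) := by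
      field_simp
    nlinarith
  subst hc
  nlinarith

/-- A nearest point `u` to `v` in `S` satisfies the proximal normal inequality. -/
theorem inner_le_of_nearest {S : Set V} {u v : V} (h : ∀ y ∈ S, ‖u - v‖ ^ 2 ≤ ‖y - v‖ ^ 2)
    {y : V} (hy : y ∈ S) : inner ℝ (v - u) (y - u) ≤ 1 / 2 * ‖y - u‖ ^ 2 := by
  have h1 := h y hy
  rw [show y - v = (y - u) - (v - u) by abel, norm_sub_sq_real (y - u), ← norm_neg (u - v),
    neg_sub, real_inner_comm] at h1
  linarith

/-- The variational inequality for a nearest point, along a segment contained in `S`. -/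
theorem inner_nonpos_of_nearest {S : Set V} {u v y : V} (h : ∀ y ∈ S, ‖u - v‖ ^ 2 ≤ ‖y - v‖ ^ 2)
    (hS : ∀ t : ℝ, 0 < t → t ≤ 1 → u + t • (y - u) ∈ S) : inner ℝ (v - u) (y - u) ≤ 0 := by
  by_contra! hpos
  set p := inner ℝ (v - u) (y - u)
  have key : ∀ t : ℝ, 0 < t → t ≤ 1 → p ≤ t / 2 * ‖y - u‖ ^ 2 := by
    intro t ht ht1
    have := inner_le_of_nearest h (hS t ht ht1)
    rw [add_sub_cancel_left, inner_smul_right, norm_smul, Real.norm_of_nonneg ht.le, mul_pow] at this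
    have h3 : t * p ≤ t * (t / 2 * ‖y - u‖ ^ 2) := by
      calc t * p ≤ _ := this
        _ = _ := by ring
    exact le_of_mul_le_mul_left h3 ht
  set n := ‖y - u‖ ^ 2
  have hn : 0 ≤ n := sq_nonneg _
  have h1 := key (min 1 (p / (n + 1))) (lt_min one_pos (by positivity)) (min_le_left _ _)
  have h2 : min 1 (p / (n + 1)) * n ≤ p := by
    calc min 1 (p / (n + 1)) * n ≤ p / (n + 1) * n := by gcongr; exact min_le_right _ _
      _ ≤ p := by rw [div_mul_eq_mul_div, div_le_iff₀ (by linarith)]; nlinarith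
  linarith

/-! ### The Rayleigh quotient along linear gradient steps -/

/-- For a symmetric `A`, the Rayleigh quotient of `A²` does not increase along `x ↦ x - τ A² x`
when `τ ‖A‖² ≤ 1 / 2`. -/
theorem rayleigh_step {A : V →ₗ[ℝ] V} (hA : A.IsSymmetric) {Λ τ : ℝ}
    (hΛ : ∀ x, ‖A x‖ ^ 2 ≤ Λ * ‖x‖ ^ 2) (hτ : 0 ≤ τ) (hτΛ : τ * Λ ≤ 1 / 2) (x : V) :
    ‖A (x - τ • A (A x))‖ ^ 2 * ‖x‖ ^ 2 ≤ ‖A x‖ ^ 2 * ‖x - τ • A (A x)‖ ^ 2 := by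
  rcases eq_or_ne x 0 with rfl | hx
  · simp
  set m0 := ‖x‖ ^ 2 with hm0
  set m1 := ‖A x‖ ^ 2 with hm1
  have hm0pos : 0 < m0 := by positivity
  set q := m1 / m0 with hq
  have hm1q : m1 = q * m0 := by rw [hq]; field_simp
  have hq0 : 0 ≤ q := by positivity
  set M := A (A x) with hM
  -- `e` is the part of `A² x` orthogonal to `x`
  set e := M - q • x with he
  have hMe : M = q • x + e := by rw [he]; abel
  have hxM : inner ℝ x M = m1 := by
    rw [hM, ← hA x (A x), real_inner_self_eq_norm_sq]
  have hxe : inner ℝ x e = 0 := by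
    rw [he, inner_sub_right, hxM, inner_smul_right, real_inner_self_eq_norm_sq, ← hm0, hm1q]
    ring
  have hex : inner ℝ e x = 0 := by rw [real_inner_comm]; exact hxe
  have hMM : ‖M‖ ^ 2 = q * m1 + ‖e‖ ^ 2 := by
    rw [hMe, norm_add_sq_real, inner_smul_left, hxe, norm_smul, mul_pow, Real.norm_eq_abs, sq_abs,
      ← hm0, hm1q]
    simp; ring
  have hAxAM : inner ℝ (A x) (A M) = q * m1 + ‖e‖ ^ 2 := by
    rw [← hA (A x) M, ← hM, real_inner_self_eq_norm_sq, hMM]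
  have hAM : ‖A M‖ ^ 2 = q ^ 2 * m1 + 2 * q * ‖e‖ ^ 2 + ‖A e‖ ^ 2 := by
    have h1 : inner ℝ (A x) (A e) = ‖e‖ ^ 2 := by
      rw [← hA (A x) e, ← hM, hMe, inner_add_left, inner_smul_left, hxe,
        real_inner_self_eq_norm_sq]
      simp
    nth_rewrite 1 [hMe]
    rw [map_add, map_smul, norm_add_sq_real, inner_smul_left, h1, norm_smul, mul_pow,
      Real.norm_eq_abs, sq_abs, ← hm1]
    simp; ring
  have hAe := hΛ e
  have hqΛ : q ≤ Λ := by
    rw [hq, div_le_iff₀ hm0pos]; exact hΛ x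
  have e1 : ‖A (x - τ • M)‖ ^ 2 = m1 - 2 * τ * (q * m1 + ‖e‖ ^ 2) +
      τ ^ 2 * (q ^ 2 * m1 + 2 * q * ‖e‖ ^ 2 + ‖A e‖ ^ 2) := by
    rw [map_sub, map_smul, norm_sub_sq_real, inner_smul_right, hAxAM, norm_smul, mul_pow,
      Real.norm_eq_abs, sq_abs, hAM, ← hm1]
    ring
  have e2 : ‖x - τ • M‖ ^ 2 = m0 - 2 * τ * m1 + τ ^ 2 * (q * m1 + ‖e‖ ^ 2) := by
    rw [norm_sub_sq_real, inner_smul_right, hxM, norm_smul, mul_pow,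
      Real.norm_eq_abs, sq_abs, hMM, ← hm0]
    ring
  rw [e1, e2]
  have key : τ * (q * ‖e‖ ^ 2 + ‖A e‖ ^ 2) ≤ 2 * ‖e‖ ^ 2 := by
    have h1 : τ * ‖A e‖ ^ 2 ≤ τ * (Λ * ‖e‖ ^ 2) := mul_le_mul_of_nonneg_left hAe hτ
    have h2 : τ * q ≤ τ * Λ := mul_le_mul_of_nonneg_left hqΛ hτ
    nlinarith [sq_nonneg ‖e‖]
  have key2 : 0 ≤ τ * m0 * (2 * ‖e‖ ^ 2 - τ * (q * ‖e‖ ^ 2 + ‖A e‖ ^ 2)) := by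
    apply mul_nonneg (by positivity); linarith
  rw [hm1q]
  nlinarith

end InnerProduct

/-- The Rayleigh quotient along an inexact linear gradient step. -/
theorem rayleigh_step_perturbed {V : Type*} [NormedAddCommGroup V] [InnerProductSpace ℝ V]
    {A : V →ₗ[ℝ] V} (hA : A.IsSymmetric) {Λ τ a η : ℝ} (hΛ0 : 0 ≤ Λ)
    (hΛ : ∀ x, ‖A x‖ ^ 2 ≤ Λ * ‖x‖ ^ 2) (ha : ∀ x, ‖A x‖ ≤ a * ‖x‖) (ha0 : 0 ≤ a)
    (hτ : 0 ≤ τ) (hτΛ : τ * Λ ≤ 1 / 2) (hη : η ≤ 1 / 4) {x x' : V} (hx : x ≠ 0)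
    (hx' : ‖x' - (x - τ • A (A x))‖ ≤ η * ‖x‖) :
    ‖A x'‖ / ‖x'‖ ≤ ‖A x‖ / ‖x‖ + 8 * a * η := by
  have hpos : 0 < ‖x‖ := norm_pos_iff.2 hx
  have hη0 : 0 ≤ η := nonneg_of_mul_nonneg_left ((norm_nonneg _).trans hx') hpos
  set x₁ := x - τ • A (A x) with hx₁
  set σ := ‖A x‖ / ‖x‖ with hσ
  have hσ0 : 0 ≤ σ := by positivity
  have hσa : σ ≤ a := by rw [hσ, div_le_iff₀ hpos]; exact ha x
  have hAx : ‖A x‖ = σ * ‖x‖ := by rw [hσ]; field_simp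
  have hray : ‖A x₁‖ ≤ σ * ‖x₁‖ := by
    have h := rayleigh_step hA hΛ hτ hτΛ x
    rw [← hx₁, hAx] at h
    refine (sq_le_sq₀ (norm_nonneg _) (by positivity)).1 ?_
    refine le_of_mul_le_mul_right (a := ‖x‖ ^ 2) ?_ (by positivity)
    linarith [h]
  have hAA : ‖A (A x)‖ ≤ Λ * ‖x‖ := by
    refine (sq_le_sq₀ (norm_nonneg _) (by positivity)).1 ?_
    calc ‖A (A x)‖ ^ 2 ≤ Λ * ‖A x‖ ^ 2 := hΛ _
      _ ≤ Λ * (Λ * ‖x‖ ^ 2) := by gcongr; exact hΛ x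
      _ = _ := by ring
  have hx₁ge : 1 / 2 * ‖x‖ ≤ ‖x₁‖ := by
    have h1 : ‖τ • A (A x)‖ ≤ 1 / 2 * ‖x‖ := by
      rw [norm_smul, Real.norm_of_nonneg hτ]
      calc τ * ‖A (A x)‖ ≤ τ * (Λ * ‖x‖) := by gcongr
        _ = τ * Λ * ‖x‖ := by ring
        _ ≤ _ := by gcongr
    have h2 := norm_sub_norm_le x (τ • A (A x))
    linarith
  have htri : ‖x₁‖ ≤ ‖x'‖ + η * ‖x‖ := by
    have := norm_sub_norm_le x₁ x'
    rw [norm_sub_rev x₁ x'] at this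
    linarith
  have hx'ge : 1 / 4 * ‖x‖ ≤ ‖x'‖ := by nlinarith
  have hx'pos : 0 < ‖x'‖ := by linarith
  have hAx' : ‖A x'‖ ≤ ‖A x₁‖ + a * (η * ‖x‖) := by
    have h1 : A x' = A x₁ + A (x' - x₁) := by rw [← map_add]; congr 1; abel
    rw [h1]
    refine (norm_add_le _ _).trans ?_
    gcongr
    exact (ha _).trans (by gcongr)
  rw [div_le_iff₀ hx'pos]
  have h1 : σ * ‖x₁‖ ≤ σ * (‖x'‖ + η * ‖x‖) := by gcongr
  have h2 : σ * (η * ‖x‖) ≤ a * (η * ‖x‖) := by gcongr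
  have h3 : a * (η * ‖x‖) ≤ a * (η * (4 * ‖x'‖)) := by gcongr; linarith
  nlinarith

/-- A linear map is dominated by any other whose kernel is contained in its own. -/
theorem exists_norm_le_of_ker_le {V W W' : Type*} [NormedAddCommGroup V] [NormedSpace ℝ V]
    [NormedAddCommGroup W] [NormedSpace ℝ W] [FiniteDimensional ℝ W]
    [NormedAddCommGroup W'] [NormedSpace ℝ W']
    (f : V →ₗ[ℝ] W') (g : V →ₗ[ℝ] W) (h : ∀ x, g x = 0 → f x = 0) :
    ∃ C : ℝ, 0 < C ∧ ∀ x, ‖f x‖ ≤ C * ‖g x‖ := by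
  obtain ⟨k, hk⟩ : ∃ k : W →ₗ[ℝ] W', k ∘ₗ g = f := by
    have hker : LinearMap.ker g ≤ LinearMap.ker f := fun x hx => h x hx
    let f' := (LinearMap.ker g).liftQ f hker
    let f'' : LinearMap.range g →ₗ[ℝ] W' := f' ∘ₗ g.quotKerEquivRange.symm.toLinearMap
    obtain ⟨k, hk⟩ := f''.exists_extend
    refine ⟨k, ?_⟩
    ext x
    have h1 : k (g x) = f'' ⟨g x, LinearMap.mem_range_self g x⟩ := by
      rw [← hk]; rfl
    have h2 : g.quotKerEquivRange.symm ⟨g x, LinearMap.mem_range_self g x⟩ =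
        (LinearMap.ker g).mkQ x := by
      rw [LinearEquiv.symm_apply_eq]; rfl
    simp only [LinearMap.comp_apply, h1, f'', LinearEquiv.coe_coe, h2, f']
    exact Submodule.liftQ_apply _ _ _
  refine ⟨‖LinearMap.toContinuousLinearMap k‖ + 1, by positivity, fun x => ?_⟩
  rw [← hk]
  calc ‖k (g x)‖ ≤ ‖LinearMap.toContinuousLinearMap k‖ * ‖g x‖ :=
        (LinearMap.toContinuousLinearMap k).le_opNorm (g x)
    _ ≤ _ := by gcongr; linarith

/-! ### Topology of Euclidean products -/

theorem finiteDimensional_prod (F G : Type*) [NormedAddCommGroup F] [InnerProductSpace ℝ F]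
    [NormedAddCommGroup G] [InnerProductSpace ℝ G] [FiniteDimensional ℝ F] [FiniteDimensional ℝ G] :
    FiniteDimensional ℝ (WithLp 2 (F × G)) :=
  (WithLp.linearEquiv 2 ℝ (F × G)).symm.finiteDimensional

theorem properSpace_prod (F G : Type*) [NormedAddCommGroup F] [InnerProductSpace ℝ F]
    [NormedAddCommGroup G] [InnerProductSpace ℝ G] [FiniteDimensional ℝ F] [FiniteDimensional ℝ G] :
    ProperSpace (WithLp 2 (F × G)) :=
  haveI := finiteDimensional_prod F G
  FiniteDimensional.proper_real _

theorem continuous_of_differentiable {V : Type*} [NormedAddCommGroup V] [InnerProductSpace ℝ V]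
    {f : V → ℝ} (hf : Differentiable ℝ f) : Continuous f := hf.continuous

/-! ### Potential arguments for real sequences -/

/-- A sequence that is bounded below and never increases, and drops by a fixed amount whenever `p`
holds, meets `p` finitely often. -/
theorem eventually_not_of_drop {V : ℕ → ℝ} {p : ℕ → Prop} {c B : ℝ} (hc : 0 < c) {K : ℕ}
    (hB : ∀ k, K ≤ k → B ≤ V k) (hmono : ∀ k, K ≤ k → V (k + 1) ≤ V k)
    (hdrop : ∀ k, K ≤ k → p k → V (k + 1) ≤ V k - c) : ∀ᶠ k in atTop, ¬ p k := by
  have hanti : Antitone fun j => V (K + j) := antitone_nat_of_succ_le fun j => hmono (K + j) (by omega)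
  have hbdd : BddBelow (Set.range fun j => V (K + j)) :=
    ⟨B, by rintro _ ⟨j, rfl⟩; exact hB _ (by omega)⟩
  have hlim := tendsto_atTop_ciInf hanti hbdd
  have hdiff : Tendsto (fun j => V (K + j) - V (K + (j + 1))) atTop (𝓝 0) := by
    simpa using hlim.sub (hlim.comp (tendsto_add_atTop_nat 1))
  obtain ⟨J, hJ⟩ := eventually_atTop.1 (hdiff.eventually (gt_mem_nhds hc))
  filter_upwards [eventually_ge_atTop (K + J)] with k hk hpk
  have h1 := hJ (k - K) (by omega)
  have h2 := hdrop k (by omega) hpk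
  rw [show K + (k - K) = k by omega, show K + (k - K + 1) = k + 1 by omega] at h1
  linarith

/-- A quantity dominated by the decrements of a sequence that is bounded below tends to zero. -/
theorem tendsto_zero_of_le_decrement {u h : ℕ → ℝ} {C B : ℝ} (hu : ∀ k, 0 ≤ u k)
    (hB : ∀ k, 1 ≤ k → B ≤ h k) (hh : ∀ k, 1 ≤ k → h (k + 1) ≤ h k)
    (hle : ∀ k, 1 ≤ k → u k ≤ C * (h k - h (k + 1))) : Tendsto u atTop (𝓝 0) := by
  have hanti : Antitone fun j => h (j + 1) := antitone_nat_of_succ_le fun j => hh _ (by omega)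
  have hlim := tendsto_atTop_ciInf hanti ⟨B, by rintro _ ⟨j, rfl⟩; exact hB _ (by omega)⟩
  have hd : Tendsto (fun j => C * (h (j + 1) - h (j + 1 + 1))) atTop (𝓝 0) := by
    simpa using (hlim.sub (hlim.comp (tendsto_add_atTop_nat 1))).const_mul C
  rw [← tendsto_add_atTop_iff_nat 1]
  exact squeeze_zero (fun j => hu _) (fun j => hle _ (by omega)) hd

/-- A sufficient decrease of squares gives a linear rate. -/
theorem le_one_sub_mul_of_sq {t t' μ₁ : ℝ} (ht' : 0 ≤ t')
    (h : t ^ 2 ≤ (1 - μ₁) * t' ^ 2) : t ≤ (1 - min μ₁ 1 / 2) * t' := by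
  set μ := min μ₁ 1 / 2 with hμ
  have hμ1 : μ ≤ 1 / 2 := by rw [hμ]; linarith [min_le_right μ₁ 1]
  have hμ2 : 2 * μ ≤ μ₁ := by rw [hμ]; linarith [min_le_left μ₁ 1]
  refine abs_le_of_sq_le_sq ?_ (mul_nonneg (by linarith) ht') |> (le_abs_self _).trans
  rw [mul_pow]
  refine h.trans ?_
  gcongr
  nlinarith [sq_nonneg μ]

/-- The finite length property: a sequence with a cluster point along which a quantity `f ↓ 0`
decreases quadratically in the step length and satisfies a Kurdyka-Lojasiewicz
inequality near the cluster point has summable steps. -/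
theorem summable_of_kl {V : Type*} [NormedAddCommGroup V] {x : ℕ → V} {f : ℕ → ℝ}
    {xs : V} {α β r : ℝ} {η : EReal} {ψ : ℝ → ℝ} (hα : 0 < α) (hβ : 0 < β) (hr : 0 < r) (hη : 0 < η)
    (hψ : IsDesingularizing η ψ) (hcl : MapClusterPt xs atTop x)
    (hpos : ∀ k, 0 < f k) (hlim : Tendsto f atTop (𝓝 0))
    (hdec : ∀ k, α * ‖x (k + 1) - x k‖ ^ 2 ≤ f k - f (k + 1))
    (hkl : ∀ k, ‖x (k + 1) - xs‖ < r → (f (k + 1) : EReal) < η →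
      1 ≤ deriv ψ (f (k + 1)) * (β * ‖x (k + 1) - x k‖)) :
    Summable fun k => ‖x (k + 1) - x k‖ := by
  set Δ : ℕ → ℝ := fun k => ‖x (k + 1) - x k‖ with hΔ
  have hΔ0 : ∀ k, 0 ≤ Δ k := fun k => norm_nonneg _
  have hmono : ∀ k, f (k + 1) ≤ f k := fun k => by
    have := hdec k; nlinarith [sq_nonneg (Δ k)]
  have hfanti : Antitone f := antitone_nat_of_succ_le hmono
  -- eventually `f k < η`
  have hev : ∀ᶠ k in atTop, (f k : EReal) < η := by
    have : Tendsto (fun k => ((f k : ℝ) : EReal)) atTop (𝓝 ((0 : ℝ) : EReal)) :=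
      (continuous_coe_real_ereal.tendsto 0).comp hlim
    exact this.eventually (gt_mem_nhds (by simpa using hη))
  obtain ⟨K0, hK0⟩ := eventually_atTop.1 hev
  have hψnn : ∀ t : ℝ, 0 ≤ t → (t : EReal) < η → 0 ≤ ψ t := by
    intro t ht htη
    have hmon : MonotoneOn ψ (Set.Icc 0 t) := by
      have hsub : ∀ s ∈ Set.Icc 0 t, (s : EReal) < η := fun s hs =>
        lt_of_le_of_lt (by exact_mod_cast hs.2) htη
      apply monotoneOn_of_deriv_nonneg (convex_Icc 0 t)
      · exact hψ.continuousOn.mono fun s hs => ⟨hs.1, hsub s hs⟩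
      · intro s hs
        rw [interior_Icc] at hs
        have hsη := hsub s ⟨hs.1.le, hs.2.le⟩
        have hne := hψ.deriv_pos s hs.1 hsη
        exact (differentiableAt_of_deriv_ne_zero hne.ne').differentiableWithinAt
      · intro s hs
        rw [interior_Icc] at hs
        exact (hψ.deriv_pos s hs.1 (hsub s ⟨hs.1.le, hs.2.le⟩)).le
    have := hmon ⟨le_rfl, ht⟩ ⟨ht, le_rfl⟩ ht
    rwa [hψ.map_zero] at this
  have hψlim : Tendsto (fun k => ψ (f k)) atTop (𝓝 0) := by
    have h0 : ContinuousWithinAt ψ {t : ℝ | 0 ≤ t ∧ (t : EReal) < η} 0 :=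
      hψ.continuousOn 0 ⟨le_rfl, by simpa using hη⟩
    have h1 : Tendsto f atTop (𝓝[{t : ℝ | 0 ≤ t ∧ (t : EReal) < η}] 0) :=
      tendsto_nhdsWithin_iff.2 ⟨hlim, by
        filter_upwards [hev] with k hk using ⟨(hpos k).le, hk⟩⟩
    have := h0.tendsto.comp h1
    rwa [hψ.map_zero] at this
  have hΔlim : Tendsto Δ atTop (𝓝 0) := by
    have h1 : Tendsto (fun k => (f k - f (k + 1)) / α) atTop (𝓝 0) := by
      simpa using (hlim.sub (hlim.comp (tendsto_add_atTop_nat 1))).div_const α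
    have h2 : Tendsto (fun k => Δ k ^ 2) atTop (𝓝 0) :=
      squeeze_zero (fun k => sq_nonneg _) (fun k => by
        rw [le_div_iff₀ hα]; have := hdec k; simp only [hΔ]; linarith) h1
    have h3 := h2.sqrt
    simpa [Real.sqrt_sq (hΔ0 _)] using h3
  -- the one-step estimate
  set c := β / α with hc
  have hc0 : 0 < c := by positivity
  set S : ℕ → ℝ := fun k => Δ k + c * ψ (f (k + 1)) with hS
  have hS0 : ∀ k, K0 ≤ k → 0 ≤ S k := fun k hk =>
    add_nonneg (hΔ0 k) (mul_nonneg hc0.le (hψnn _ (hpos _).le (hK0 _ (by omega))))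
  have hstep : ∀ k, K0 ≤ k → ‖x (k + 1) - xs‖ < r → Δ (k + 1) ≤ S k - S (k + 1) := by
    intro k hk hxk
    have hη1 := hK0 (k + 1) (by omega)
    have hη2 := hK0 (k + 2) (by omega)
    have h1 := hkl k hxk hη1
    set p := deriv ψ (f (k + 1))
    have hp : 0 < p := hψ.deriv_pos _ (hpos _) hη1
    have hconc : p * (f (k + 1) - f (k + 2)) ≤ ψ (f (k + 1)) - ψ (f (k + 2)) := by
      rcases (hmono (k + 1)).lt_or_eq with hlt | heq
      · have hd : HasDerivAt ψ p (f (k + 1)) :=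
          (differentiableAt_of_deriv_ne_zero hp.ne').hasDerivAt
        have := hψ.concaveOn.le_slope_of_hasDerivAt ⟨(hpos (k + 2)).le, hη2⟩
          ⟨(hpos (k + 1)).le, hη1⟩ hlt hd
        rw [slope_def_field, le_div_iff₀ (by linarith)] at this
        linarith
      · rw [show k + 2 = k + 1 + 1 from rfl, heq]; simp
    set D := ψ (f (k + 1)) - ψ (f (k + 2)) with hD
    have h2 := hdec (k + 1)
    have h3 : p * (α * Δ (k + 1) ^ 2) ≤ D := le_trans (mul_le_mul_of_nonneg_left h2 hp.le) hconc
    have h4 : Δ (k + 1) ^ 2 ≤ c * D * Δ k := by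
      have h5 : Δ (k + 1) ^ 2 ≤ p * (β * Δ k) * Δ (k + 1) ^ 2 :=
        le_mul_of_one_le_left (sq_nonneg _) h1
      have h6 : p * (β * Δ k) * Δ (k + 1) ^ 2 = c * Δ k * (p * (α * Δ (k + 1) ^ 2)) := by
        rw [hc]; field_simp
      rw [h6] at h5
      have h7 := mul_le_mul_of_nonneg_left h3 (mul_nonneg hc0.le (hΔ0 k))
      linarith
    have h8 : 2 * Δ (k + 1) ≤ Δ k + c * D := by
      have hD0 : 0 ≤ D := le_trans (by positivity) h3
      have hcD : 0 ≤ c * D := by positivity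
      apply abs_le_of_sq_le_sq' _ (by linarith [hΔ0 k]) |>.2
      nlinarith [sq_nonneg (Δ k - c * D)]
    simp only [hS]
    have : c * D = c * ψ (f (k + 1)) - c * ψ (f (k + 2)) := by rw [hD]; ring
    linarith
  -- a late index at which the iterate is close to the cluster point
  have hSlim : Tendsto S atTop (𝓝 0) := by
    simpa using hΔlim.add ((hψlim.comp (tendsto_add_atTop_nat 1)).const_mul c)
  obtain ⟨K1, hK1⟩ := eventually_atTop.1 (hSlim.eventually (gt_mem_nhds (half_pos hr)))
  obtain ⟨K, hKge, hKx⟩ : ∃ K, K0 + K1 ≤ K ∧ ‖x (K + 1) - xs‖ < r / 2 := by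
    have := hcl.frequently (Metric.ball_mem_nhds xs (half_pos hr))
    obtain ⟨j, hj, hjx⟩ := frequently_atTop.1 this (K0 + K1 + 1)
    refine ⟨j - 1, by omega, ?_⟩
    rw [show j - 1 + 1 = j by omega, ← dist_eq_norm]
    exact hjx
  have hind : ∀ j, ‖x (K + j + 1) - xs‖ + S (K + j) < r := by
    intro j
    induction j with
    | zero => have := hK1 K (by omega); simp only [add_zero]; linarith
    | succ j ih =>
      have hs := hstep (K + j) (by omega) (by linarith [hS0 (K + j) (by omega)])
      have htri : ‖x (K + (j + 1) + 1) - xs‖ ≤ Δ (K + j + 1) + ‖x (K + j + 1) - xs‖ := by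
        have := norm_add_le (x (K + j + 1 + 1) - x (K + j + 1)) (x (K + j + 1) - xs)
        rwa [sub_add_sub_cancel] at this
      rw [show K + (j + 1) = K + j + 1 by omega] at *
      linarith
  have hsum : Summable fun j => Δ (j + (K + 1)) := by
    apply summable_of_sum_range_le (c := S K) (fun j => hΔ0 _)
    intro n
    have : ∀ n, ∑ i ∈ Finset.range n, Δ (i + (K + 1)) ≤ S K - S (K + n) := by
      intro n
      induction n with
      | zero => simp
      | succ n ih =>
        rw [Finset.sum_range_succ]
        have hs := hstep (K + n) (by omega) (by linarith [hind n, hS0 (K + n) (by omega)])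
        rw [show n + (K + 1) = K + n + 1 by omega, show K + (n + 1) = K + n + 1 by omega]
        linarith
    linarith [this n, hS0 (K + n) (by omega)]
  exact (summable_nat_add_iff (K + 1)).1 hsum

namespace Problem

noncomputable section

variable {nd ng m : ℕ} (N : Problem nd ng m)

/-! ### The flow operator and the gradients of the penalty function -/

/-- The incidence matrix as a linear operator. -/
def incid : LineVec m →L[ℝ] BusVec nd ng :=
  LinearMap.toContinuousLinearMap (Matrix.toEuclideanLin N.E)

/-- The transposed incidence matrix as a linear operator. -/
def incidT : BusVec nd ng →L[ℝ] LineVec m :=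
  LinearMap.toContinuousLinearMap (Matrix.toEuclideanLin N.E.transpose)

/-- Componentwise multiplication by the vector `a`. -/
def diagOp (a : Fin m → ℝ) : LineVec m →L[ℝ] LineVec m :=
  LinearMap.toContinuousLinearMap (Matrix.toEuclideanLin (Matrix.diagonal a))

@[simp] theorem diagOp_apply (a : Fin m → ℝ) (y : LineVec m) (l : Fin m) :
    diagOp a y l = a l * y l := by
  simp [diagOp, Matrix.mulVec_diagonal]

theorem inner_diagOp (a : Fin m → ℝ) (x y : LineVec m) :
    inner ℝ (diagOp a x) y = inner ℝ x (diagOp a y) := by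
  simp only [PiLp.inner_apply, diagOp_apply, RCLike.inner_apply, conj_trivial]
  exact Finset.sum_congr rfl fun l _ => by ring

theorem inner_incid (y : LineVec m) (x : BusVec nd ng) :
    inner ℝ (N.incid y) x = inner ℝ y (N.incidT x) := by
  have h := Matrix.toEuclideanLin_conjTranspose_eq_adjoint N.E
  rw [Matrix.conjTranspose_eq_transpose_of_trivial] at h
  simp only [incid, incidT, LinearMap.coe_toContinuousLinearMap', h]
  rw [LinearMap.adjoint_inner_right]

theorem angleDiff_eq (θ : BusVec nd ng) (l : Fin m) : N.angleDiff θ l = N.incidT θ l := by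
  simp [angleDiff, incidT]

/-- The vector `sin(Eᵀ θ)` in the space of line variables. -/
def sinVec (θ : BusVec nd ng) : LineVec m := WithLp.toLp 2 (N.sinDiff θ)

theorem sinVec_apply (θ : BusVec nd ng) (l : Fin m) :
    N.sinVec θ l = Real.sin (N.incidT θ l) := by
  simp [sinVec, sinDiff, angleDiff_eq]

/-- The operator `D diag(γ)`. -/
def weight (γ : LineVec m) : LineVec m →L[ℝ] LineVec m := diagOp fun l => N.adm l * γ l

/-- The nodal power flow `E D diag(γ) sin(Eᵀ θ)`. -/
def flow (γ : LineVec m) (θ : BusVec nd ng) : BusVec nd ng :=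
  N.incid (N.weight γ (N.sinVec θ))

/-- The injections after shedding, `P + z`. -/
def shifted (z : BusVec nd ng) : BusVec nd ng := WithLp.toLp 2 N.P + z

theorem mulVec_flow (γ : LineVec m) (θ : BusVec nd ng) (i : Bus nd ng) :
    Matrix.mulVec (N.E * N.D * Γ γ) (N.sinDiff θ) i = N.flow γ θ i := by
  have h : N.flow γ θ i = Matrix.mulVec N.E (N.weight γ (N.sinVec θ)).ofLp i := by
    simp [flow, incid]
  rw [h, Matrix.mul_assoc, ← Matrix.mulVec_mulVec, D, Γ, Matrix.diagonal_mul_diagonal]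
  refine congrArg (fun v => Matrix.mulVec N.E v i) ?_
  funext l
  simp [Matrix.mulVec_diagonal, weight, sinVec]

theorem residual_eq (γ : LineVec m) (z θ : BusVec nd ng) :
    N.residual γ z θ = N.flow γ θ - N.shifted z := by
  ext i
  simp [residual, mulVec_flow, shifted]

/-- The indicator vector of the load buses. -/
def loadVec (nd ng : ℕ) : BusVec nd ng := WithLp.toLp 2 (Sum.elim (fun _ => 1) fun _ => 0)

theorem inner_loadVec (z : BusVec nd ng) :
    inner ℝ (loadVec nd ng) z = ∑ i : Fin nd, z (Sum.inl i) := by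
  simp [loadVec, PiLp.inner_apply, Fintype.sum_sum_type]

theorem H_eq (γ : LineVec m) (z θ : BusVec nd ng) :
    N.H γ z θ = -inner ℝ (loadVec nd ng) z +
      N.ρ / 2 * ‖N.flow γ θ - N.shifted z‖ ^ 2 := by
  rw [H, residual_eq, inner_loadVec]

theorem hasFDerivAt_sinVec (θ : BusVec nd ng) :
    HasFDerivAt N.sinVec
      ((diagOp fun l => Real.cos (N.incidT θ l)) ∘L N.incidT) θ := by
  refine HasStrictFDerivAt.hasFDerivAt ?_
  rw [hasStrictFDerivAt_piLp]
  intro l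
  have h1 : HasStrictFDerivAt (fun θ : BusVec nd ng => N.incidT θ l)
      (PiLp.proj 2 (fun _ : Fin m => ℝ) l ∘L N.incidT) θ :=
    (PiLp.proj 2 (fun _ : Fin m => ℝ) l ∘L N.incidT).hasStrictFDerivAt
  have h2 := h1.sin
  simp only [← sinVec_apply] at h2
  refine h2.congr_fderiv ?_
  ext v
  simp

theorem differentiable_flow :
    Differentiable ℝ fun x : State nd ng m => N.flow x.fst x.snd.snd := by
  have hsnd : Differentiable ℝ fun x : State nd ng m => x.snd.snd :=
    ((WithLp.sndL 2 ℝ (BusVec nd ng) (BusVec nd ng)) ∘L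
      (WithLp.sndL 2 ℝ (LineVec m) (WithLp 2 (BusVec nd ng × BusVec nd ng)))).differentiable
  have hfst : Differentiable ℝ fun x : State nd ng m => x.fst :=
    (WithLp.fstL 2 ℝ (LineVec m) (WithLp 2 (BusVec nd ng × BusVec nd ng))).differentiable
  have hs : Differentiable ℝ fun x : State nd ng m => N.sinVec x.snd.snd :=
    fun x => ((N.hasFDerivAt_sinVec _).differentiableAt).comp x (hsnd x)
  refine N.incid.differentiable.comp ?_
  rw [differentiable_piLp]
  intro l
  simp only [weight, diagOp_apply]
  have h1 : Differentiable ℝ fun x : State nd ng m => x.fst l :=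
    (differentiable_piLp 2).1 hfst l
  have h2 : Differentiable ℝ fun x : State nd ng m => N.sinVec x.snd.snd l :=
    (differentiable_piLp 2).1 hs l
  exact ((differentiable_const _).mul h1).mul h2

theorem differentiable_Hjoint : Differentiable ℝ N.Hjoint := by
  have hz : Differentiable ℝ fun x : State nd ng m => x.snd.fst :=
    ((WithLp.fstL 2 ℝ (BusVec nd ng) (BusVec nd ng)) ∘L
      (WithLp.sndL 2 ℝ (LineVec m) (WithLp 2 (BusVec nd ng × BusVec nd ng)))).differentiable
  have h : N.Hjoint = fun x : State nd ng m => -inner ℝ (loadVec nd ng) x.snd.fst +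
      N.ρ / 2 * ‖N.flow x.fst x.snd.snd - (WithLp.toLp 2 N.P + x.snd.fst)‖ ^ 2 := by
    funext x; rw [Hjoint, H_eq]; rfl
  rw [h]
  refine ((differentiable_const _).inner ℝ hz).neg.add (Differentiable.const_mul ?_ _)
  exact (N.differentiable_flow.sub ((differentiable_const _).add hz)).norm_sq ℝ

theorem mkState_add (γ γ' : LineVec m) (z z' θ θ' : BusVec nd ng) :
    (mkState γ z θ + mkState γ' z' θ' : State nd ng m) = mkState (γ + γ') (z + z') (θ + θ') := rfl

/-- The pairing map onto a Euclidean product, as a continuous linear map. -/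
def pairL (F G : Type*) [NormedAddCommGroup F] [InnerProductSpace ℝ F] [NormedAddCommGroup G]
    [InnerProductSpace ℝ G] : F × G →L[ℝ] WithLp 2 (F × G) :=
  (WithLp.prodContinuousLinearEquiv 2 ℝ F G).symm.toContinuousLinearMap

/-- The embedding of the first coordinate into the space of triples. -/
def embγ : LineVec m →L[ℝ] State nd ng m :=
  pairL _ _ ∘L ContinuousLinearMap.inl ℝ _ _

theorem embγ_apply (v : LineVec m) : (embγ v : State nd ng m) = mkState v 0 0 := rfl

/-- The embedding of the second coordinate. -/
def embz : BusVec nd ng →L[ℝ] State nd ng m :=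
  pairL _ _ ∘L ContinuousLinearMap.inr ℝ _ _ ∘L pairL _ _ ∘L ContinuousLinearMap.inl ℝ _ _

theorem embz_apply (v : BusVec nd ng) : (embz v : State nd ng m) = mkState 0 v 0 := rfl

/-- The embedding of the third coordinate. -/
def embθ : BusVec nd ng →L[ℝ] State nd ng m :=
  pairL _ _ ∘L ContinuousLinearMap.inr ℝ _ _ ∘L pairL _ _ ∘L ContinuousLinearMap.inr ℝ _ _

theorem embθ_apply (v : BusVec nd ng) : (embθ v : State nd ng m) = mkState 0 0 v := rfl

theorem inner_mkState (x : State nd ng m) (v : LineVec m) (w u : BusVec nd ng) :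
    inner ℝ x (mkState v w u) =
      inner ℝ x.fst v + inner ℝ x.snd.fst w + inner ℝ x.snd.snd u := by
  rw [WithLp.prod_inner_apply, WithLp.prod_inner_apply, add_assoc]
  rfl

theorem norm_sq_mkState_sub (γ γ' : LineVec m) (z z' θ θ' : BusVec nd ng) :
    ‖(mkState γ z θ - mkState γ' z' θ' : State nd ng m)‖ ^ 2 =
      ‖γ - γ'‖ ^ 2 + ‖z - z'‖ ^ 2 + ‖θ - θ'‖ ^ 2 := by
  rw [WithLp.prod_norm_sq_eq_of_L2, WithLp.prod_norm_sq_eq_of_L2, add_assoc]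
  rfl

/-- The gradient of a section of `Hjoint` along an affine embedding of a coordinate. -/
theorem hasGradientAt_section {F : Type*} [NormedAddCommGroup F] [InnerProductSpace ℝ F]
    [CompleteSpace F] (e : F →L[ℝ] State nd ng m) (x₀ : State nd ng m)
    (u g : F)
    (hg : ∀ v, inner ℝ (gradient N.Hjoint (x₀ + e u)) (e v) = inner ℝ g v) :
    HasGradientAt (fun u => N.Hjoint (x₀ + e u)) g u := by
  rw [hasGradientAt_iff_hasFDerivAt]
  have h1 : HasFDerivAt (fun u => x₀ + e u) e u := e.hasFDerivAt.const_add x₀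
  refine ((N.differentiable_Hjoint (x₀ + e u)).hasFDerivAt.comp u h1).congr_fderiv ?_
  ext v
  rw [ContinuousLinearMap.comp_apply, ← inner_gradient_left, hg, InnerProductSpace.toDual_apply_apply]

theorem hasGradientAt_γ (γ : LineVec m) (z θ : BusVec nd ng) :
    HasGradientAt (fun γ' => N.H γ' z θ) (gradient N.Hjoint (mkState γ z θ)).fst γ := by
  have hx : ∀ v, mkState v z θ = (mkState 0 z θ : State nd ng m) + embγ v := fun v => by
    simp [embγ_apply, mkState_add]
  have := N.hasGradientAt_section embγ (mkState 0 z θ) γ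
    (gradient N.Hjoint (mkState γ z θ)).fst (fun v => by
      rw [← hx, embγ_apply, inner_mkState]; simp)
  simp only [← hx] at this
  exact this

theorem hasGradientAt_z (γ : LineVec m) (z θ : BusVec nd ng) :
    HasGradientAt (fun z' => N.H γ z' θ) (gradient N.Hjoint (mkState γ z θ)).snd.fst z := by
  have hx : ∀ v, mkState γ v θ = (mkState γ 0 θ : State nd ng m) + embz v := fun v => by
    simp [embz_apply, mkState_add]
  have := N.hasGradientAt_section embz (mkState γ 0 θ) z
    (gradient N.Hjoint (mkState γ z θ)).snd.fst (fun v => by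
      rw [← hx, embz_apply, inner_mkState]; simp)
  simp only [← hx] at this
  exact this

theorem hasGradientAt_θ (γ : LineVec m) (z θ : BusVec nd ng) :
    HasGradientAt (fun θ' => N.H γ z θ') (gradient N.Hjoint (mkState γ z θ)).snd.snd θ := by
  have hx : ∀ v, mkState γ z v = (mkState γ z 0 : State nd ng m) + embθ v := fun v => by
    simp [embθ_apply, mkState_add]
  have := N.hasGradientAt_section embθ (mkState γ z 0) θ
    (gradient N.Hjoint (mkState γ z θ)).snd.snd (fun v => by
      rw [← hx, embθ_apply, inner_mkState]; simp)
  simp only [← hx] at this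
  exact this

theorem gradz_eq (γ : LineVec m) (z θ : BusVec nd ng) :
    N.gradz γ z θ = (gradient N.Hjoint (mkState γ z θ)).snd.fst := (N.hasGradientAt_z γ z θ).gradient

theorem gradθ_eq (γ : LineVec m) (z θ : BusVec nd ng) :
    N.gradθ γ z θ = (gradient N.Hjoint (mkState γ z θ)).snd.snd := (N.hasGradientAt_θ γ z θ).gradient

theorem gradz_formula (γ : LineVec m) (z θ : BusVec nd ng) :
    N.gradz γ z θ = -loadVec nd ng - N.ρ • (N.flow γ θ - N.shifted z) := by
  apply HasGradientAt.gradient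
  rw [hasGradientAt_iff_hasFDerivAt]
  simp only [H_eq]
  have h1 : HasFDerivAt (fun z => N.flow γ θ - N.shifted z)
      (-(ContinuousLinearMap.id ℝ (BusVec nd ng))) z :=
    ((hasFDerivAt_id z).const_add _).const_sub _
  have h2 := h1.norm_sq.const_mul (N.ρ / 2)
  have h3 : HasFDerivAt (fun z => inner ℝ (loadVec nd ng) z) (innerSL ℝ (loadVec nd ng)) z :=
    (innerSL ℝ (loadVec nd ng)).hasFDerivAt
  refine (h3.neg.add h2).congr_fderiv ?_
  ext v
  simp
  ring

theorem gradθ_formula (γ : LineVec m) (z θ : BusVec nd ng) :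
    N.gradθ γ z θ = N.ρ • N.incid (N.weight γ ((diagOp fun l => Real.cos (N.incidT θ l))
      (N.incidT (N.flow γ θ - N.shifted z)))) := by
  apply HasGradientAt.gradient
  rw [hasGradientAt_iff_hasFDerivAt]
  simp only [H_eq]
  have h1 : HasFDerivAt (fun θ => N.flow γ θ - N.shifted z) (N.incid ∘L N.weight γ ∘L
      ((diagOp fun l => Real.cos (N.incidT θ l)) ∘L N.incidT)) θ :=
    ((N.incid ∘L N.weight γ).hasFDerivAt.comp θ (N.hasFDerivAt_sinVec θ)).sub_const _
  have h2 := (h1.norm_sq.const_mul (N.ρ / 2)).const_add (-inner ℝ (loadVec nd ng) z)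
  refine h2.congr_fderiv ?_
  ext v
  set r := N.flow γ θ - N.shifted z
  have h3 : inner ℝ r (N.incid (N.weight γ ((diagOp fun l => Real.cos (N.incidT θ l))
      (N.incidT v)))) = inner ℝ (N.incid (N.weight γ ((diagOp fun l => Real.cos (N.incidT θ l))
      (N.incidT r)))) v := by
    rw [real_inner_comm, inner_incid, inner_incid, weight]
    simp only [PiLp.inner_apply, diagOp_apply, RCLike.inner_apply, conj_trivial]
    exact Finset.sum_congr rfl fun l _ => by ring
  simp [h3]
  ring

end

end Problem

/-! ### Binary vectors -/

/-- The vectors with entries in `{0, 1}`. -/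
def IsBinary {m : ℕ} (γ : LineVec m) : Prop := ∀ l, γ l = 0 ∨ γ l = 1

theorem finite_isBinary (m : ℕ) : {γ : LineVec m | IsBinary γ}.Finite := by
  have h : {f : Fin m → ℝ | ∀ l, f l ∈ ({0, 1} : Set ℝ)}.Finite :=
    Set.Finite.pi' fun _ => Set.toFinite _
  refine (h.preimage (f := fun γ : LineVec m => γ.ofLp)
    (fun a _ b _ hab => WithLp.ofLp_injective 2 hab)).subset fun γ hγ l => ?_
  simpa using hγ l

theorem IsBinary.mul_self {m : ℕ} {γ : LineVec m} (h : IsBinary γ) (l : Fin m) :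
    γ l * γ l = γ l := by
  rcases h l with h | h <;> simp [h]

theorem IsBinary.one_le_norm_sub_sq {m : ℕ} {γ γ' : LineVec m} (h : IsBinary γ) (h' : IsBinary γ')
    (hne : γ' ≠ γ) : 1 ≤ ‖γ' - γ‖ ^ 2 := by
  obtain ⟨l, hl⟩ : ∃ l, γ' l ≠ γ l := by
    by_contra! hcon
    exact hne (by ext l; exact hcon l)
  have h1 : |(γ' - γ) l| = 1 := by
    rcases h l with h | h <;> rcases h' l with h' | h' <;> simp_all
  have h2 := PiLp.norm_apply_le (γ' - γ) l
  rw [Real.norm_eq_abs, h1] at h2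
  nlinarith

theorem norm_le_of_forall_abs_le {m : ℕ} {x y : LineVec m} {c : ℝ} (hc : 0 ≤ c)
    (h : ∀ l, |x l| ≤ c * |y l|) : ‖x‖ ≤ c * ‖y‖ := by
  refine (sq_le_sq₀ (norm_nonneg _) (by positivity)).1 ?_
  rw [mul_pow, EuclideanSpace.norm_sq_eq, EuclideanSpace.norm_sq_eq, Finset.mul_sum]
  refine Finset.sum_le_sum fun l _ => ?_
  rw [← mul_pow, Real.norm_eq_abs, Real.norm_eq_abs]
  gcongr
  exact h l

/-! ### Spectral norm bounds -/

theorem abs_entry_le_specNorm {ι κ : Type*} [Fintype ι] [Fintype κ] [DecidableEq κ]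
    (A : Matrix ι κ ℝ) (i : ι) (j : κ) : |A i j| ≤ specNorm A := by
  have h1 := (LinearMap.toContinuousLinearMap (Matrix.toEuclideanLin A)).le_opNorm
    (EuclideanSpace.single j 1)
  rw [PiLp.norm_single, norm_one, mul_one] at h1
  refine le_trans ?_ h1
  have h2 := PiLp.norm_apply_le (LinearMap.toContinuousLinearMap (Matrix.toEuclideanLin A)
    (EuclideanSpace.single j 1)) i
  simpa using h2

namespace Problem

noncomputable section

variable {nd ng m : ℕ} (N : Problem nd ng m)

theorem norm_incid_le (y : LineVec m) : ‖N.incid y‖ ≤ specNorm N.E * ‖y‖ :=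
  N.incid.le_opNorm y

theorem norm_incidT_le (x : BusVec nd ng) : ‖N.incidT x‖ ≤ specNorm N.E * ‖x‖ := by
  rcases (norm_nonneg (N.incidT x)).eq_or_lt with h | h
  · rw [← h]; exact mul_nonneg (norm_nonneg _) (norm_nonneg _)
  · refine le_of_mul_le_mul_left ?_ h
    calc ‖N.incidT x‖ * ‖N.incidT x‖ = inner ℝ (N.incid (N.incidT x)) x := by
          rw [inner_incid, real_inner_self_eq_norm_mul_norm]
      _ ≤ ‖N.incid (N.incidT x)‖ * ‖x‖ := real_inner_le_norm _ _
      _ ≤ (specNorm N.E * ‖N.incidT x‖) * ‖x‖ := by gcongr; exact N.norm_incid_le _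
      _ = _ := by ring

theorem one_le_gram (l : Fin m) : 1 ≤ (N.E.transpose * N.E) l l := by
  rw [Matrix.mul_apply]
  have h : N.E.transpose l (N.src l) * N.E (N.src l) l = 1 := by simp [E]
  rw [← h]
  exact Finset.single_le_sum (f := fun i => N.E.transpose l i * N.E i l)
    (fun i _ => mul_self_nonneg (N.E i l)) (Finset.mem_univ _)

theorem one_le_specNorm_E (l : Fin m) : 1 ≤ specNorm N.E := by
  have h := abs_entry_le_specNorm N.E (N.src l) l
  simpa [E] using h

/-- `L₁` dominates `‖sin(Eᵀ θ)‖²`, by its diagonal entries. -/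
theorem exists_sq_sinVec_le_L₁ : ∃ C : ℝ, 0 < C ∧ ∀ (z θ : BusVec nd ng),
    ‖N.sinVec θ‖ ^ 2 ≤ C * N.L₁ z θ := by
  have hρ := N.ρ_pos
  have hS : 0 ≤ ∑ l, 1 / (N.ρ * N.adm l ^ 2) := Finset.sum_nonneg fun l _ => by positivity
  refine ⟨∑ l, 1 / (N.ρ * N.adm l ^ 2) + 1, by linarith, fun z θ => ?_⟩
  have hL : 0 ≤ N.L₁ z θ := mul_nonneg hρ.le (norm_nonneg _)
  have h : ‖N.sinVec θ‖ ^ 2 ≤ (∑ l, 1 / (N.ρ * N.adm l ^ 2)) * N.L₁ z θ := by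
    rw [EuclideanSpace.norm_sq_eq, Finset.sum_mul]
    refine Finset.sum_le_sum fun l _ => ?_
    have hd := N.adm_pos l
    have h1 := abs_entry_le_specNorm (Matrix.hadamard (N.D * N.E.transpose * N.E * N.D)
      (Matrix.vecMulVec (N.sinDiff θ) (N.sinDiff θ))) l l
    have h2 : (N.D * N.E.transpose * N.E * N.D) l l =
        N.adm l * (N.E.transpose * N.E) l l * N.adm l := by
      rw [D, Matrix.mul_diagonal, Matrix.mul_assoc, Matrix.diagonal_mul]
    rw [Matrix.hadamard_apply, h2, Matrix.vecMulVec_apply] at h1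
    have h3 := le_trans (le_abs_self _) h1
    have hg := N.one_le_gram l
    have h4 : N.adm l ^ 2 * ‖N.sinVec θ l‖ ^ 2 ≤
        N.adm l * (N.E.transpose * N.E) l l * N.adm l * (N.sinDiff θ l * N.sinDiff θ l) := by
      have : ‖N.sinVec θ l‖ ^ 2 = N.sinDiff θ l * N.sinDiff θ l := by
        rw [Real.norm_eq_abs, sq_abs, sq]; rfl
      rw [this]
      have hpos : 0 ≤ N.adm l ^ 2 * (N.sinDiff θ l * N.sinDiff θ l) :=
        mul_nonneg (sq_nonneg _) (mul_self_nonneg _)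
      nlinarith
    rw [one_div_mul_eq_div, le_div_iff₀ (by positivity), L₁]
    nlinarith
  linarith

theorem sq_adm_le_specNorm_Q {γ : LineVec m} {l : Fin m} (hl : γ l = 1) :
    N.adm l ^ 2 ≤ specNorm (N.Q γ) := by
  have h1 := abs_entry_le_specNorm (N.Q γ) l l
  have h2 : N.Q γ l l = N.adm l ^ 2 * (N.E.transpose * N.E) l l := by
    have : N.Q γ = (Γ γ * N.D) * (N.E.transpose * N.E) * (N.D * Γ γ) := by
      simp only [Q, Matrix.mul_assoc]
    rw [this, Γ, D, Matrix.diagonal_mul_diagonal, Matrix.diagonal_mul_diagonal,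
      Matrix.mul_diagonal, Matrix.diagonal_mul, hl]
    ring
  rw [h2] at h1
  have := N.one_le_gram l
  nlinarith [le_abs_self (N.adm l ^ 2 * (N.E.transpose * N.E) l l), sq_nonneg (N.adm l)]

/-- `L₃` is bounded away from zero on binary `γ` unless it vanishes. -/
theorem exists_le_L₃ : ∃ c : ℝ, 0 < c ∧ ∀ (γ : LineVec m) (z : BusVec nd ng), IsBinary γ →
    0 < N.L₃ γ z → c ≤ N.L₃ γ z := by
  have hρ := N.ρ_pos
  set S := ∑ l, 1 / N.adm l ^ 2
  have hS : 0 ≤ S := Finset.sum_nonneg fun l _ => by positivity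
  refine ⟨2 * N.ρ / (S + 1), by positivity, fun γ z hγ hpos => ?_⟩
  obtain ⟨l, hl⟩ : ∃ l, γ l = 1 := by
    by_contra! hcon
    have h0 : Γ γ = 0 := by
      rw [Γ, Matrix.diagonal_eq_zero]
      funext l
      exact (hγ l).resolve_right (hcon l)
    have hQ : N.Q γ = 0 := by simp [Q, h0]
    have hR : N.R γ z = 0 := by ext l; simp [R, h0]
    simp [L₃, hQ, hR, specNorm] at hpos
  have hd := N.adm_pos l
  have h1 : 1 / N.adm l ^ 2 ≤ S :=
    Finset.single_le_sum (f := fun l => 1 / N.adm l ^ 2) (fun i _ => by positivity)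
      (Finset.mem_univ l)
  have h2 := N.sq_adm_le_specNorm_Q hl
  have h3 : 1 ≤ S * specNorm (N.Q γ) := by
    calc 1 = 1 / N.adm l ^ 2 * N.adm l ^ 2 := by field_simp
      _ ≤ S * specNorm (N.Q γ) := by gcongr
  have hE := N.one_le_specNorm_E l
  have hQ0 : 0 ≤ specNorm (N.Q γ) := norm_nonneg _
  have h4 : 2 * N.ρ * specNorm (N.Q γ) ≤ N.L₃ γ z := by
    rw [L₃]
    have hE2 : 1 ≤ specNorm N.E ^ 2 := by nlinarith
    have hR0 := norm_nonneg (N.R γ z)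
    calc 2 * N.ρ * specNorm (N.Q γ) = N.ρ * 1 * (2 * specNorm (N.Q γ)) := by ring
      _ ≤ _ := by gcongr; linarith
  rw [div_le_iff₀ (by linarith)]
  nlinarith [mul_le_mul_of_nonneg_left h4 hS]

/-! ### The linearized flow operator -/

/-- The weighted Laplacian `E D diag(γ) Eᵀ`. -/
def lap (γ : LineVec m) : BusVec nd ng →ₗ[ℝ] BusVec nd ng :=
  (N.incid ∘L N.weight γ ∘L N.incidT).toLinearMap

theorem lap_apply (γ : LineVec m) (x : BusVec nd ng) :
    N.lap γ x = N.incid (N.weight γ (N.incidT x)) := rfl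

theorem lap_isSymmetric (γ : LineVec m) : (N.lap γ).IsSymmetric := fun x y => by
  rw [lap_apply, lap_apply, inner_incid, weight, inner_diagOp, real_inner_comm, ← inner_incid,
    real_inner_comm]

theorem norm_sq_incid_weight_le (γ y : LineVec m) :
    ‖N.incid (N.weight γ y)‖ ^ 2 ≤ specNorm (N.Q γ) * ‖y‖ ^ 2 := by
  have hQ : (LinearMap.toContinuousLinearMap (Matrix.toEuclideanLin (N.Q γ))) y =
      N.weight γ (N.incidT (N.incid (N.weight γ y))) := by
    have h1 : N.Q γ = (Γ γ * N.D) * (N.E.transpose * (N.E * (N.D * Γ γ))) := by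
      simp only [Q, Matrix.mul_assoc]
    rw [h1, Γ, D, Matrix.diagonal_mul_diagonal, Matrix.diagonal_mul_diagonal]
    ext l
    simp [incidT, incid, weight, diagOp, Matrix.mulVec_diagonal, mul_comm (γ l)]
  have h2 := (LinearMap.toContinuousLinearMap (Matrix.toEuclideanLin (N.Q γ))).le_opNorm y
  rw [hQ] at h2
  calc ‖N.incid (N.weight γ y)‖ ^ 2 = inner ℝ y (N.weight γ (N.incidT (N.incid (N.weight γ y)))) := by
        rw [weight, ← inner_diagOp, ← inner_incid, real_inner_self_eq_norm_sq]
    _ ≤ ‖y‖ * ‖N.weight γ (N.incidT (N.incid (N.weight γ y)))‖ := real_inner_le_norm _ _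
    _ ≤ ‖y‖ * (specNorm (N.Q γ) * ‖y‖) := by gcongr; exact h2
    _ = _ := by ring

theorem norm_sq_lap_le (γ : LineVec m) (x : BusVec nd ng) :
    ‖N.lap γ x‖ ^ 2 ≤ (specNorm (N.Q γ) * specNorm N.E ^ 2) * ‖x‖ ^ 2 := by
  have h1 := N.norm_sq_incid_weight_le γ (N.incidT x)
  have h2 := N.norm_incidT_le x
  have hQ0 : 0 ≤ specNorm (N.Q γ) := norm_nonneg _
  calc ‖N.lap γ x‖ ^ 2 ≤ specNorm (N.Q γ) * ‖N.incidT x‖ ^ 2 := h1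
    _ ≤ specNorm (N.Q γ) * (specNorm N.E * ‖x‖) ^ 2 := by gcongr
    _ = _ := by ring

theorem inner_weight_self {γ : LineVec m} (hγ : IsBinary γ) (y : LineVec m) :
    inner ℝ y (N.weight γ y) = ∑ l, N.adm l * (γ l * y l) ^ 2 := by
  simp only [PiLp.inner_apply, weight, diagOp_apply, RCLike.inner_apply, conj_trivial]
  refine Finset.sum_congr rfl fun l _ => ?_
  rw [mul_pow, sq (γ l), hγ.mul_self]
  ring

theorem diagOp_eq_zero_of_sum {γ : LineVec m} {y : LineVec m}
    (h : ∑ l, N.adm l * (γ l * y l) ^ 2 = 0) : diagOp (fun l => γ l) y = 0 := by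
  rw [Finset.sum_eq_zero_iff_of_nonneg
    (fun l _ => mul_nonneg (N.adm_pos l).le (sq_nonneg _))] at h
  ext l
  have := h l (Finset.mem_univ l)
  simpa [(N.adm_pos l).ne'] using this

theorem weight_diagOp {γ : LineVec m} (hγ : IsBinary γ) (y : LineVec m) :
    N.weight γ (diagOp (fun l => γ l) y) = N.weight γ y := by
  ext l
  simp only [weight, diagOp_apply]
  rw [← mul_assoc, mul_assoc (N.adm l), hγ.mul_self]

theorem exists_norm_active_le {γ : LineVec m} (hγ : IsBinary γ) : ∃ C : ℝ, 0 < C ∧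
    ∀ θ, ‖diagOp (fun l => γ l) (N.incidT θ)‖ ≤ C * ‖N.lap γ θ‖ := by
  refine exists_norm_le_of_ker_le
    ((diagOp (fun l => γ l) ∘L N.incidT).toLinearMap) (N.lap γ) fun x hx => ?_
  refine N.diagOp_eq_zero_of_sum ?_
  have h : inner ℝ (N.incid (N.weight γ (N.incidT x))) x = 0 := by
    rw [← lap_apply, hx, inner_zero_left]
  rwa [inner_incid, real_inner_comm, N.inner_weight_self hγ] at h

theorem exists_norm_flow_le {γ : LineVec m} (hγ : IsBinary γ) : ∃ C : ℝ, 0 < C ∧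
    ∀ y, ‖N.incid (N.weight γ y)‖ ≤
      C * ‖diagOp (fun l => γ l) (N.incidT (N.incid (N.weight γ y)))‖ := by
  refine exists_norm_le_of_ker_le ((N.incid ∘L N.weight γ).toLinearMap)
    ((diagOp (fun l => γ l) ∘L N.incidT ∘L N.incid ∘L N.weight γ).toLinearMap) fun y hy => ?_
  have hy' : diagOp (fun l => γ l) (N.incidT (N.incid (N.weight γ y))) = 0 := hy
  have h : inner ℝ (N.incid (N.weight γ y)) (N.incid (N.weight γ y)) = 0 := by
    rw [inner_incid, weight, inner_diagOp, ← weight, ← N.weight_diagOp hγ, hy']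
    simp
  exact inner_self_eq_zero.1 h

/-- Comparison constants that are uniform over the finitely many binary vectors. -/
theorem exists_uniform_bounds : ∃ C : ℝ, 0 < C ∧ ∀ γ : LineVec m, IsBinary γ →
    (∀ θ, ‖diagOp (fun l => γ l) (N.incidT θ)‖ ≤ C * ‖N.lap γ θ‖) ∧
    (∀ y, ‖N.incid (N.weight γ y)‖ ≤
      C * ‖diagOp (fun l => γ l) (N.incidT (N.incid (N.weight γ y)))‖) ∧
    (∀ y, ‖N.incid (N.weight γ y)‖ ≤ C * ‖y‖) := by
  have h : ∀ γ : LineVec m, ∃ C : ℝ, 0 < C ∧ (IsBinary γ →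
      (∀ θ, ‖diagOp (fun l => γ l) (N.incidT θ)‖ ≤ C * ‖N.lap γ θ‖) ∧
      (∀ y, ‖N.incid (N.weight γ y)‖ ≤
        C * ‖diagOp (fun l => γ l) (N.incidT (N.incid (N.weight γ y)))‖) ∧
      (∀ y, ‖N.incid (N.weight γ y)‖ ≤ C * ‖y‖)) := by
    intro γ
    by_cases hγ : IsBinary γ
    · obtain ⟨C₁, hC₁, h₁⟩ := N.exists_norm_active_le hγ
      obtain ⟨C₂, hC₂, h₂⟩ := N.exists_norm_flow_le hγ
      have h₃ := (N.incid ∘L N.weight γ).le_opNorm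
      set C₃ := ‖N.incid ∘L N.weight γ‖
      have hC₃ : 0 ≤ C₃ := norm_nonneg _
      refine ⟨C₁ + C₂ + C₃, by linarith, fun _ => ⟨fun θ => ?_, fun y => ?_, fun y => ?_⟩⟩
      · exact (h₁ θ).trans (by gcongr; linarith)
      · exact (h₂ y).trans (by gcongr; linarith)
      · exact (h₃ y).trans (by gcongr; linarith)
    · exact ⟨1, one_pos, fun h => absurd h hγ⟩
  choose C hC0 hC using h
  obtain ⟨B, hB⟩ := ((finite_isBinary m).image C).bddAbove
  have hB' : ∀ γ, IsBinary γ → C γ ≤ |B| + 1 := fun γ hγ =>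
    (hB ⟨γ, hγ, rfl⟩).trans ((le_abs_self B).trans (by linarith))
  refine ⟨|B| + 1, by positivity, fun γ hγ => ?_⟩
  obtain ⟨h1, h2, h3⟩ := hC γ hγ
  have := hB' γ hγ
  exact ⟨fun θ => (h1 θ).trans (by gcongr), fun y => (h2 y).trans (by gcongr),
    fun y => (h3 y).trans (by gcongr)⟩

end

end Problem

/-! ### Feasible sets and the objective -/

/-- Minimizing an indicator function plus a real-valued function is constrained minimization. -/
theorem mem_and_le_of_isMinOn {V : Type*} {S : Set V} {φ : V → EReal} (h0 : ∀ x ∈ S, φ x = 0)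
    (h1 : ∀ x, x ∉ S → φ x = ⊤) (hne : S.Nonempty) {q : V → ℝ} {u : V}
    (h : IsMinOn (fun y => φ y + (q y : EReal)) Set.univ u) : u ∈ S ∧ ∀ y ∈ S, q u ≤ q y := by
  have hle : ∀ y ∈ S, φ u + (q u : EReal) ≤ q y := fun y hy => by
    simpa [h0 y hy] using h (Set.mem_univ y)
  obtain ⟨y, hy⟩ := hne
  have hu : u ∈ S := by
    by_contra hu
    have := hle y hy
    rw [h1 u hu, EReal.top_add_coe] at this
    exact absurd this (by simp)
  refine ⟨hu, fun y hy => ?_⟩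
  have := hle y hy
  rw [h0 u hu, zero_add] at this
  exact_mod_cast this

namespace Problem

noncomputable section

variable {nd ng m : ℕ} (N : Problem nd ng m)

/-- The feasible line vectors. -/
def feasγ : Set (LineVec m) := {γ | IsBinary γ ∧ (m : ℝ) - ∑ l, γ l = (N.K : ℝ)}

/-- The feasible shedding vectors. -/
def feasz : Set (BusVec nd ng) :=
  {z | (∀ i : Fin nd, 0 ≤ z (Sum.inl i) ∧ z (Sum.inl i) ≤ -N.P (Sum.inl i)) ∧
    (∀ j : Fin ng, -N.P (Sum.inr j) ≤ z (Sum.inr j) ∧ z (Sum.inr j) ≤ 0) ∧ ∑ i, z i = 0}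

/-- The feasible angle vectors. -/
def feasθ : Set (BusVec nd ng) :=
  {θ | ∀ l, |N.incidT θ l| ≤ Real.pi / 2}

theorem φ₁_of_mem {γ : LineVec m} (h : γ ∈ N.feasγ) : N.φ₁ γ = 0 := if_pos h

theorem φ₁_of_notMem {γ : LineVec m} (h : γ ∉ N.feasγ) : N.φ₁ γ = ⊤ := if_neg h

theorem φ₂_of_mem {z : BusVec nd ng} (h : z ∈ N.feasz) : N.φ₂ z = 0 := if_pos h

theorem φ₂_of_notMem {z : BusVec nd ng} (h : z ∉ N.feasz) : N.φ₂ z = ⊤ := if_neg h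

theorem mem_feasθ_iff {θ : BusVec nd ng} : θ ∈ N.feasθ ↔
    ∀ l, -(Real.pi / 2) ≤ N.angleDiff θ l ∧ N.angleDiff θ l ≤ Real.pi / 2 := by
  simp only [feasθ, Set.mem_ofPred_eq, abs_le, angleDiff_eq]

theorem φ₃_of_mem {θ : BusVec nd ng} (h : θ ∈ N.feasθ) : N.φ₃ θ = 0 :=
  if_pos (N.mem_feasθ_iff.1 h)

theorem φ₃_of_notMem {θ : BusVec nd ng} (h : θ ∉ N.feasθ) : N.φ₃ θ = ⊤ :=
  if_neg fun h' => h (N.mem_feasθ_iff.2 h')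

/-- The domain of `Φ`. -/
def Feasible (x : State nd ng m) : Prop :=
  x.fst ∈ N.feasγ ∧ x.snd.fst ∈ N.feasz ∧ x.snd.snd ∈ N.feasθ

theorem Φ_of_feasible {x : State nd ng m} (h : N.Feasible x) : N.Φ x = (N.Hjoint x : EReal) := by
  rw [Φ, N.φ₁_of_mem h.1, N.φ₂_of_mem h.2.1, N.φ₃_of_mem h.2.2]
  simp

theorem Φ_of_not_feasible {x : State nd ng m} (h : ¬ N.Feasible x) : N.Φ x = ⊤ := by
  have hb₁ : N.φ₁ x.fst ≠ ⊥ := by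
    by_cases h : x.fst ∈ N.feasγ
    · simp [N.φ₁_of_mem h]
    · simp [N.φ₁_of_notMem h]
  have hb₂ : N.φ₂ x.snd.fst ≠ ⊥ := by
    by_cases h : x.snd.fst ∈ N.feasz
    · simp [N.φ₂_of_mem h]
    · simp [N.φ₂_of_notMem h]
  have hb₃ : N.φ₃ x.snd.snd ≠ ⊥ := by
    by_cases h : x.snd.snd ∈ N.feasθ
    · simp [N.φ₃_of_mem h]
    · simp [N.φ₃_of_notMem h]
  rw [Φ]
  by_cases h₁ : x.fst ∈ N.feasγ
  · by_cases h₂ : x.snd.fst ∈ N.feasz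
    · have h₃ : x.snd.snd ∉ N.feasθ := fun h₃ => h ⟨h₁, h₂, h₃⟩
      simp [N.φ₁_of_mem h₁, N.φ₂_of_mem h₂, N.φ₃_of_notMem h₃]
    · rw [N.φ₂_of_notMem h₂, EReal.add_top_of_ne_bot hb₁, EReal.top_add_of_ne_bot hb₃,
        EReal.top_add_coe]
  · rw [N.φ₁_of_notMem h₁, EReal.top_add_of_ne_bot hb₂, EReal.top_add_of_ne_bot hb₃,
      EReal.top_add_coe]

theorem Φ_ne_top_iff {x : State nd ng m} : N.Φ x ≠ ⊤ ↔ N.Feasible x := by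
  by_cases h : N.Feasible x
  · simp [N.Φ_of_feasible h, h]
  · simp [N.Φ_of_not_feasible h, h]

/-- The negative of the injections: everything is shed. -/
def fullShed : BusVec nd ng := -WithLp.toLp 2 N.P

theorem shifted_fullShed : N.shifted N.fullShed = 0 := by simp [shifted, fullShed]

theorem eq_fullShed_of_shifted {z : BusVec nd ng} (h : N.shifted z = 0) : z = N.fullShed := by
  rw [shifted] at h
  exact (neg_eq_of_add_eq_zero_right h).symm

theorem fullShed_mem : N.fullShed ∈ N.feasz := by
  refine ⟨fun i => ?_, fun j => ?_, ?_⟩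
  · simpa [fullShed] using N.load_nonpos i
  · simpa [fullShed] using (N.gen_pos j).le
  · simp only [fullShed, PiLp.neg_apply]
    rw [Finset.sum_neg_distrib, N.lossless, neg_zero]

theorem segment_mem_feasz {z : BusVec nd ng} (hz : z ∈ N.feasz) {t : ℝ} (ht : 0 < t) (ht1 : t ≤ 1) :
    z + t • (N.fullShed - z) ∈ N.feasz := by
  refine ⟨fun i => ?_, fun j => ?_, ?_⟩
  · obtain ⟨h1, h2⟩ := hz.1 i
    simp only [fullShed, PiLp.add_apply, PiLp.smul_apply, PiLp.sub_apply, PiLp.neg_apply, smul_eq_mul]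
    have h3 := N.load_nonpos i
    constructor <;> nlinarith
  · obtain ⟨h1, h2⟩ := hz.2.1 j
    simp only [fullShed, PiLp.add_apply, PiLp.smul_apply, PiLp.sub_apply, PiLp.neg_apply, smul_eq_mul]
    have h3 := N.gen_pos j
    constructor <;> nlinarith
  · have h := hz.2.2
    simp only [fullShed, PiLp.add_apply, PiLp.smul_apply, PiLp.sub_apply, PiLp.neg_apply, smul_eq_mul]
    rw [Finset.sum_add_distrib, ← Finset.mul_sum, Finset.sum_sub_distrib, Finset.sum_neg_distrib, h,
      N.lossless]
    simp

theorem inner_loadVec_shifted_le {z : BusVec nd ng} (hz : z ∈ N.feasz) :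
    inner ℝ (loadVec nd ng) (N.shifted z) ≤ -(1 / 2) * ‖N.shifted z‖ := by
  set w := N.shifted z with hw
  have hl : ∀ i : Fin nd, w (Sum.inl i) ≤ 0 := fun i => by
    have := (hz.1 i).2
    simp only [hw, shifted, PiLp.add_apply]; linarith
  have hg : ∀ j : Fin ng, 0 ≤ w (Sum.inr j) := fun j => by
    have := (hz.2.1 j).1
    simp only [hw, shifted, PiLp.add_apply]; linarith
  have hs : ∑ i, w i = 0 := by
    simp only [hw, shifted, PiLp.add_apply]
    rw [Finset.sum_add_distrib, hz.2.2, N.lossless, add_zero]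
  rw [inner_loadVec]
  have hnorm : ‖w‖ ≤ ∑ i, |w i| := by
    rw [EuclideanSpace.norm_eq]
    apply Real.sqrt_le_iff.2 ⟨Finset.sum_nonneg fun i _ => abs_nonneg _, ?_⟩
    exact Finset.sum_sq_le_sq_sum_of_nonneg fun i _ => abs_nonneg _
  rw [Fintype.sum_sum_type] at hnorm hs
  have e1 : ∑ i : Fin nd, |w (Sum.inl i)| = -∑ i : Fin nd, w (Sum.inl i) := by
    rw [← Finset.sum_neg_distrib]
    exact Finset.sum_congr rfl fun i _ => abs_of_nonpos (hl i)
  have e2 : ∑ j : Fin ng, |w (Sum.inr j)| = ∑ j : Fin ng, w (Sum.inr j) :=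
    Finset.sum_congr rfl fun j _ => abs_of_nonneg (hg j)
  rw [e1, e2] at hnorm
  linarith

/-- On the feasible set, `H` is bounded below by a constant. -/
theorem H_ge {z : BusVec nd ng} (hz : z ∈ N.feasz) (γ : LineVec m) (θ : BusVec nd ng) :
    inner ℝ (loadVec nd ng) (WithLp.toLp 2 N.P) ≤ N.H γ z θ := by
  have h1 := N.inner_loadVec_shifted_le hz
  rw [shifted, inner_add_right] at h1
  rw [H_eq]
  have := N.ρ_pos
  have h2 : 0 ≤ N.ρ / 2 * ‖N.flow γ θ - N.shifted z‖ ^ 2 := by positivity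
  have := norm_nonneg (WithLp.toLp 2 N.P + z)
  linarith

theorem H_fullShed (γ : LineVec m) (θ : BusVec nd ng) :
    N.H γ N.fullShed θ =
      inner ℝ (loadVec nd ng) (WithLp.toLp 2 N.P) + N.ρ / 2 * ‖N.flow γ θ‖ ^ 2 := by
  rw [H_eq, shifted_fullShed, sub_zero, fullShed, inner_neg_right, neg_neg]

/-- Full shedding is a sharp minimizer of the linear term on the feasible set, so a projected
gradient step with a short displacement and a small flow lands exactly on it. -/
theorem eq_fullShed_of_nearest {r b : ℝ} (hr : 1 < r) (hb : b = r * N.ρ) {γ : LineVec m}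
    {z z' θ : BusVec nd ng} (hz' : z' ∈ N.feasz)
    (hmin : ∀ y ∈ N.feasz, ‖z' - (z - (1 / b) • N.gradz γ z θ)‖ ^ 2 ≤
      ‖y - (z - (1 / b) • N.gradz γ z θ)‖ ^ 2)
    (hsmall : ‖z' - z‖ + ‖N.flow γ θ‖ < 1 / (2 * b)) : z' = N.fullShed := by
  have hρ := N.ρ_pos
  have hb0 : 0 < b := by rw [hb]; positivity
  have hvar := inner_nonpos_of_nearest hmin
    (y := N.fullShed) fun t ht ht1 => N.segment_mem_feasz hz' ht ht1
  set w := N.shifted z with hw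
  set w' := N.shifted z' with hw'
  set f := N.flow γ θ with hf
  have e1 : N.fullShed - z' = -w' := by simp only [hw', shifted, fullShed]; abel
  have e2 : z - (1 / b) • N.gradz γ z θ - z' =
      (1 - 1 / r) • (w - w') + (1 / b) • loadVec nd ng + (1 / r) • (f - w') := by
    have hbρ : (1 / b) * N.ρ = 1 / r := by rw [hb]; field_simp
    have hzz : z - z' = w - w' := by simp only [hw, hw', shifted]; abel
    rw [gradz_formula, sub_right_comm, hzz, smul_sub, smul_neg, smul_smul, hbρ]
    simp only [← hw, ← hf]
    module
  rw [e1, e2, inner_neg_right, inner_add_left, inner_add_left, inner_smul_left, inner_smul_left,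
    inner_smul_left] at hvar
  simp only [conj_trivial] at hvar
  have hl := N.inner_loadVec_shifted_le hz'
  rw [← hw'] at hl
  have h1 : inner ℝ (w - w') w' ≤ ‖z' - z‖ * ‖w'‖ := by
    have : w - w' = -(z' - z) := by simp only [hw, hw', shifted]; abel
    calc _ ≤ ‖w - w'‖ * ‖w'‖ := real_inner_le_norm _ _
      _ = _ := by rw [this, norm_neg]
  have h2 : inner ℝ (f - w') w' ≤ ‖f‖ * ‖w'‖ := by
    rw [inner_sub_left, real_inner_self_eq_norm_sq]
    have := real_inner_le_norm f w'
    nlinarith [sq_nonneg ‖w'‖]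
  have hr1 : 0 ≤ 1 - 1 / r := by
    rw [sub_nonneg, div_le_one (by linarith)]; exact hr.le
  have hr2 : 0 < 1 / r := by positivity
  have hn := norm_nonneg w'
  have h3 : (1 - 1 / r) * inner ℝ (w - w') w' ≤ ‖z' - z‖ * ‖w'‖ := by
    have h0 : 0 ≤ ‖z' - z‖ * ‖w'‖ := by positivity
    nlinarith
  have h4 : (1 / r) * inner ℝ (f - w') w' ≤ ‖f‖ * ‖w'‖ := by
    have h0 : 0 ≤ ‖f‖ * ‖w'‖ := by positivity
    nlinarith
  have h5 : (1 / b) * inner ℝ (loadVec nd ng) w' ≤ -(1 / (2 * b)) * ‖w'‖ := by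
    calc (1 / b) * inner ℝ (loadVec nd ng) w' ≤ (1 / b) * (-(1 / 2) * ‖w'‖) := by gcongr
      _ = _ := by field_simp
  have h6 : ‖w'‖ = 0 := by
    by_contra hne
    have hpos : 0 < ‖w'‖ := lt_of_le_of_ne hn (Ne.symm hne)
    nlinarith
  exact N.eq_fullShed_of_shifted (norm_eq_zero.1 h6)

/-! ### Descent of the iteration -/

theorem differentiable_γ (z θ : BusVec nd ng) : Differentiable ℝ fun γ => N.H γ z θ :=
  fun γ => (N.hasGradientAt_γ γ z θ).differentiableAt

theorem differentiable_z (γ : LineVec m) (θ : BusVec nd ng) : Differentiable ℝ fun z => N.H γ z θ :=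
  fun z => (N.hasGradientAt_z γ z θ).differentiableAt

theorem differentiable_θ (γ : LineVec m) (z : BusVec nd ng) : Differentiable ℝ fun θ => N.H γ z θ :=
  fun θ => (N.hasGradientAt_θ γ z θ).differentiableAt

variable {N}
variable {r₁ r₂ r₃ : ℝ} {a b c : ℕ → ℝ} {γ : ℕ → LineVec m} {z θ : ℕ → BusVec nd ng}

theorem IsPALM.minγ (hP : N.IsPALM r₁ r₂ r₃ a b c γ z θ) (hp : IsProper N.Φ) (k : ℕ) :
    γ (k + 1) ∈ N.feasγ ∧ ∀ y ∈ N.feasγ,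
      a k / 2 * ‖γ (k + 1) - (γ k - (1 / a k) • N.gradγ (γ k) (z k) (θ k))‖ ^ 2 ≤
      a k / 2 * ‖y - (γ k - (1 / a k) • N.gradγ (γ k) (z k) (θ k))‖ ^ 2 := by
  obtain ⟨x, hx⟩ := hp.2
  exact mem_and_le_of_isMinOn (fun _ => N.φ₁_of_mem) (fun _ => N.φ₁_of_notMem)
    ⟨_, (N.Φ_ne_top_iff.1 hx).1⟩ (hP.step_γ k)

theorem IsPALM.minz (hP : N.IsPALM r₁ r₂ r₃ a b c γ z θ) (k : ℕ) :
    z (k + 1) ∈ N.feasz ∧ ∀ y ∈ N.feasz,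
      b k / 2 * ‖z (k + 1) - (z k - (1 / b k) • N.gradz (γ (k + 1)) (z k) (θ k))‖ ^ 2 ≤
      b k / 2 * ‖y - (z k - (1 / b k) • N.gradz (γ (k + 1)) (z k) (θ k))‖ ^ 2 :=
  mem_and_le_of_isMinOn (fun _ => N.φ₂_of_mem) (fun _ => N.φ₂_of_notMem)
    ⟨_, N.fullShed_mem⟩ (hP.step_z k)

theorem zero_mem_feasθ : (0 : BusVec nd ng) ∈ N.feasθ := fun l => by
  simpa using (half_pos Real.pi_pos).le

theorem IsPALM.minθ (hP : N.IsPALM r₁ r₂ r₃ a b c γ z θ) (k : ℕ) :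
    θ (k + 1) ∈ N.feasθ ∧ ∀ y ∈ N.feasθ,
      c k / 2 * ‖θ (k + 1) - (θ k - (1 / c k) • N.gradθ (γ (k + 1)) (z (k + 1)) (θ k))‖ ^ 2 ≤
      c k / 2 * ‖y - (θ k - (1 / c k) • N.gradθ (γ (k + 1)) (z (k + 1)) (θ k))‖ ^ 2 :=
  mem_and_le_of_isMinOn (fun _ => N.φ₃_of_mem) (fun _ => N.φ₃_of_notMem)
    ⟨_, zero_mem_feasθ⟩ (hP.step_θ k)

/-- Decrease of `H` in the three partial steps. -/
theorem IsPALM.descent (hP : N.IsPALM r₁ r₂ r₃ a b c γ z θ) (hp : IsProper N.Φ)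
    (hL : N.LipschitzConditions γ z θ) {k : ℕ} (hγ : γ k ∈ N.feasγ) (hz : z k ∈ N.feasz)
    (hθ : θ k ∈ N.feasθ) :
    N.H (γ (k + 1)) (z k) (θ k) + (r₁ - 1) / 2 * N.L₁ (z k) (θ k) * ‖γ (k + 1) - γ k‖ ^ 2 ≤
      N.H (γ k) (z k) (θ k) ∧
    N.H (γ (k + 1)) (z (k + 1)) (θ k) + (r₂ - 1) / 2 * N.ρ * ‖z (k + 1) - z k‖ ^ 2 ≤
      N.H (γ (k + 1)) (z k) (θ k) ∧
    N.H (γ (k + 1)) (z (k + 1)) (θ (k + 1)) +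
        (r₃ - 1) / 2 * N.L₃ (γ (k + 1)) (z (k + 1)) * ‖θ (k + 1) - θ k‖ ^ 2 ≤
      N.H (γ (k + 1)) (z (k + 1)) (θ k) :=
  ⟨prox_step_descent (N.differentiable_γ _ _) (hL.lipschitz_γ _ _) (hP.a_eq k) (hP.a_pos k)
      ((hP.minγ hp k).2 _ hγ),
    prox_step_descent (N.differentiable_z _ _) (hL.lipschitz_z _ (θ k)) (hP.b_eq k) (hP.b_pos k)
      ((hP.minz k).2 _ hz),
    prox_step_descent (N.differentiable_θ _ _) (hL.lipschitz_θ _ _) (hP.c_eq k) (hP.c_pos k)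
      ((hP.minθ k).2 _ hθ)⟩

theorem IsPALM.L₁_pos (hP : N.IsPALM r₁ r₂ r₃ a b c γ z θ) (hr : 1 < r₁) (k : ℕ) :
    0 < N.L₁ (z k) (θ k) := by
  have h := hP.a_pos k
  rw [hP.a_eq] at h
  exact pos_of_mul_pos_right h (by linarith)

theorem IsPALM.L₃_pos (hP : N.IsPALM r₁ r₂ r₃ a b c γ z θ) (hr : 1 < r₃) (k : ℕ) :
    0 < N.L₃ (γ (k + 1)) (z (k + 1)) := by
  have h := hP.c_pos k
  rw [hP.c_eq] at h
  exact pos_of_mul_pos_right h (by linarith)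

end

noncomputable section

variable {nd ng m : ℕ} (N : Problem nd ng m)

/-! ### Local estimates for small angle differences -/

/-- The orthogonal projection onto the range of the incidence operator. It kills the component of
the angles which is constant on the connected components of the network. -/
def pr : BusVec nd ng →L[ℝ] BusVec nd ng :=
  (LinearMap.range N.incid.toLinearMap).starProjection

theorem pr_incid (y : LineVec m) : N.pr (N.incid y) = N.incid y :=
  Submodule.starProjection_eq_self_iff.2 ⟨y, rfl⟩

theorem incidT_pr (x : BusVec nd ng) : N.incidT (N.pr x) = N.incidT x := by
  have h : x - N.pr x ∈ (LinearMap.range N.incid.toLinearMap)ᗮ :=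
    Submodule.sub_starProjection_mem_orthogonal x
  have h2 : inner ℝ (N.incid (N.incidT (x - N.pr x))) (x - N.pr x) = 0 :=
    Submodule.inner_right_of_mem_orthogonal
      (LinearMap.mem_range_self N.incid.toLinearMap (N.incidT (x - N.pr x))) h
  rw [inner_incid, inner_self_eq_zero, map_sub, sub_eq_zero] at h2
  exact h2.symm

theorem lap_pr (γ : LineVec m) (x : BusVec nd ng) : N.lap γ (N.pr x) = N.lap γ x := by
  rw [lap_apply, incidT_pr, ← lap_apply]

theorem norm_pr_le (x : BusVec nd ng) : ‖N.pr x‖ ≤ ‖x‖ :=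
  Submodule.norm_starProjection_apply_le _ x

theorem exists_norm_pr_le : ∃ C : ℝ, 0 < C ∧ ∀ x, ‖N.pr x‖ ≤ C * ‖N.incidT x‖ := by
  refine exists_norm_le_of_ker_le N.pr.toLinearMap N.incidT.toLinearMap fun x hx => ?_
  have hx' : N.incidT x = 0 := hx
  have h : x ∈ (LinearMap.range N.incid.toLinearMap)ᗮ := by
    rw [Submodule.mem_orthogonal]
    rintro _ ⟨y, rfl⟩
    change inner ℝ (N.incid y) x = 0
    rw [inner_incid, hx', inner_zero_right]
  exact (Submodule.starProjection_apply_eq_zero_iff _).2 h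

/-- The gradient direction `E D diag(γ) diag(cos(Eᵀ θ)) Eᵀ F(γ, θ)` of `‖F(γ, ·)‖² / 2`. -/
def dir (γ : LineVec m) (θ : BusVec nd ng) : BusVec nd ng :=
  N.incid (N.weight γ ((diagOp fun l => Real.cos (N.incidT θ l)) (N.incidT (N.flow γ θ))))

theorem gradθ_fullShed (γ : LineVec m) (θ : BusVec nd ng) :
    N.gradθ γ N.fullShed θ = N.ρ • N.dir γ θ := by
  rw [gradθ_formula, shifted_fullShed, sub_zero, dir]

theorem pr_dir (γ : LineVec m) (θ : BusVec nd ng) : N.pr (N.dir γ θ) = N.dir γ θ :=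
  N.pr_incid _

theorem exists_norm_pr_le_sinVec : ∃ C : ℝ, 0 < C ∧ ∀ θ ∈ N.feasθ,
    ‖N.pr θ‖ ≤ C * ‖N.sinVec θ‖ := by
  obtain ⟨C, hC, h⟩ := N.exists_norm_pr_le
  refine ⟨C * (Real.pi / 2), by positivity, fun θ hθ => (h θ).trans ?_⟩
  rw [mul_assoc]
  gcongr
  refine norm_le_of_forall_abs_le (by positivity) fun l => ?_
  have h1 := Real.mul_abs_le_abs_sin (hθ l)
  rw [sinVec_apply]
  rw [div_mul_eq_mul_div, div_le_iff₀ Real.pi_pos] at h1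
  linarith

/-- The local model near zero angle differences: the flow is `Aθ` up to a quadratic error for the
Laplacian `A = E D diag(γ) Eᵀ`, its gradient direction is `A²θ` up to a relative error, and a
Lojasiewicz inequality with exponent one half holds. -/
def LocalModel (C ε : ℝ) (γ : LineVec m) : Prop :=
  (∀ x, ‖N.lap γ x‖ ≤ C * ‖x‖) ∧ ∀ θ : BusVec nd ng,
    ‖N.flow γ θ‖ ≤ C * ‖N.pr θ‖ ∧
    (‖N.pr θ‖ ≤ ε →
    ‖N.flow γ θ‖ ≤ C * ‖N.dir γ θ‖ ∧
    ‖N.dir γ θ‖ ≤ C * ‖N.flow γ θ‖ ∧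
    ‖N.flow γ θ - N.lap γ θ‖ ≤ C * ‖N.pr θ‖ ^ 2 ∧
    ‖N.dir γ θ - N.lap γ (N.lap γ θ)‖ ≤ C * ‖N.flow γ θ‖ * ‖N.pr θ‖)

theorem exists_localModel : ∃ C ε : ℝ, 0 < C ∧ 0 < ε ∧ ∀ γ : LineVec m, IsBinary γ →
    N.LocalModel C ε γ := by
  obtain ⟨C, hC, hu⟩ := N.exists_uniform_bounds
  set e := specNorm N.E + 1 with he
  have he1 : 1 ≤ e := by
    have : 0 ≤ specNorm N.E := norm_nonneg _
    linarith
  have hET : ∀ x, ‖N.incidT x‖ ≤ e * ‖x‖ := fun x =>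
    (N.norm_incidT_le x).trans (by gcongr; linarith)
  -- an upper bound for `1 / dₗ`
  obtain ⟨B, hB, hBd⟩ : ∃ B : ℝ, 0 < B ∧ ∀ l, 1 ≤ B * N.adm l := by
    have hS : 0 ≤ ∑ l, 1 / N.adm l := Finset.sum_nonneg fun l _ => (one_div_pos.2 (N.adm_pos l)).le
    refine ⟨∑ l, 1 / N.adm l + 1, by linarith, fun l => ?_⟩
    have h1 : 1 / N.adm l ≤ ∑ l, 1 / N.adm l :=
      Finset.single_le_sum (f := fun l => 1 / N.adm l)
        (fun i _ => (one_div_pos.2 (N.adm_pos i)).le) (Finset.mem_univ l)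
    have hd := N.adm_pos l
    calc 1 = 1 / N.adm l * N.adm l := by field_simp
      _ ≤ _ := by gcongr; linarith
  set C₁ := C * e with hC₁
  set C₂ := 2 * B * C ^ 2 with hC₂
  set C₃ := C * e ^ 2 with hC₃
  set C₄ := C * e ^ 2 + 2 * C ^ 3 * e ^ 2 with hC₄
  have hC₁p : 0 < C₁ := by positivity
  have hC₂p : 0 < C₂ := by positivity
  have hC₃p : 0 < C₃ := by positivity
  have hC₄p : 0 < C₄ := by positivity
  refine ⟨C₁ + C₂ + C₃ + C₄, min (1 / e) (1 / (2 * C ^ 2 * e)), by positivity, by positivity,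
    fun γ hγ => ?_⟩
  obtain ⟨hu1, hu2, hu3⟩ := hu γ hγ
  have hlap : ∀ x, ‖N.lap γ x‖ ≤ C₁ * ‖x‖ := fun x => by
    rw [lap_apply]
    calc _ ≤ C * ‖N.incidT x‖ := hu3 _
      _ ≤ C * (e * ‖x‖) := by gcongr; exact hET x
      _ = _ := by ring
  refine ⟨fun x => (hlap x).trans (by gcongr; linarith), fun θ => ?_⟩
  set δ := N.incidT θ with hδ
  have hδx : ‖δ‖ ≤ e * ‖N.pr θ‖ := by rw [hδ, ← incidT_pr]; exact hET _
  set F := N.flow γ θ with hF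
  have hFδ : ‖F‖ ≤ C₁ * ‖N.pr θ‖ := by
    have h1 : ‖N.sinVec θ‖ ≤ 1 * ‖δ‖ := norm_le_of_forall_abs_le zero_le_one fun l => by
      rw [sinVec_apply, one_mul]; exact Real.abs_sin_le_abs
    calc ‖F‖ ≤ C * ‖N.sinVec θ‖ := hu3 _
      _ ≤ C * (e * ‖N.pr θ‖) := by gcongr; linarith
      _ = _ := by ring
  refine ⟨hFδ.trans (by gcongr; linarith), fun hsmall => ?_⟩
  have hδ1 : ‖δ‖ ≤ 1 := by
    calc ‖δ‖ ≤ e * (1 / e) := hδx.trans (by gcongr; exact hsmall.trans (min_le_left _ _))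
      _ = 1 := by field_simp
  have hδ2 : C ^ 2 * ‖δ‖ ≤ 1 / 2 := by
    calc C ^ 2 * ‖δ‖ ≤ C ^ 2 * (e * (1 / (2 * C ^ 2 * e))) := by
          gcongr; exact hδx.trans (by gcongr; exact hsmall.trans (min_le_right _ _))
      _ = 1 / 2 := by field_simp
  have hδl : ∀ l, |δ l| ≤ ‖δ‖ := fun l => by
    have := PiLp.norm_apply_le δ l
    rwa [Real.norm_eq_abs] at this
  have hsin : ∀ t : ℝ, |t| ≤ 1 → |Real.sin t - t| ≤ |t| * |t| := fun t ht => by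
    have h1 := Real.abs_sub_sin_le t
    rw [abs_sub_comm] at h1
    have h2 := abs_nonneg t
    nlinarith [mul_nonneg h2 h2, mul_le_mul_of_nonneg_left ht (mul_nonneg h2 h2)]
  have hcos : ∀ t : ℝ, |Real.cos t - 1| ≤ |t| := fun t => by
    simpa using Real.abs_cos_sub_cos_le t 0
  have hcos2 : ∀ t : ℝ, |t| ≤ 1 → 1 / 2 ≤ Real.cos t := fun t ht => by
    have := Real.one_sub_sq_div_two_le_cos (x := t)
    have h2 : t ^ 2 ≤ 1 := by rw [← sq_abs]; nlinarith [abs_nonneg t]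
    linarith
  -- the linearization error of the flow
  have hlin : ‖F - N.lap γ θ‖ ≤ C * (‖δ‖ * ‖diagOp (fun l => γ l) δ‖) := by
    have h1 : F - N.lap γ θ = N.incid (N.weight γ (diagOp (fun l => γ l) (N.sinVec θ - δ))) := by
      rw [N.weight_diagOp hγ, map_sub, map_sub]; rfl
    rw [h1]
    refine (hu3 _).trans ?_
    gcongr
    refine norm_le_of_forall_abs_le (norm_nonneg _) fun l => ?_
    simp only [diagOp_apply, PiLp.sub_apply, sinVec_apply, abs_mul]
    have h2 := hsin (δ l) ((hδl l).trans hδ1)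
    calc |γ l| * |Real.sin (δ l) - δ l| ≤ |γ l| * (‖δ‖ * |δ l|) := by
          gcongr; exact h2.trans (by gcongr; exact hδl l)
      _ = _ := by ring
  have hact : ‖diagOp (fun l => γ l) δ‖ ≤ 2 * C * ‖F‖ := by
    have h1 := hu1 θ
    rw [← hδ] at h1
    have h2 : ‖N.lap γ θ‖ ≤ ‖F‖ + ‖F - N.lap γ θ‖ := by
      have := norm_sub_norm_le (N.lap γ θ) F
      rw [norm_sub_rev] at this
      linarith
    set q := ‖diagOp (fun l => γ l) δ‖
    have hq : 0 ≤ q := norm_nonneg _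
    have h3 : q ≤ C * (‖F‖ + C * (‖δ‖ * q)) := h1.trans (by gcongr; linarith)
    have h4 : C ^ 2 * ‖δ‖ * q ≤ 1 / 2 * q := by gcongr
    nlinarith
  have hactδ : ‖diagOp (fun l => γ l) δ‖ ≤ 1 * ‖δ‖ :=
    norm_le_of_forall_abs_le zero_le_one fun l => by
      rcases hγ l with h | h <;> simp [h]
  set g := N.dir γ θ with hg
  set κ := diagOp fun l => Real.cos (δ l) with hκ
  refine ⟨?_, ?_, ?_, ?_⟩
  · -- Lojasiewicz inequality
    have h1 : ‖F‖ ≤ C * ‖diagOp (fun l => γ l) (N.incidT F)‖ := hu2 _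
    have h2 : ‖diagOp (fun l => γ l) (N.incidT F)‖ ^ 2 ≤ 2 * B * inner ℝ g F := by
      rw [hg, dir, inner_incid, weight, EuclideanSpace.norm_sq_eq, PiLp.inner_apply, Finset.mul_sum]
      refine Finset.sum_le_sum fun l _ => ?_
      simp only [diagOp_apply, RCLike.inner_apply, conj_trivial, Real.norm_eq_abs, sq_abs]
      have h3 := hcos2 (δ l) ((hδl l).trans hδ1)
      have h4 := hBd l
      have h5 : 1 ≤ 2 * (B * N.adm l) * Real.cos (δ l) := by nlinarith
      have h6 : 0 ≤ γ l * (N.incidT F l) ^ 2 := by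
        rcases hγ l with h | h <;> simp [h, sq_nonneg]
      rw [mul_pow, sq (γ l), hγ.mul_self]
      calc γ l * N.incidT F l ^ 2 ≤ (2 * (B * N.adm l) * Real.cos (δ l)) * (γ l * N.incidT F l ^ 2) :=
            le_mul_of_one_le_left h6 h5
        _ = _ := by ring
    have h3 := real_inner_le_norm g F
    have h4 : ‖F‖ ^ 2 ≤ C ^ 2 * (2 * B * (‖g‖ * ‖F‖)) := by
      calc ‖F‖ ^ 2 ≤ (C * ‖diagOp (fun l => γ l) (N.incidT F)‖) ^ 2 := by gcongr
        _ = C ^ 2 * ‖diagOp (fun l => γ l) (N.incidT F)‖ ^ 2 := by ring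
        _ ≤ C ^ 2 * (2 * B * (‖g‖ * ‖F‖)) := by gcongr; exact h2.trans (by gcongr)
    have h5 : ‖F‖ ≤ C₂ * ‖g‖ := by
      rcases (norm_nonneg F).eq_or_lt with h | h
      · rw [← h]; positivity
      · refine le_of_mul_le_mul_right ?_ h
        rw [hC₂]; linarith
    exact h5.trans (by gcongr; linarith)
  · have h1 : ‖κ (N.incidT F)‖ ≤ 1 * ‖N.incidT F‖ := norm_le_of_forall_abs_le zero_le_one fun l => by
      rw [hκ, diagOp_apply, abs_mul]
      gcongr
      exact Real.abs_cos_le_one _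
    have h2 : ‖g‖ ≤ C₁ * ‖F‖ := by
      calc ‖g‖ ≤ C * ‖κ (N.incidT F)‖ := hu3 _
        _ ≤ C * (e * ‖F‖) := by gcongr; linarith [hET F]
        _ = _ := by ring
    exact h2.trans (by gcongr; linarith)
  · have h1 : ‖F - N.lap γ θ‖ ≤ C₃ * ‖N.pr θ‖ ^ 2 := by
      calc _ ≤ C * (‖δ‖ * ‖δ‖) := hlin.trans (by gcongr; linarith)
        _ ≤ C * ((e * ‖N.pr θ‖) * (e * ‖N.pr θ‖)) := by gcongr
        _ = _ := by ring
    exact h1.trans (by gcongr; linarith)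
  · have h1 : g - N.lap γ F = N.incid (N.weight γ (κ (N.incidT F) - N.incidT F)) := by
      rw [map_sub, map_sub]; rfl
    have h2 : ‖κ (N.incidT F) - N.incidT F‖ ≤ ‖δ‖ * ‖N.incidT F‖ :=
      norm_le_of_forall_abs_le (norm_nonneg _) fun l => by
        rw [hκ, PiLp.sub_apply, diagOp_apply, ← sub_one_mul, abs_mul]
        gcongr
        exact (hcos _).trans (hδl l)
    have h3 : ‖g - N.lap γ F‖ ≤ C * e ^ 2 * (‖F‖ * ‖N.pr θ‖) := by
      rw [h1]
      calc _ ≤ C * (‖δ‖ * ‖N.incidT F‖) := (hu3 _).trans (by gcongr)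
        _ ≤ C * ((e * ‖N.pr θ‖) * (e * ‖F‖)) := by gcongr; exact hET F
        _ = _ := by ring
    have h4 : ‖N.lap γ (F - N.lap γ θ)‖ ≤ 2 * C ^ 3 * e ^ 2 * (‖F‖ * ‖N.pr θ‖) := by
      calc _ ≤ C₁ * ‖F - N.lap γ θ‖ := hlap _
        _ ≤ C₁ * (C * ((e * ‖N.pr θ‖) * (2 * C * ‖F‖))) := by
            gcongr; exact hlin.trans (by gcongr)
        _ = _ := by rw [hC₁]; ring
    have h5 : g - N.lap γ (N.lap γ θ) = (g - N.lap γ F) + N.lap γ (F - N.lap γ θ) := by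
      rw [map_sub]; abel
    have h6 : ‖g - N.lap γ (N.lap γ θ)‖ ≤ C₄ * (‖F‖ * ‖N.pr θ‖) := by
      rw [h5]
      refine (norm_add_le _ _).trans ?_
      rw [hC₄, add_mul]
      linarith
    rw [mul_assoc]
    exact h6.trans (by gcongr; linarith)

end

noncomputable section

variable {nd ng m : ℕ} {N : Problem nd ng m}

/-! ### Finitely many changes of the line variables -/

/-- The quotient `‖A θ‖ / ‖θ‖` for `A = E D diag(γ) Eᵀ`, with `θ` taken modulo the kernel of `Eᵀ`:
the square root of the Rayleigh quotient of `A²`. -/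
def quot (N : Problem nd ng m) (γ : LineVec m) (θ : BusVec nd ng) : ℝ :=
  ‖N.lap γ θ‖ / ‖N.pr θ‖

theorem quot_nonneg (γ : LineVec m) (θ : BusVec nd ng) : 0 ≤ N.quot γ θ := by
  unfold quot; positivity

/-- The effect of a small gradient step in the angles on the angles and on the quotient. -/
theorem LocalModel.angle_step {C ε : ℝ} {γ : LineVec m} (hM : N.LocalModel C ε γ) (hC : 0 < C)
    {θ : BusVec nd ng} (hθ : ‖N.pr θ‖ ≤ ε) (hθ0 : N.pr θ ≠ 0) {τ τ₁ : ℝ} (hτ : 0 ≤ τ)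
    (hτ₁ : τ ≤ τ₁) (hτΛ : τ * (specNorm (N.Q γ) * specNorm N.E ^ 2) ≤ 1 / 2)
    (hε : τ₁ * C * (C * ε) ≤ 1 / 4) :
    ‖N.pr (θ - τ • N.dir γ θ)‖ ≤ ‖N.pr θ‖ + τ₁ * C * ‖N.flow γ θ‖ ∧
    N.quot γ (θ - τ • N.dir γ θ) ≤ N.quot γ θ + 8 * C * (τ₁ * C * ‖N.flow γ θ‖) := by
  obtain ⟨hlap, hM⟩ := hM
  obtain ⟨hF, hM⟩ := hM θ
  obtain ⟨-, hdir, -, herr⟩ := hM hθ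
  have hτ₁0 : 0 ≤ τ₁ := hτ.trans hτ₁
  have hpr : N.pr (θ - τ • N.dir γ θ) = N.pr θ - τ • N.dir γ θ := by
    rw [map_sub, map_smul, pr_dir]
  constructor
  · rw [hpr]
    refine (norm_sub_le _ _).trans ?_
    rw [norm_smul, Real.norm_of_nonneg hτ, mul_assoc]
    gcongr
  · have hQ : 0 ≤ specNorm (N.Q γ) := norm_nonneg _
    have h := rayleigh_step_perturbed (N.lap_isSymmetric γ)
      (Λ := specNorm (N.Q γ) * specNorm N.E ^ 2) (τ := τ) (a := C)
      (η := τ₁ * C * ‖N.flow γ θ‖) (by positivity) (N.norm_sq_lap_le γ) hlap hC.le hτ hτΛ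
      (le_trans (by gcongr; exact hF.trans (by gcongr)) hε) hθ0
      (x' := N.pr (θ - τ • N.dir γ θ)) (by
        rw [hpr, N.lap_pr, sub_sub_sub_cancel_left, ← smul_sub, norm_smul,
          Real.norm_of_nonneg hτ, norm_sub_rev]
        calc τ * _ ≤ τ₁ * (C * ‖N.flow γ θ‖ * ‖N.pr θ‖) := by gcongr
          _ = _ := by ring)
    rwa [N.lap_pr, N.lap_pr] at h

/-- A change of the line variables that decreases the squared flow by a fixed multiple of the
squared angles decreases the quotient by a fixed amount. -/
theorem LocalModel.quot_drop {C ε κ : ℝ} {γ γ' : LineVec m} (hM : N.LocalModel C ε γ)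
    (hM' : N.LocalModel C ε γ') (hC : 0 < C) (hκ : 0 < κ) (hε : 8 * C ^ 2 * ε ≤ κ)
    {θ : BusVec nd ng} (hθ : ‖N.pr θ‖ ≤ ε) (hθ0 : N.pr θ ≠ 0)
    (hdrop : ‖N.flow γ' θ‖ ^ 2 ≤ ‖N.flow γ θ‖ ^ 2 - κ * ‖N.pr θ‖ ^ 2) :
    N.quot γ' θ ≤ N.quot γ θ - κ / (4 * C) := by
  obtain ⟨hF, h1⟩ := hM.2 θ
  obtain ⟨hF', h1'⟩ := hM'.2 θ
  obtain ⟨-, -, hlin, -⟩ := h1 hθ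
  obtain ⟨-, -, hlin', -⟩ := h1' hθ
  set x := ‖N.pr θ‖ with hx
  have hx0 : 0 < x := norm_pos_iff.2 hθ0
  set T := ‖N.flow γ θ‖
  set T' := ‖N.flow γ' θ‖
  have hT : T' ≤ T - κ / (2 * C) * x := by
    have hT0 : 0 ≤ T := norm_nonneg _
    have hT0' : 0 ≤ T' := norm_nonneg _
    have hlt : T' < T := by
      refine lt_of_pow_lt_pow_left₀ 2 hT0 ?_
      nlinarith [mul_pos hκ (pow_pos hx0 2)]
    have h2 : κ * x ^ 2 ≤ (T - T') * (2 * C * x) := by nlinarith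
    have h3 : κ * x ≤ (T - T') * (2 * C) := by
      refine le_of_mul_le_mul_right ?_ hx0
      calc κ * x * x = κ * x ^ 2 := by ring
        _ ≤ _ := h2
        _ = _ := by ring
    have h4 : κ / (2 * C) * x ≤ T - T' := by
      rw [div_mul_eq_mul_div, div_le_iff₀ (by positivity)]; exact h3
    linarith
  have h5 : ‖N.lap γ' θ‖ ≤ T' + C * x ^ 2 := by
    have := norm_sub_norm_le (N.lap γ' θ) (N.flow γ' θ)
    rw [norm_sub_rev] at this
    linarith
  have h6 : T ≤ ‖N.lap γ θ‖ + C * x ^ 2 := by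
    have := norm_sub_norm_le (N.flow γ θ) (N.lap γ θ)
    linarith
  have h7 : 2 * C * x ≤ κ / (4 * C) := by
    rw [le_div_iff₀ (by positivity)]
    calc 2 * C * x * (4 * C) = 8 * C ^ 2 * x := by ring
      _ ≤ 8 * C ^ 2 * ε := by gcongr
      _ ≤ κ := hε
  have h8 : κ / (2 * C) = κ / (4 * C) + κ / (4 * C) := by field_simp; norm_num
  unfold quot
  rw [← hx, div_le_iff₀ hx0, sub_mul, div_mul_cancel₀ _ hx0.ne']
  rw [h8] at hT
  nlinarith

theorem LocalModel.mono {C ε ε' : ℝ} {γ : LineVec m} (hM : N.LocalModel C ε γ) (h : ε' ≤ ε) :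
    N.LocalModel C ε' γ :=
  ⟨hM.1, fun θ => ⟨(hM.2 θ).1, fun hθ => (hM.2 θ).2 (hθ.trans h)⟩⟩

variable {r₁ r₂ r₃ : ℝ} {a b c : ℕ → ℝ} {γ : ℕ → LineVec m} {z θ : ℕ → BusVec nd ng}

theorem IsPALM.mem_of_pos (hP : N.IsPALM r₁ r₂ r₃ a b c γ z θ) (hp : IsProper N.Φ) {k : ℕ}
    (hk : 1 ≤ k) : γ k ∈ N.feasγ ∧ z k ∈ N.feasz ∧ θ k ∈ N.feasθ := by
  obtain ⟨j, rfl⟩ : ∃ j, k = j + 1 := ⟨k - 1, by omega⟩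
  exact ⟨(hP.minγ hp j).1, (hP.minz j).1, (hP.minθ j).1⟩

theorem IsPALM.tendsto_steps (hP : N.IsPALM r₁ r₂ r₃ a b c γ z θ) (hp : IsProper N.Φ)
    (hL : N.LipschitzConditions γ z θ) (hr₁ : 1 < r₁) (hr₂ : 1 < r₂) (hr₃ : 1 < r₃) :
    Tendsto (fun k => N.L₁ (z k) (θ k) * ‖γ (k + 1) - γ k‖ ^ 2) atTop (𝓝 0) ∧
    Tendsto (fun k => ‖z (k + 1) - z k‖) atTop (𝓝 0) ∧
    Tendsto (fun k => ‖θ (k + 1) - θ k‖) atTop (𝓝 0) := by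
  obtain ⟨c₃, hc₃, hL₃⟩ := N.exists_le_L₃
  have hρ := N.ρ_pos
  set h : ℕ → ℝ := fun k => N.H (γ k) (z k) (θ k) with hh
  have hB : ∀ k, 1 ≤ k → inner ℝ (loadVec nd ng) (WithLp.toLp 2 N.P) ≤ h k := fun k hk =>
    N.H_ge (hP.mem_of_pos hp hk).2.1 _ _
  have hdec : ∀ k, 1 ≤ k →
      (r₁ - 1) / 2 * (N.L₁ (z k) (θ k) * ‖γ (k + 1) - γ k‖ ^ 2) +
      (r₂ - 1) / 2 * N.ρ * ‖z (k + 1) - z k‖ ^ 2 +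
      (r₃ - 1) / 2 * c₃ * ‖θ (k + 1) - θ k‖ ^ 2 ≤ h k - h (k + 1) := by
    intro k hk
    obtain ⟨f1, f2, f3⟩ := hP.mem_of_pos hp hk
    obtain ⟨d1, d2, d3⟩ := hP.descent hp hL f1 f2 f3
    have h3 : (r₃ - 1) / 2 * c₃ * ‖θ (k + 1) - θ k‖ ^ 2 ≤
        (r₃ - 1) / 2 * N.L₃ (γ (k + 1)) (z (k + 1)) * ‖θ (k + 1) - θ k‖ ^ 2 := by
      have := hL₃ (γ (k + 1)) (z (k + 1)) (hP.minγ hp k).1.1 (hP.L₃_pos hr₃ k)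
      have h0 : 0 ≤ (r₃ - 1) / 2 := by linarith
      gcongr
    simp only [hh]
    linarith
  have p1 : ∀ k, 0 ≤ N.L₁ (z k) (θ k) * ‖γ (k + 1) - γ k‖ ^ 2 := fun k =>
    mul_nonneg (hP.L₁_pos hr₁ k).le (sq_nonneg _)
  have e1 : 0 < (r₁ - 1) / 2 := by linarith
  have e2 : 0 < (r₂ - 1) / 2 * N.ρ := mul_pos (by linarith) hρ
  have e3 : 0 < (r₃ - 1) / 2 * c₃ := mul_pos (by linarith) hc₃
  have q1 := fun k => mul_nonneg e1.le (p1 k)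
  have q2 := fun k => mul_nonneg e2.le (sq_nonneg ‖z (k + 1) - z k‖)
  have q3 := fun k => mul_nonneg e3.le (sq_nonneg ‖θ (k + 1) - θ k‖)
  have hmono : ∀ k, 1 ≤ k → h (k + 1) ≤ h k := fun k hk => by
    linarith [hdec k hk, q1 k, q2 k, q3 k]
  have sqrt_lim : ∀ u : ℕ → ℝ, (∀ k, 0 ≤ u k) → Tendsto (fun k => u k ^ 2) atTop (𝓝 0) →
      Tendsto u atTop (𝓝 0) := fun u hu hlim => by
    have := hlim.sqrt
    simpa [Real.sqrt_sq (hu _)] using this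
  refine ⟨?_, sqrt_lim _ (fun k => norm_nonneg _) ?_, sqrt_lim _ (fun k => norm_nonneg _) ?_⟩
  · refine tendsto_zero_of_le_decrement (C := 1 / ((r₁ - 1) / 2)) p1 hB hmono fun k hk => ?_
    rw [one_div_mul_eq_div, le_div_iff₀ e1]
    linarith [hdec k hk, q2 k, q3 k]
  · refine tendsto_zero_of_le_decrement (C := 1 / ((r₂ - 1) / 2 * N.ρ)) (fun k => sq_nonneg _)
      hB hmono fun k hk => ?_
    rw [one_div_mul_eq_div, le_div_iff₀ e2]
    linarith [hdec k hk, q1 k, q3 k]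
  · refine tendsto_zero_of_le_decrement (C := 1 / ((r₃ - 1) / 2 * c₃)) (fun k => sq_nonneg _)
      hB hmono fun k hk => ?_
    rw [one_div_mul_eq_div, le_div_iff₀ e3]
    linarith [hdec k hk, q1 k, q2 k]

/-- Bounds for the effective step length `ρ / cₖ` of the angle steps. -/
theorem IsPALM.step_length (hP : N.IsPALM r₁ r₂ r₃ a b c γ z θ) (hp : IsProper N.Φ)
    (hL : N.LipschitzConditions γ z θ) (hr₃ : 1 < r₃) :
    ∃ τ₀ τ₁ : ℝ, 0 < τ₀ ∧ 0 < τ₁ ∧ ∀ k, τ₀ ≤ N.ρ / c k ∧ N.ρ / c k ≤ τ₁ ∧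
      N.ρ / c k * (specNorm (N.Q (γ (k + 1))) * specNorm N.E ^ 2) ≤ 1 / 2 := by
  obtain ⟨c₃, hc₃, hL₃⟩ := N.exists_le_L₃
  obtain ⟨s₁, s₂, s₃, -, -, hs₃, hs⟩ := hL.moduli_bounded
  have hρ := N.ρ_pos
  have hr₃0 : 0 < r₃ := by linarith
  refine ⟨N.ρ / (r₃ * s₃), N.ρ / (r₃ * c₃), by positivity, by positivity, fun k => ?_⟩
  have hcp := hP.c_pos k
  have hc := hP.c_eq k
  have hpos := hP.L₃_pos hr₃ k
  have hge := hL₃ (γ (k + 1)) (z (k + 1)) (hP.minγ hp k).1.1 hpos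
  have hle := (hs (k + 1)).2.2
  refine ⟨by rw [hc]; gcongr, by rw [hc]; gcongr, ?_⟩
  have hQ : 0 ≤ specNorm (N.Q (γ (k + 1))) := norm_nonneg _
  have hR := norm_nonneg (N.R (γ (k + 1)) (z (k + 1)))
  have h2 : 2 * (N.ρ * (specNorm (N.Q (γ (k + 1))) * specNorm N.E ^ 2)) ≤
      N.L₃ (γ (k + 1)) (z (k + 1)) := by
    rw [L₃]
    calc _ = N.ρ * specNorm N.E ^ 2 * (2 * specNorm (N.Q (γ (k + 1)))) := by ring
      _ ≤ _ := by gcongr; linarith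
  have h3 : N.L₃ (γ (k + 1)) (z (k + 1)) ≤ c k := by
    rw [hc]; exact le_mul_of_one_le_left hpos.le hr₃.le
  rw [div_mul_eq_mul_div, div_le_iff₀ hcp]
  linarith

theorem mem_feasθ_of_norm_pr {t : BusVec nd ng} (h : specNorm N.E * ‖N.pr t‖ ≤ 1) :
    t ∈ N.feasθ := fun l => by
  have h1 := PiLp.norm_apply_le (N.incidT t) l
  rw [Real.norm_eq_abs, ← incidT_pr] at h1
  have h2 := h1.trans ((N.norm_incidT_le _).trans h)
  rw [incidT_pr] at h2
  linarith [Real.pi_gt_three]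

/-- When everything is shed and the constraint is inactive, the angle step is a gradient step. -/
theorem IsPALM.angle_eq (hP : N.IsPALM r₁ r₂ r₃ a b c γ z θ) {k : ℕ}
    (hz : z (k + 1) = N.fullShed)
    (hmem : θ k - (N.ρ / c k) • N.dir (γ (k + 1)) (θ k) ∈ N.feasθ) :
    θ (k + 1) = θ k - (N.ρ / c k) • N.dir (γ (k + 1)) (θ k) := by
  have hv : θ k - (1 / c k) • N.gradθ (γ (k + 1)) (z (k + 1)) (θ k) =
      θ k - (N.ρ / c k) • N.dir (γ (k + 1)) (θ k) := by
    rw [hz, gradθ_fullShed, smul_smul, one_div_mul_eq_div]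
  have h1 := le_of_mul_le_mul_left ((hP.minθ k).2 _ hmem) (half_pos (hP.c_pos k))
  rw [hv, sub_self, norm_zero, zero_pow two_ne_zero] at h1
  have h2 : ‖θ (k + 1) - (θ k - (N.ρ / c k) • N.dir (γ (k + 1)) (θ k))‖ = 0 :=
    (pow_eq_zero_iff two_ne_zero).1 (le_antisymm h1 (sq_nonneg _))
  exact sub_eq_zero.1 (norm_eq_zero.1 h2)

/-- The flow decreases at a linear rate in the angle steps, by the Lojasiewicz inequality. -/
theorem IsPALM.flow_contraction (hP : N.IsPALM r₁ r₂ r₃ a b c γ z θ) (hp : IsProper N.Φ)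
    (hL : N.LipschitzConditions γ z θ) (hr₃ : 1 < r₃) {k : ℕ} (hk : 1 ≤ k) {C τ₀ c₃ : ℝ}
    (hC : 0 < C) (hτ₀ : 0 < τ₀) (hc₃ : 0 < c₃) (hτ : τ₀ ≤ N.ρ / c k)
    (hL₃ : c₃ ≤ N.L₃ (γ (k + 1)) (z (k + 1)))
    (hPL : ‖N.flow (γ (k + 1)) (θ k)‖ ≤ C * ‖N.dir (γ (k + 1)) (θ k)‖)
    (hz : z (k + 1) = N.fullShed)
    (hθ : θ (k + 1) = θ k - (N.ρ / c k) • N.dir (γ (k + 1)) (θ k)) :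
    ‖N.flow (γ (k + 1)) (θ (k + 1))‖ ≤
      (1 - min ((r₃ - 1) * c₃ * τ₀ ^ 2 / (N.ρ * C ^ 2)) 1 / 2) *
        ‖N.flow (γ (k + 1)) (θ k)‖ := by
  obtain ⟨f1, f2, f3⟩ := hP.mem_of_pos hp hk
  obtain ⟨-, -, d3⟩ := hP.descent hp hL f1 f2 f3
  have hρ := N.ρ_pos
  have h1 : ‖θ (k + 1) - θ k‖ = N.ρ / c k * ‖N.dir (γ (k + 1)) (θ k)‖ := by
    rw [hθ, sub_sub_cancel_left, norm_neg, norm_smul, Real.norm_of_nonneg (hτ₀.le.trans hτ)]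
  rw [hz] at d3 hL₃
  rw [N.H_fullShed, N.H_fullShed] at d3
  generalize ‖N.flow (γ (k + 1)) (θ (k + 1))‖ = T₁ at *
  have hT' := norm_nonneg (N.flow (γ (k + 1)) (θ k))
  generalize ‖N.flow (γ (k + 1)) (θ k)‖ = T' at *
  refine le_one_sub_mul_of_sq hT' ?_
  have h2 : τ₀ * (T' / C) ≤ ‖θ (k + 1) - θ k‖ := by
    rw [h1]
    have h0 : T' / C ≤ ‖N.dir (γ (k + 1)) (θ k)‖ := by rw [div_le_iff₀ hC]; linarith
    have hτ' := hτ₀.le.trans hτ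
    gcongr
  have h3 : (r₃ - 1) / 2 * c₃ * (τ₀ * (T' / C)) ^ 2 ≤
      (r₃ - 1) / 2 * N.L₃ (γ (k + 1)) N.fullShed * ‖θ (k + 1) - θ k‖ ^ 2 := by
    have h0 : 0 ≤ (r₃ - 1) / 2 := by linarith
    have h0' := mul_nonneg h0 (hc₃.le.trans hL₃)
    gcongr
  have h4 : (r₃ - 1) / 2 * c₃ * (τ₀ * (T' / C)) ^ 2 =
      N.ρ / 2 * ((r₃ - 1) * c₃ * τ₀ ^ 2 / (N.ρ * C ^ 2) * T' ^ 2) := by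
    field_simp
  generalize (r₃ - 1) * c₃ * τ₀ ^ 2 / (N.ρ * C ^ 2) = μ₁ at *
  have h5 : N.ρ / 2 * (T₁ ^ 2 + μ₁ * T' ^ 2) ≤ N.ρ / 2 * T' ^ 2 := by linarith
  have h6 := le_of_mul_le_mul_left h5 (half_pos hρ)
  linarith

/-- The flow does not increase in the line steps, and its square decreases by a multiple of the
squared angles at each change. -/
theorem IsPALM.flow_line_step (hP : N.IsPALM r₁ r₂ r₃ a b c γ z θ) (hp : IsProper N.Φ)
    (hL : N.LipschitzConditions γ z θ) (hr₁ : 1 < r₁) {k : ℕ} (hk : 1 ≤ k) {C : ℝ} (hC : 0 < C)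
    (hpr : ‖N.pr (θ k)‖ ^ 2 ≤ C * N.L₁ (z k) (θ k)) (hz : z k = N.fullShed) :
    ‖N.flow (γ (k + 1)) (θ k)‖ ≤ ‖N.flow (γ k) (θ k)‖ ∧
    (γ (k + 1) ≠ γ k → ‖N.flow (γ (k + 1)) (θ k)‖ ^ 2 ≤
      ‖N.flow (γ k) (θ k)‖ ^ 2 - (r₁ - 1) / (N.ρ * C) * ‖N.pr (θ k)‖ ^ 2) := by
  obtain ⟨f1, f2, f3⟩ := hP.mem_of_pos hp hk
  obtain ⟨d1, -, -⟩ := hP.descent hp hL f1 f2 f3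
  have hρ := N.ρ_pos
  have hL₁ := hP.L₁_pos hr₁ k
  rw [hz] at d1 hpr hL₁
  rw [N.H_fullShed, N.H_fullShed] at d1
  have hT' := norm_nonneg (N.flow (γ (k + 1)) (θ k))
  generalize ‖N.flow (γ (k + 1)) (θ k)‖ = T' at *
  have hT := norm_nonneg (N.flow (γ k) (θ k))
  generalize ‖N.flow (γ k) (θ k)‖ = T at *
  have hr : 0 ≤ (r₁ - 1) / 2 * N.L₁ N.fullShed (θ k) := mul_nonneg (by linarith) hL₁.le
  constructor
  · refine (sq_le_sq₀ hT' hT).1 ?_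
    have h0 := mul_nonneg hr (sq_nonneg ‖γ (k + 1) - γ k‖)
    have h1 : N.ρ / 2 * T' ^ 2 ≤ N.ρ / 2 * T ^ 2 := by linarith
    exact le_of_mul_le_mul_left h1 (half_pos hρ)
  · intro hne
    have h1 := f1.1.one_le_norm_sub_sq (hP.minγ hp k).1.1 hne
    have h2 := le_mul_of_one_le_right hr h1
    have h3 : N.ρ / 2 * ((r₁ - 1) / (N.ρ * C) * ‖N.pr (θ k)‖ ^ 2) ≤
        (r₁ - 1) / 2 * N.L₁ N.fullShed (θ k) := by
      have h0 : 0 ≤ (r₁ - 1) / (N.ρ * C) := div_nonneg (by linarith) (by positivity)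
      calc _ ≤ N.ρ / 2 * ((r₁ - 1) / (N.ρ * C) * (C * N.L₁ N.fullShed (θ k))) := by gcongr
        _ = _ := by field_simp
    have h4 : N.ρ / 2 * (T' ^ 2 + (r₁ - 1) / (N.ρ * C) * ‖N.pr (θ k)‖ ^ 2) ≤ N.ρ / 2 * T ^ 2 := by
      linarith
    have h5 := le_of_mul_le_mul_left h4 (half_pos hρ)
    linarith

theorem IsPALM.pr_ne_zero (hP : N.IsPALM r₁ r₂ r₃ a b c γ z θ) (hr₁ : 1 < r₁) (k : ℕ) :
    N.pr (θ k) ≠ 0 := by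
  intro h0
  refine (hP.L₁_pos hr₁ k).ne' ?_
  have hs0 : N.sinDiff (θ k) = 0 := by
    funext l
    rw [sinDiff, angleDiff_eq, ← incidT_pr, h0]
    simp
  rw [L₁, hs0]
  simp [specNorm]

/-- The regime of full shedding and small angles: it persists, since the first potential does not
increase, and a second potential does not increase and drops by a fixed amount at each change of the
line variables. -/
theorem IsPALM.regime_step (hP : N.IsPALM r₁ r₂ r₃ a b c γ z θ) (hp : IsProper N.Φ)
    (hL : N.LipschitzConditions γ z θ) (hr₁ : 1 < r₁) (hr₂ : 1 < r₂) (hr₃ : 1 < r₃) :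
    ∃ C CW CV ε κ : ℝ, 0 < C ∧ 0 < CW ∧ 0 < CV ∧ 0 < ε ∧ 0 < κ ∧
      (∀ k, 1 ≤ k → ‖N.flow (γ k) (θ k)‖ ≤ C * ‖N.pr (θ k)‖) ∧
      ∀ᶠ k in atTop, ‖N.pr (θ k)‖ ≤ ε → z (k + 1) = N.fullShed ∧ (z k = N.fullShed →
        ‖N.pr (θ (k + 1))‖ + CW * ‖N.flow (γ (k + 1)) (θ (k + 1))‖ ≤
          ‖N.pr (θ k)‖ + CW * ‖N.flow (γ k) (θ k)‖ ∧
        N.quot (γ (k + 1)) (θ (k + 1)) + CV * ‖N.flow (γ (k + 1)) (θ (k + 1))‖ ≤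
          N.quot (γ k) (θ k) + CV * ‖N.flow (γ k) (θ k)‖ ∧
        (γ (k + 1) ≠ γ k →
          N.quot (γ (k + 1)) (θ (k + 1)) + CV * ‖N.flow (γ (k + 1)) (θ (k + 1))‖ ≤
            N.quot (γ k) (θ k) + CV * ‖N.flow (γ k) (θ k)‖ - κ)) := by
  obtain ⟨C, ε₀, hC, hε₀, hM⟩ := N.exists_localModel
  obtain ⟨C₁, hC₁, hsin⟩ := N.exists_norm_pr_le_sinVec
  obtain ⟨CL, hCL, hL₁⟩ := N.exists_sq_sinVec_le_L₁
  obtain ⟨c₃, hc₃, hL₃⟩ := N.exists_le_L₃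
  obtain ⟨τ₀, τ₁, hτ₀p, hτ₁p, hτ⟩ := hP.step_length hp hL hr₃
  have hρ := N.ρ_pos
  set κ₁ := (r₁ - 1) / (N.ρ * (C₁ ^ 2 * CL)) with hκ₁
  have hκ₁p : 0 < κ₁ := div_pos (by linarith) (by positivity)
  set μ₁ := (r₃ - 1) * c₃ * τ₀ ^ 2 / (N.ρ * C ^ 2) with hμ₁
  have hμ₁p : 0 < μ₁ := div_pos (mul_pos (mul_pos (by linarith) hc₃) (by positivity)) (by positivity)
  set μ := min μ₁ 1 / 2 with hμ
  have hμp : 0 < μ := by positivity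
  set e := specNorm N.E + 1 with he
  have hE0 : 0 ≤ specNorm N.E := norm_nonneg _
  obtain ⟨ε, hε, hεa, hεb, hεc, hεd, hεe⟩ : ∃ ε : ℝ, 0 < ε ∧ ε ≤ ε₀ ∧ τ₁ * C * (C * ε) ≤ 1 / 4 ∧
      8 * C ^ 2 * ε ≤ κ₁ ∧ C * ε < 1 / (4 * (r₂ * N.ρ)) ∧ e * ((1 + τ₁ * C ^ 2) * ε) ≤ 1 := by
    have hb : 0 < 1 / (4 * (r₂ * N.ρ)) := by positivity
    have hl : ∀ A B : ℝ, 0 < B → ∀ᶠ ε : ℝ in 𝓝[>] 0, A * ε < B := fun A B hB => by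
      have : Tendsto (fun ε : ℝ => A * ε) (𝓝[>] 0) (𝓝 0) := by
        have h0 : Tendsto (fun ε : ℝ => A * ε) (𝓝 0) (𝓝 (A * 0)) := by
          exact tendsto_id.const_mul A
        rw [mul_zero] at h0
        exact h0.mono_left nhdsWithin_le_nhds
      exact this.eventually (gt_mem_nhds hB)
    obtain ⟨ε, h1, h2, h3, h4, h5, h6⟩ := (eventually_mem_nhdsWithin.and ((hl 1 ε₀ hε₀).and
      ((hl (τ₁ * C * C) (1 / 4) (by norm_num)).and ((hl (8 * C ^ 2) κ₁ hκ₁p).and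
      ((hl C _ hb).and (hl (e * (1 + τ₁ * C ^ 2)) 1 one_pos)))))).exists
    exact ⟨ε, h1, by linarith, by linarith, h4.le, h5, by linarith⟩
  have hbin : ∀ k, 1 ≤ k → IsBinary (γ k) := fun k hk => (hP.mem_of_pos hp hk).1.1
  refine ⟨C, τ₁ * C / μ, 8 * C * (τ₁ * C) / μ, ε, κ₁ / (4 * C), hC, by positivity, by positivity, hε,
    by positivity, fun k hk => ((hM _ (hbin k hk)).2 _).1, ?_⟩
  have hzlim := (hP.tendsto_steps hp hL hr₁ hr₂ hr₃).2.1
  filter_upwards [eventually_ge_atTop 1, hzlim.eventually (gt_mem_nhds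
    (show (0 : ℝ) < 1 / (4 * (r₂ * N.ρ)) by positivity))] with k hk hdz hθ
  obtain ⟨f1, f2, f3⟩ := hP.mem_of_pos hp hk
  have hMk := (hM _ (hbin k hk)).mono hεa
  have hMk' := (hM _ (hbin (k + 1) (by omega))).mono hεa
  have hbk : b k = r₂ * N.ρ := hP.b_eq k
  have hflow' : ‖N.flow (γ (k + 1)) (θ k)‖ ≤ C * ‖N.pr (θ k)‖ := (hMk'.2 _).1
  have hz' : z (k + 1) = N.fullShed := by
    refine N.eq_fullShed_of_nearest hr₂ hbk (hP.minz k).1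
      (fun y hy => le_of_mul_le_mul_left ((hP.minz k).2 y hy) (half_pos (hP.b_pos k))) ?_
    have h1 : ‖N.flow (γ (k + 1)) (θ k)‖ ≤ C * ε := hflow'.trans (by gcongr)
    have h2 : 1 / (2 * b k) = 1 / (4 * (r₂ * N.ρ)) + 1 / (4 * (r₂ * N.ρ)) := by
      rw [hbk]; field_simp; norm_num
    linarith
  refine ⟨hz', fun hz => ?_⟩
  have hprL : ‖N.pr (θ k)‖ ^ 2 ≤ C₁ ^ 2 * CL * N.L₁ (z k) (θ k) := by
    calc ‖N.pr (θ k)‖ ^ 2 ≤ (C₁ * ‖N.sinVec (θ k)‖) ^ 2 := by gcongr; exact hsin _ f3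
      _ = C₁ ^ 2 * ‖N.sinVec (θ k)‖ ^ 2 := by ring
      _ ≤ C₁ ^ 2 * (CL * N.L₁ (z k) (θ k)) := by gcongr; exact hL₁ _ _
      _ = _ := by ring
  have hθ0 := hP.pr_ne_zero hr₁ k
  obtain ⟨hττ₀, hττ₁, hτΛ⟩ := hτ k
  obtain ⟨hstep1, hstep2⟩ :=
    hMk'.angle_step hC hθ hθ0 (hτ₀p.le.trans hττ₀) hττ₁ hτΛ hεb
  have hPL := ((hMk'.2 (θ k)).2 hθ).1
  have hθ' : θ (k + 1) = θ k - (N.ρ / c k) • N.dir (γ (k + 1)) (θ k) := by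
    refine hP.angle_eq hz' (mem_feasθ_of_norm_pr ?_)
    have h2 : ‖N.pr (θ k - (N.ρ / c k) • N.dir (γ (k + 1)) (θ k))‖ ≤ (1 + τ₁ * C ^ 2) * ε := by
      calc _ ≤ ‖N.pr (θ k)‖ + τ₁ * C * (C * ‖N.pr (θ k)‖) := hstep1.trans (by gcongr)
        _ = (1 + τ₁ * C ^ 2) * ‖N.pr (θ k)‖ := by ring
        _ ≤ _ := by gcongr
    refine le_trans ?_ hεe
    gcongr
    rw [he]; linarith
  rw [← hθ'] at hstep1 hstep2
  have hL₃k := hL₃ (γ (k + 1)) (z (k + 1)) (hbin (k + 1) (by omega)) (hP.L₃_pos hr₃ k)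
  have hcontr := hP.flow_contraction hp hL hr₃ hk hC hτ₀p hc₃ hττ₀ hL₃k hPL hz' hθ'
  rw [← hμ₁, ← hμ] at hcontr
  obtain ⟨hTT', hline⟩ := hP.flow_line_step hp hL hr₁ hk (show 0 < C₁ ^ 2 * CL by positivity)
    hprL hz
  rw [← hκ₁] at hline
  have hdrop : γ (k + 1) ≠ γ k →
      N.quot (γ (k + 1)) (θ k) ≤ N.quot (γ k) (θ k) - κ₁ / (4 * C) := fun hne =>
    hMk.quot_drop hMk' hC hκ₁p hεc hθ hθ0 (hline hne)
  clear hM hMk hMk' hbin hL₃ hsin hL₁ hτ hline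
  have hT0' := norm_nonneg (N.flow (γ (k + 1)) (θ k))
  generalize ‖N.flow (γ (k + 1)) (θ k)‖ = T' at *
  generalize ‖N.flow (γ (k + 1)) (θ (k + 1))‖ = T₁ at *
  generalize ‖N.flow (γ k) (θ k)‖ = T at *
  have hμT : T' ≤ (T - T₁) / μ := by
    rw [le_div_iff₀ hμp]; linarith
  have hW : τ₁ * C * T' ≤ τ₁ * C / μ * (T - T₁) := by
    calc τ₁ * C * T' ≤ τ₁ * C * ((T - T₁) / μ) := by gcongr
      _ = _ := by ring
  have hV : 8 * C * (τ₁ * C * T') ≤ 8 * C * (τ₁ * C) / μ * (T - T₁) := by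
    calc 8 * C * (τ₁ * C * T') ≤ 8 * C * (τ₁ * C * ((T - T₁) / μ)) := by gcongr
      _ = _ := by ring
  refine ⟨by linarith, ?_, fun hne => by linarith [hdrop hne]⟩
  have hquot : N.quot (γ (k + 1)) (θ k) ≤ N.quot (γ k) (θ k) := by
    by_cases hne : γ (k + 1) = γ k
    · rw [hne]
    · have : 0 < κ₁ / (4 * C) := by positivity
      linarith [hdrop hne]
  linarith

/-- The line variables change only finitely often. -/
theorem IsPALM.eventually_γ_eq (hP : N.IsPALM r₁ r₂ r₃ a b c γ z θ) (hp : IsProper N.Φ)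
    (hL : N.LipschitzConditions γ z θ) (hr₁ : 1 < r₁) (hr₂ : 1 < r₂) (hr₃ : 1 < r₃) :
    ∀ᶠ k in atTop, γ (k + 1) = γ k := by
  obtain ⟨C, CW, CV, ε, κ, hC, hCW, hCV, hε, hκ, hflow, hreg⟩ :=
    hP.regime_step hp hL hr₁ hr₂ hr₃
  obtain ⟨C₁, hC₁, hsin⟩ := N.exists_norm_pr_le_sinVec
  obtain ⟨CL, hCL, hL₁⟩ := N.exists_sq_sinVec_le_L₁
  obtain ⟨hlim₁, -, hlim₃⟩ := hP.tendsto_steps hp hL hr₁ hr₂ hr₃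
  by_contra hcon
  rw [not_eventually] at hcon
  set ε' := ε / (2 * (1 + CW * C)) with hε'
  have hε'p : 0 < ε' := by positivity
  have hε'ε : ε' ≤ ε := by
    rw [hε']
    refine div_le_self hε.le ?_
    have : 0 < CW * C := by positivity
    linarith
  -- a late change of the line variables forces small angles
  obtain ⟨k, hne, hk1, hkL, hkθ, hkreg⟩ := (hcon.and_eventually ((eventually_ge_atTop 1).and
    ((hlim₁.eventually (gt_mem_nhds (show (0 : ℝ) < ε' ^ 2 / (C₁ ^ 2 * CL) by positivity))).and
    ((hlim₃.eventually (gt_mem_nhds hε'p)).and (eventually_forall_ge_atTop.2 hreg))))).exists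
  obtain ⟨f1, f2, f3⟩ := hP.mem_of_pos hp hk1
  have hpr : ‖N.pr (θ k)‖ ≤ ε' := by
    have h1 := f1.1.one_le_norm_sub_sq (hP.minγ hp k).1.1 hne
    have h2 : N.L₁ (z k) (θ k) ≤ ε' ^ 2 / (C₁ ^ 2 * CL) :=
      (le_mul_of_one_le_right (hP.L₁_pos hr₁ k).le h1).trans hkL.le
    refine (sq_le_sq₀ (norm_nonneg _) hε'p.le).1 ?_
    calc ‖N.pr (θ k)‖ ^ 2 ≤ (C₁ * ‖N.sinVec (θ k)‖) ^ 2 := by gcongr; exact hsin _ f3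
      _ = C₁ ^ 2 * ‖N.sinVec (θ k)‖ ^ 2 := by ring
      _ ≤ C₁ ^ 2 * (CL * (ε' ^ 2 / (C₁ ^ 2 * CL))) := by
          gcongr; exact (hL₁ _ _).trans (by gcongr)
      _ = ε' ^ 2 := by field_simp
  have hpr' : ‖N.pr (θ (k + 1))‖ ≤ 2 * ε' := by
    have h1 : N.pr (θ (k + 1)) = N.pr (θ k) + N.pr (θ (k + 1) - θ k) := by
      rw [← map_add]; congr 1; abel
    rw [h1]
    refine (norm_add_le _ _).trans ?_
    linarith [N.norm_pr_le (θ (k + 1) - θ k)]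
  have hz := (hkreg k le_rfl (hpr.trans hε'ε)).1
  have hW0 : ‖N.pr (θ (k + 1))‖ + CW * ‖N.flow (γ (k + 1)) (θ (k + 1))‖ ≤ ε := by
    calc _ ≤ ‖N.pr (θ (k + 1))‖ + CW * (C * ‖N.pr (θ (k + 1))‖) := by
          gcongr; exact hflow (k + 1) (by omega)
      _ = (1 + CW * C) * ‖N.pr (θ (k + 1))‖ := by ring
      _ ≤ (1 + CW * C) * (2 * ε') := by gcongr
      _ = ε := by rw [hε']; field_simp
  have hstay : ∀ j, z (k + 1 + j) = N.fullShed ∧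
      ‖N.pr (θ (k + 1 + j))‖ + CW * ‖N.flow (γ (k + 1 + j)) (θ (k + 1 + j))‖ ≤ ε := by
    intro j
    induction j with
    | zero => exact ⟨hz, hW0⟩
    | succ j ih =>
      have hflow0 := mul_nonneg hCW.le (norm_nonneg (N.flow (γ (k + 1 + j)) (θ (k + 1 + j))))
      obtain ⟨h1, h2⟩ := hkreg (k + 1 + j) (by omega) (by linarith [ih.2])
      exact ⟨h1, (h2 ih.1).1.trans ih.2⟩
  have hstep : ∀ n, k + 1 ≤ n → ‖N.pr (θ n)‖ ≤ ε ∧ z n = N.fullShed := fun n hn => by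
    obtain ⟨j, rfl⟩ := Nat.exists_eq_add_of_le hn
    have hflow0 := mul_nonneg hCW.le (norm_nonneg (N.flow (γ (k + 1 + j)) (θ (k + 1 + j))))
    exact ⟨by linarith [(hstay j).2], (hstay j).1⟩
  have hfin := eventually_not_of_drop (p := fun n => γ (n + 1) ≠ γ n) (B := 0) hκ (K := k + 1)
    (V := fun n => N.quot (γ n) (θ n) + CV * ‖N.flow (γ n) (θ n)‖)
    (fun n _ => add_nonneg (quot_nonneg _ _) (mul_nonneg hCV.le (norm_nonneg _)))
    (fun n hn => ((hkreg n (by omega) (hstep n hn).1).2 (hstep n hn).2).2.1)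
    (fun n hn => ((hkreg n (by omega) (hstep n hn).1).2 (hstep n hn).2).2.2)
  obtain ⟨n, hn1, hn2⟩ := (hcon.and_eventually hfin).exists
  exact hn2 hn1

end

end Problem

/-! ### Convergence of descent sequences for Kurdyka-Lojasiewicz functions -/

theorem frechetSubdiff_subset_subdiff {V : Type*} [NormedAddCommGroup V] [InnerProductSpace ℝ V]
    (f : V → EReal) (x : V) : frechetSubdiff f x ⊆ subdiff f x := fun v hv =>
  ⟨hv.1, hv.2.1, fun _ => x, fun _ => v, tendsto_const_nhds, tendsto_const_nhds, fun _ => hv,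
    tendsto_const_nhds⟩

/-- A bounded sequence with sufficient decrease and with subgradients bounded by the step lengths
has finite length and converges to a critical point, for a Kurdyka-Lojasiewicz function which is
continuous along the sequence. -/
theorem IsKLFunction.summable_and_tendsto {V : Type*} [NormedAddCommGroup V]
    [InnerProductSpace ℝ V] [ProperSpace V] {f : V → EReal} (hf : IsKLFunction f) {x : ℕ → V}
    {h : ℕ → ℝ} {α β : ℝ} (hα : 0 < α) (hβ : 0 < β) (hfx : ∀ k, f (x k) = (h k : EReal))
    (hdec : ∀ k, α * ‖x (k + 1) - x k‖ ^ 2 ≤ h k - h (k + 1))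
    (hsub : ∀ k, ∃ v ∈ frechetSubdiff f (x (k + 1)), ‖v‖ ≤ β * ‖x (k + 1) - x k‖)
    (hbdd : Bornology.IsBounded (Set.range x))
    (hcont : ∀ (xs : V) (φ : ℕ → ℕ), StrictMono φ → Tendsto (x ∘ φ) atTop (𝓝 xs) →
      ∃ F : ℝ, f xs = (F : EReal) ∧ Tendsto h atTop (𝓝 F)) :
    (Summable fun k => ‖x (k + 1) - x k‖) ∧
      ∃ xs, Tendsto x atTop (𝓝 xs) ∧ IsCriticalPoint f xs := by
  obtain ⟨xs, -, φ, hφ, hxs⟩ := tendsto_subseq_of_bounded hbdd fun n => Set.mem_range_self n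
  obtain ⟨F, hF, hlim⟩ := hcont xs φ hφ hxs
  have hmono : ∀ k, h (k + 1) ≤ h k := fun k => by
    have := hdec k
    have h2 : 0 ≤ α * ‖x (k + 1) - x k‖ ^ 2 := by positivity
    linarith
  have hanti : Antitone h := antitone_nat_of_succ_le hmono
  have hFle : ∀ k, F ≤ h k := fun k => hanti.le_of_tendsto hlim k
  have hΔ : Tendsto (fun k => ‖x (k + 1) - x k‖) atTop (𝓝 0) := by
    have h1 : Tendsto (fun k => (h k - h (k + 1)) / α) atTop (𝓝 0) := by
      simpa using (hlim.sub (hlim.comp (tendsto_add_atTop_nat 1))).div_const α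
    have h2 : Tendsto (fun k => ‖x (k + 1) - x k‖ ^ 2) atTop (𝓝 0) :=
      squeeze_zero (fun k => sq_nonneg _) (fun k => by
        rw [le_div_iff₀ hα]; linarith [hdec k]) h1
    have h3 := h2.sqrt
    simpa [Real.sqrt_sq (norm_nonneg _)] using h3
  choose v hv hvβ using hsub
  have hcrit : IsCriticalPoint f xs := by
    have hge : ∀ j, 1 ≤ φ (j + 1) := fun j => (Nat.le_add_left 1 j).trans hφ.le_apply
    have hsucc : ∀ j, φ (j + 1) - 1 + 1 = φ (j + 1) := fun j => by have := hge j; omega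
    have htop : Tendsto (fun j => φ (j + 1) - 1) atTop atTop :=
      (tendsto_sub_atTop_nat 1).comp (hφ.tendsto_atTop.comp (tendsto_add_atTop_nat 1))
    refine ⟨by simp [hF], by simp [hF], fun j => x (φ (j + 1)), fun j => v (φ (j + 1) - 1),
      hxs.comp (tendsto_add_atTop_nat 1), ?_, fun j => ?_, ?_⟩
    · simp only [hfx, hF]
      exact (continuous_coe_real_ereal.tendsto F).comp
        (hlim.comp (hφ.tendsto_atTop.comp (tendsto_add_atTop_nat 1)))
    · have := hv (φ (j + 1) - 1)
      rwa [hsucc] at this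
    · rw [tendsto_zero_iff_norm_tendsto_zero]
      have h1 : Tendsto (fun j => β * ‖x (φ (j + 1) - 1 + 1) - x (φ (j + 1) - 1)‖) atTop (𝓝 0) := by
        simpa using (hΔ.comp htop).const_mul β
      exact squeeze_zero (fun j => norm_nonneg _) (fun j => hvβ _) h1
  have hsum : Summable fun k => ‖x (k + 1) - x k‖ := by
    by_cases hstat : ∃ k₀, h k₀ = F
    · obtain ⟨k₀, hk₀⟩ := hstat
      refine summable_of_ne_finset_zero (s := Finset.range k₀) fun k hk => ?_
      have hk' : k₀ ≤ k := by simpa using hk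
      have h1 : h k = F := le_antisymm (hk₀ ▸ hanti hk') (hFle k)
      have h2 := hdec k
      have h3 := hFle (k + 1)
      have h4 : ‖x (k + 1) - x k‖ ^ 2 ≤ 0 := by
        by_contra! hpos
        have := mul_pos hα hpos
        linarith
      exact (pow_eq_zero_iff two_ne_zero).1 (le_antisymm h4 (sq_nonneg _))
    · push Not at hstat
      have hlt : ∀ k, F < h k := fun k => lt_of_le_of_ne (hFle k) (hstat k).symm
      obtain ⟨η, hη, U, hU, ψ, hψ, hkl⟩ := hf.kl xs ⟨0, hcrit⟩
      obtain ⟨r, hr, hrU⟩ := Metric.mem_nhds_iff.1 hU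
      refine summable_of_kl (f := fun k => h k - F) hα hβ hr hη hψ
        (hxs.mapClusterPt.of_comp hφ.tendsto_atTop) (fun k => sub_pos.2 (hlt k))
        (by simpa using hlim.sub_const F) (fun k => by simpa using hdec k) fun k hxr hfη => ?_
      have hmem : x (k + 1) ∈ U := hrU (by rwa [Metric.mem_ball, dist_eq_norm])
      have h1 := hkl (x (k + 1)) hmem (by rw [hF, hfx]; exact_mod_cast hlt (k + 1)) (by
        rw [hF, hfx]
        have := EReal.add_lt_add_left_coe hfη F
        rwa [← EReal.coe_add, add_sub_cancel] at this)
      rw [hF, hfx, EReal.toReal_coe, EReal.toReal_coe] at h1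
      have h2 : Metric.infEDist (0 : V) (subdiff f (x (k + 1))) ≤
          ENNReal.ofReal (β * ‖x (k + 1) - x k‖) := by
        refine (Metric.infEDist_le_edist_of_mem
          (frechetSubdiff_subset_subdiff f _ (hv k))).trans ?_
        rw [edist_dist, dist_zero_left]
        exact ENNReal.ofReal_le_ofReal (hvβ k)
      have h3 := h1.trans (mul_le_mul_right h2 _)
      rw [← ENNReal.ofReal_mul' (by positivity), ENNReal.one_le_ofReal] at h3
      exact h3
  refine ⟨hsum, xs, ?_, hcrit⟩
  have hcauchy : CauchySeq x := cauchySeq_of_summable_dist (by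
    simpa [dist_eq_norm, norm_sub_rev] using hsum)
  exact tendsto_nhds_of_cauchySeq_of_subseq hcauchy hφ.tendsto_atTop hxs

namespace Problem

noncomputable section

variable {nd ng m : ℕ} {N : Problem nd ng m}

/-! ### Subgradients of the objective -/

theorem norm_mkState_le (p : LineVec m) (q r : BusVec nd ng) :
    ‖(mkState p q r : State nd ng m)‖ ≤ ‖p‖ + ‖q‖ + ‖r‖ := by
  refine (sq_le_sq₀ (norm_nonneg _) (by positivity)).1 ?_
  have h := norm_sq_mkState_sub p 0 q 0 r 0
  have h0 : (mkState (0 : LineVec m) 0 0 : State nd ng m) = 0 := rfl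
  rw [h0, sub_zero, sub_zero, sub_zero, sub_zero] at h
  rw [h]
  nlinarith [norm_nonneg p, norm_nonneg q, norm_nonneg r, mul_nonneg (norm_nonneg p) (norm_nonneg q),
    mul_nonneg (norm_nonneg p) (norm_nonneg r), mul_nonneg (norm_nonneg q) (norm_nonneg r)]

/-- Frechet subgradients of `Φ` from proximal normals of the feasible sets of `z` and `θ`. The
first component is arbitrary, since the feasible set of `γ` is discrete; it is taken to be zero. -/
theorem mem_frechetSubdiff_Φ {x : State nd ng m} (hx : N.Feasible x) {p q : BusVec nd ng} {σ : ℝ}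
    (hσ : 0 ≤ σ) (hpz : ∀ y ∈ N.feasz, inner ℝ p (y - x.snd.fst) ≤ σ * ‖y - x.snd.fst‖ ^ 2)
    (hqθ : ∀ y ∈ N.feasθ, inner ℝ q (y - x.snd.snd) ≤ σ * ‖y - x.snd.snd‖ ^ 2) :
    mkState 0 ((gradient N.Hjoint x).snd.fst + p) ((gradient N.Hjoint x).snd.snd + q) ∈
      frechetSubdiff N.Φ x := by
  refine ⟨by simp [N.Φ_of_feasible hx], by simp [N.Φ_of_feasible hx], fun ε hε => ?_⟩
  have hgrad : HasGradientAt N.Hjoint (gradient N.Hjoint x) x :=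
    (N.differentiable_Hjoint x).hasGradientAt
  have hlo := (hasGradientAt_iff_isLittleO.1 hgrad).def (half_pos hε)
  have hball : ∀ᶠ y in 𝓝 x, ‖y - x‖ < min 1 (ε / (2 * (σ + 1))) := by
    have := Metric.ball_mem_nhds x (show 0 < min 1 (ε / (2 * (σ + 1))) by positivity)
    filter_upwards [this] with y hy
    rwa [Metric.mem_ball, dist_eq_norm] at hy
  filter_upwards [hlo, hball] with y hy1 hy2
  by_cases hy : N.Feasible y
  swap
  · rw [N.Φ_of_not_feasible hy]; exact le_top
  rw [N.Φ_of_feasible hx, N.Φ_of_feasible hy, ← EReal.coe_add, EReal.coe_le_coe_iff]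
  have hsq : ‖y - x‖ ^ 2 = ‖y.fst - x.fst‖ ^ 2 + ‖y.snd.fst - x.snd.fst‖ ^ 2 +
      ‖y.snd.snd - x.snd.snd‖ ^ 2 := norm_sq_mkState_sub _ _ _ _ _ _
  have hlt1 : ‖y - x‖ < 1 := hy2.trans_le (min_le_left _ _)
  have hγ : y.fst = x.fst := by
    by_contra hne
    have h1 := hx.1.1.one_le_norm_sub_sq hy.1.1 hne
    nlinarith [norm_nonneg (y - x), sq_nonneg ‖y.snd.fst - x.snd.fst‖,
      sq_nonneg ‖y.snd.snd - x.snd.snd‖]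
  have hinner : inner ℝ (mkState 0 ((gradient N.Hjoint x).snd.fst + p)
      ((gradient N.Hjoint x).snd.snd + q)) (y - x) =
      inner ℝ (gradient N.Hjoint x) (y - x) + inner ℝ p (y.snd.fst - x.snd.fst) +
      inner ℝ q (y.snd.snd - x.snd.snd) := by
    have hd : y - x = mkState (y.fst - x.fst) (y.snd.fst - x.snd.fst) (y.snd.snd - x.snd.snd) := rfl
    rw [hd, inner_mkState, inner_mkState, hγ, sub_self, inner_zero_right, inner_zero_right]
    change 0 + inner ℝ ((gradient N.Hjoint x).snd.fst + p) _ +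
      inner ℝ ((gradient N.Hjoint x).snd.snd + q) _ = _
    rw [inner_add_left, inner_add_left]
    ring
  rw [hinner]
  have hp := hpz _ hy.2.1
  have hq := hqθ _ hy.2.2
  have hσ2 : σ * ‖y - x‖ ^ 2 ≤ ε / 2 * ‖y - x‖ := by
    have h1 : ‖y - x‖ ≤ ε / (2 * (σ + 1)) := hy2.le.trans (min_le_right _ _)
    rw [le_div_iff₀ (by positivity)] at h1
    have h2 : σ * ‖y - x‖ ≤ ε / 2 := by nlinarith [norm_nonneg (y - x)]
    calc _ = σ * ‖y - x‖ * ‖y - x‖ := by ring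
      _ ≤ _ := by gcongr
  rw [hsq] at hσ2
  have h0 : 0 ≤ σ * ‖y.fst - x.fst‖ ^ 2 := by positivity
  rw [Real.norm_eq_abs] at hy1
  have h3 := (abs_le.1 hy1).1
  linarith

variable {r₁ r₂ r₃ : ℝ} {a b c : ℕ → ℝ} {γ : ℕ → LineVec m} {z θ : ℕ → BusVec nd ng}

/-- Once the line variables are constant, there are subgradients bounded by the step lengths. -/
theorem IsPALM.exists_subgradient (hP : N.IsPALM r₁ r₂ r₃ a b c γ z θ) (hp : IsProper N.Φ)
    (hL : N.LipschitzConditions γ z θ) (hr₂ : 1 < r₂) (hr₃ : 1 < r₃)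
    (hbdd : Bornology.IsBounded (Set.range fun k => (mkState (γ k) (z k) (θ k) : State nd ng m))) :
    ∃ β : ℝ, 0 < β ∧ ∀ k, γ (k + 1) = γ k →
      ∃ v ∈ frechetSubdiff N.Φ (mkState (γ (k + 1)) (z (k + 1)) (θ (k + 1))),
        ‖v‖ ≤ β * ‖(mkState (γ (k + 1)) (z (k + 1)) (θ (k + 1)) -
          mkState (γ k) (z k) (θ k) : State nd ng m)‖ := by
  obtain ⟨C, hC⟩ := hL.lipschitz_bounded _ hbdd
  obtain ⟨s₁, s₂, s₃, -, -, hs₃, hs⟩ := hL.moduli_bounded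
  have hρ := N.ρ_pos
  refine ⟨C + r₂ * N.ρ + (s₃ + r₃ * s₃), by positivity, fun k hγ => ?_⟩
  set x' : State nd ng m := mkState (γ (k + 1)) (z (k + 1)) (θ (k + 1)) with hx'
  set x : State nd ng m := mkState (γ k) (z k) (θ k) with hx
  have hb := hP.b_pos k
  have hc := hP.c_pos k
  set p := b k • (z k - (1 / b k) • N.gradz (γ (k + 1)) (z k) (θ k) - z (k + 1)) with hpdef
  set q := c k • (θ k - (1 / c k) • N.gradθ (γ (k + 1)) (z (k + 1)) (θ k) - θ (k + 1)) with hqdef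
  have hfeas : N.Feasible x' := ⟨(hP.minγ hp k).1, (hP.minz k).1, (hP.minθ k).1⟩
  have hmem := mem_frechetSubdiff_Φ hfeas (p := p) (q := q) (σ := b k / 2 + c k / 2)
    (by positivity)
    (fun y hy => by
      have h1 := inner_le_of_nearest (fun y hy =>
        le_of_mul_le_mul_left ((hP.minz k).2 y hy) (half_pos hb)) hy
      rw [hpdef, inner_smul_left, conj_trivial]
      change b k * inner ℝ _ (y - z (k + 1)) ≤ (b k / 2 + c k / 2) * ‖y - z (k + 1)‖ ^ 2
      have h2 := mul_le_mul_of_nonneg_left h1 hb.le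
      have h3 : 0 ≤ c k / 2 * ‖y - z (k + 1)‖ ^ 2 := by positivity
      linarith)
    (fun y hy => by
      have h1 := inner_le_of_nearest (fun y hy =>
        le_of_mul_le_mul_left ((hP.minθ k).2 y hy) (half_pos hc)) hy
      rw [hqdef, inner_smul_left, conj_trivial]
      change c k * inner ℝ _ (y - θ (k + 1)) ≤ (b k / 2 + c k / 2) * ‖y - θ (k + 1)‖ ^ 2
      have h2 := mul_le_mul_of_nonneg_left h1 hc.le
      have h3 : 0 ≤ b k / 2 * ‖y - θ (k + 1)‖ ^ 2 := by positivity
      linarith)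
  refine ⟨_, hmem, (norm_mkState_le _ _ _).trans ?_⟩
  have hsq : ‖x' - x‖ ^ 2 = ‖γ (k + 1) - γ k‖ ^ 2 + ‖z (k + 1) - z k‖ ^ 2 +
      ‖θ (k + 1) - θ k‖ ^ 2 := norm_sq_mkState_sub _ _ _ _ _ _
  have hz_le : ‖z (k + 1) - z k‖ ≤ ‖x' - x‖ := by
    refine (sq_le_sq₀ (norm_nonneg _) (norm_nonneg _)).1 ?_
    rw [hsq]
    linarith [sq_nonneg ‖γ (k + 1) - γ k‖, sq_nonneg ‖θ (k + 1) - θ k‖]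
  have hθ_le : ‖θ (k + 1) - θ k‖ ≤ ‖x' - x‖ := by
    refine (sq_le_sq₀ (norm_nonneg _) (norm_nonneg _)).1 ?_
    rw [hsq]
    linarith [sq_nonneg ‖γ (k + 1) - γ k‖, sq_nonneg ‖z (k + 1) - z k‖]
  have hpz : ‖(gradient N.Hjoint x').snd.fst + p‖ ≤ (C + r₂ * N.ρ) * ‖x' - x‖ := by
    have h1 : (gradient N.Hjoint x').snd.fst + p =
        ((gradient N.Hjoint x').snd.fst - (gradient N.Hjoint x).snd.fst) -
          b k • (z (k + 1) - z k) := by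
      have h2 : p = -(b k • (z (k + 1) - z k)) - (gradient N.Hjoint x).snd.fst := by
        rw [hpdef, gradz_eq, hγ, ← hx, smul_sub, smul_sub, smul_smul, mul_one_div_cancel hb.ne',
          one_smul, smul_sub]
        abel
      rw [h2]; abel
    have h3 : ‖(gradient N.Hjoint x').snd.fst - (gradient N.Hjoint x).snd.fst‖ ≤
        C * ‖x' - x‖ := by
      have h4 := hC.dist_le_mul x' ⟨k + 1, rfl⟩ x ⟨k, rfl⟩
      rw [dist_eq_norm, dist_eq_norm] at h4
      refine le_trans ?_ h4
      refine (sq_le_sq₀ (norm_nonneg _) (norm_nonneg _)).1 ?_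
      have h5 : ‖gradient N.Hjoint x' - gradient N.Hjoint x‖ ^ 2 = _ :=
        norm_sq_mkState_sub (gradient N.Hjoint x').fst (gradient N.Hjoint x).fst
          (gradient N.Hjoint x').snd.fst (gradient N.Hjoint x).snd.fst
          (gradient N.Hjoint x').snd.snd (gradient N.Hjoint x).snd.snd
      rw [h5]
      linarith [sq_nonneg ‖(gradient N.Hjoint x').fst - (gradient N.Hjoint x).fst‖,
        sq_nonneg ‖(gradient N.Hjoint x').snd.snd - (gradient N.Hjoint x).snd.snd‖]
    have h6 : ‖b k • (z (k + 1) - z k)‖ ≤ r₂ * N.ρ * ‖x' - x‖ := by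
      rw [norm_smul, Real.norm_of_nonneg hb.le, show b k = r₂ * N.ρ from hP.b_eq k]
      gcongr
    rw [h1, add_mul]
    exact (norm_sub_le _ _).trans (add_le_add h3 h6)
  have hqθ : ‖(gradient N.Hjoint x').snd.snd + q‖ ≤ (s₃ + r₃ * s₃) * ‖x' - x‖ := by
    have h1 : (gradient N.Hjoint x').snd.snd + q =
        (N.gradθ (γ (k + 1)) (z (k + 1)) (θ (k + 1)) - N.gradθ (γ (k + 1)) (z (k + 1)) (θ k)) -
          c k • (θ (k + 1) - θ k) := by
      rw [hqdef, N.gradθ_eq _ _ (θ (k + 1)), ← hx', smul_sub, smul_sub, smul_smul,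
        mul_one_div_cancel hc.ne', one_smul, smul_sub]
      abel
    have hle := (hs (k + 1)).2.2
    have h3 := hL.lipschitz_θ (γ (k + 1)) (z (k + 1)) (θ (k + 1)) (θ k)
    have h4 : N.L₃ (γ (k + 1)) (z (k + 1)) * ‖θ (k + 1) - θ k‖ ≤ s₃ * ‖x' - x‖ := by gcongr
    have h6 : ‖c k • (θ (k + 1) - θ k)‖ ≤ r₃ * s₃ * ‖x' - x‖ := by
      rw [norm_smul, Real.norm_of_nonneg hc.le, hP.c_eq k]
      gcongr
    rw [h1, add_mul]
    exact (norm_sub_le _ _).trans (add_le_add (h3.trans h4) h6)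
  rw [norm_zero, zero_add, add_mul]
  exact add_le_add hpz hqθ

theorem properSpace_state : ProperSpace (State nd ng m) :=
  haveI := finiteDimensional_prod (BusVec nd ng) (BusVec nd ng)
  properSpace_prod _ _

theorem continuous_Hjoint : Continuous N.Hjoint :=
  continuous_of_differentiable N.differentiable_Hjoint

/-- Sufficient decrease along the whole iteration. -/
theorem IsPALM.exists_sufficient_decrease (hP : N.IsPALM r₁ r₂ r₃ a b c γ z θ) (hp : IsProper N.Φ)
    (hL : N.LipschitzConditions γ z θ) (hr₁ : 1 < r₁) (hr₂ : 1 < r₂) (hr₃ : 1 < r₃) :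
    ∃ d : ℝ, 0 < d ∧ ∀ k, N.Feasible (mkState (γ k) (z k) (θ k)) →
      d / 2 * ‖(mkState (γ (k + 1)) (z (k + 1)) (θ (k + 1)) -
        mkState (γ k) (z k) (θ k) : State nd ng m)‖ ^ 2 ≤
      N.H (γ k) (z k) (θ k) - N.H (γ (k + 1)) (z (k + 1)) (θ (k + 1)) := by
  obtain ⟨c₃, hc₃, hL₃⟩ := N.exists_le_L₃
  have hρ := N.ρ_pos
  -- only finitely many `L₁` matter
  obtain ⟨ℓ, hℓ, hℓL⟩ : ∃ ℓ : ℝ, 0 < ℓ ∧ ∀ k, γ (k + 1) ≠ γ k → ℓ ≤ N.L₁ (z k) (θ k) := by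
    obtain ⟨K, hK⟩ := eventually_atTop.1 (hP.eventually_γ_eq hp hL hr₁ hr₂ hr₃)
    have hmin : ∀ n, ∃ ℓ : ℝ, 0 < ℓ ∧ ∀ k < n, ℓ ≤ N.L₁ (z k) (θ k) := by
      intro n
      induction n with
      | zero => exact ⟨1, one_pos, fun k hk => absurd hk (by omega)⟩
      | succ n ih =>
        obtain ⟨ℓ, hℓ, h⟩ := ih
        refine ⟨min ℓ (N.L₁ (z n) (θ n)), lt_min hℓ (hP.L₁_pos hr₁ n), fun k hk => ?_⟩
        rcases Nat.lt_succ_iff_lt_or_eq.1 hk with hk | rfl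
        · exact (min_le_left _ _).trans (h k hk)
        · exact min_le_right _ _
    obtain ⟨ℓ, hℓ, h⟩ := hmin K
    refine ⟨ℓ, hℓ, fun k hk => h k ?_⟩
    by_contra! hKk
    exact hk (hK k hKk)
  set d := min ((r₁ - 1) * ℓ) (min ((r₂ - 1) * N.ρ) ((r₃ - 1) * c₃)) with hd
  have hd1 : d ≤ (r₁ - 1) * ℓ := min_le_left _ _
  have hd2 : d ≤ (r₂ - 1) * N.ρ := (min_le_right _ _).trans (min_le_left _ _)
  have hd3 : d ≤ (r₃ - 1) * c₃ := (min_le_right _ _).trans (min_le_right _ _)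
  refine ⟨d, lt_min (mul_pos (by linarith) hℓ)
    (lt_min (mul_pos (by linarith) hρ) (mul_pos (by linarith) hc₃)), fun k hk => ?_⟩
  obtain ⟨d1, d2, d3⟩ := hP.descent hp hL hk.1 hk.2.1 hk.2.2
  rw [norm_sq_mkState_sub]
  have e1 : d / 2 * ‖γ (k + 1) - γ k‖ ^ 2 ≤
      (r₁ - 1) / 2 * N.L₁ (z k) (θ k) * ‖γ (k + 1) - γ k‖ ^ 2 := by
    by_cases hne : γ (k + 1) = γ k
    · simp [hne]
    · have h1 := hℓL k hne
      have h2 : (r₁ - 1) * ℓ ≤ (r₁ - 1) * N.L₁ (z k) (θ k) :=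
        mul_le_mul_of_nonneg_left h1 (by linarith)
      gcongr
      linarith
  have e2 : d / 2 * ‖z (k + 1) - z k‖ ^ 2 ≤ (r₂ - 1) / 2 * N.ρ * ‖z (k + 1) - z k‖ ^ 2 := by
    gcongr
    linarith
  have e3 : d / 2 * ‖θ (k + 1) - θ k‖ ^ 2 ≤
      (r₃ - 1) / 2 * N.L₃ (γ (k + 1)) (z (k + 1)) * ‖θ (k + 1) - θ k‖ ^ 2 := by
    have h1 := hL₃ (γ (k + 1)) (z (k + 1)) (hP.minγ hp k).1.1 (hP.L₃_pos hr₃ k)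
    have h2 : (r₃ - 1) * c₃ ≤ (r₃ - 1) * N.L₃ (γ (k + 1)) (z (k + 1)) :=
      mul_le_mul_of_nonneg_left h1 (by linarith)
    gcongr
    linarith
  linarith

end

end Problem

end LoadShedding

theorem proposition1 {nd ng m : ℕ} (N : LoadShedding.Problem nd ng m)
    (r₁ r₂ r₃ : ℝ) (hr₁ : 1 < r₁) (hr₂ : 1 < r₂) (hr₃ : 1 < r₃)
    (a b c : ℕ → ℝ) (γ : ℕ → LoadShedding.LineVec m) (z θ : ℕ → LoadShedding.BusVec nd ng)
    (x : ℕ → LoadShedding.State nd ng m)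
    (hx : ∀ k, x k = LoadShedding.mkState (γ k) (z k) (θ k))
    (hKL : LoadShedding.IsKLFunction N.Φ)
    (hLip : N.LipschitzConditions γ z θ)
    (hPALM : N.IsPALM r₁ r₂ r₃ a b c γ z θ)
    (hbdd : Bornology.IsBounded (Set.range x)) :
    Summable (fun k => ‖x (k + 1) - x k‖) ∧
    (∃ xstar, Tendsto x atTop (𝓝 xstar) ∧ LoadShedding.IsCriticalPoint N.Φ xstar) ∧
    Antitone (fun k => N.Φ (x k)) ∧
    ∃ d : ℝ, 0 < d ∧ ∀ k,
      ((d / 2 * ‖x (k + 1) - x k‖ ^ 2 : ℝ) : EReal) ≤ N.Φ (x k) - N.Φ (x (k + 1)) := by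
  have hp := hKL.proper
  obtain rfl : x = fun k => LoadShedding.mkState (γ k) (z k) (θ k) := funext hx
  set x : ℕ → LoadShedding.State nd ng m := fun k => LoadShedding.mkState (γ k) (z k) (θ k)
  obtain ⟨d, hd, hdec⟩ := hPALM.exists_sufficient_decrease hp hLip hr₁ hr₂ hr₃
  obtain ⟨β, hβ, hsub⟩ := hPALM.exists_subgradient hp hLip hr₂ hr₃ hbdd
  have hfeas : ∀ k, N.Feasible (x (k + 1)) := fun k =>
    ⟨(hPALM.minγ hp k).1, (hPALM.minz k).1, (hPALM.minθ k).1⟩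
  have hΦ : ∀ k, N.Feasible (x k) → N.Φ (x k) = ((N.Hjoint (x k) : ℝ) : EReal) := fun k hk =>
    N.Φ_of_feasible hk
  have hdec' : ∀ k, N.Feasible (x k) →
      d / 2 * ‖x (k + 1) - x k‖ ^ 2 ≤ N.Hjoint (x k) - N.Hjoint (x (k + 1)) := hdec
  obtain ⟨K, hK⟩ := eventually_atTop.1 (hPALM.eventually_γ_eq hp hLip hr₁ hr₂ hr₃)
  have := LoadShedding.Problem.properSpace_state (nd := nd) (ng := ng) (m := m)
  have hmain : (Summable fun k => ‖x (k + 1 + (K + 1)) - x (k + (K + 1))‖) ∧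
      ∃ xs, Tendsto (fun k => x (k + (K + 1))) atTop (𝓝 xs) ∧
        LoadShedding.IsCriticalPoint N.Φ xs := by
    refine hKL.summable_and_tendsto (x := fun k => x (k + (K + 1)))
      (h := fun k => N.Hjoint (x (k + (K + 1)))) (half_pos hd) hβ
      (fun k => hΦ _ (hfeas (k + K))) (fun k => ?_) (fun k => ?_)
      (hbdd.subset (by rintro _ ⟨k, rfl⟩; exact ⟨_, rfl⟩)) fun xs φ hφ hlim => ?_
    · have := hdec' (k + (K + 1)) (hfeas (k + K))
      rwa [show k + (K + 1) + 1 = k + 1 + (K + 1) by omega] at this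
    · have := hsub (k + (K + 1)) (hK _ (by omega))
      rwa [show k + (K + 1) + 1 = k + 1 + (K + 1) by omega] at this
    · have hcont : Tendsto (fun k => N.Hjoint (x (φ k + (K + 1)))) atTop (𝓝 (N.Hjoint xs)) :=
        (LoadShedding.Problem.continuous_Hjoint.tendsto xs).comp hlim
      have hxs : N.Feasible xs := by
        rw [← N.Φ_ne_top_iff]
        intro htop
        have hlsc := hKL.lowerSemicontinuous xs ((N.Hjoint xs + 1 : ℝ) : EReal)
          (by
            change ((N.Hjoint xs + 1 : ℝ) : EReal) < N.Φ xs
            rw [htop]; exact EReal.coe_lt_top _)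
        have h1 := hlim.eventually hlsc
        have h2 := hcont.eventually (gt_mem_nhds (lt_add_one (N.Hjoint xs)))
        obtain ⟨k, hk1, hk2⟩ := (h1.and h2).exists
        change ((N.Hjoint xs + 1 : ℝ) : EReal) < N.Φ (x (φ k + (K + 1))) at hk1
        rw [show φ k + (K + 1) = φ k + K + 1 by omega] at hk1 hk2
        rw [hΦ _ (hfeas _)] at hk1
        exact absurd (EReal.coe_lt_coe_iff.1 hk1) (not_lt.2 hk2.le)
      refine ⟨N.Hjoint xs, N.Φ_of_feasible hxs, ?_⟩
      have hanti : Antitone fun k => N.Hjoint (x (k + (K + 1))) :=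
        antitone_nat_of_succ_le fun k => by
          have h1 := hdec' (k + (K + 1)) (hfeas (k + K))
          rw [show k + (K + 1) + 1 = k + 1 + (K + 1) by omega] at h1
          have h2 : 0 ≤ d / 2 * ‖x (k + 1 + (K + 1)) - x (k + (K + 1))‖ ^ 2 := by positivity
          linarith
      exact (tendsto_iff_tendsto_subseq_of_antitone hanti hφ.tendsto_atTop).2 hcont
  obtain ⟨hsum, xs, hlim, hcrit⟩ := hmain
  refine ⟨?_, ⟨xs, (tendsto_add_atTop_iff_nat (K + 1)).1 hlim, hcrit⟩, ?_, d, hd, fun k => ?_⟩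
  · rw [← summable_nat_add_iff (K + 1)]
    simpa only [add_right_comm] using hsum
  · refine antitone_nat_of_succ_le fun k => ?_
    by_cases hk : N.Feasible (x k)
    · rw [hΦ k hk, hΦ (k + 1) (hfeas k), EReal.coe_le_coe_iff]
      have h1 := hdec' k hk
      have h2 : 0 ≤ d / 2 * ‖x (k + 1) - x k‖ ^ 2 := by positivity
      linarith
    · rw [N.Φ_of_not_feasible hk]; exact le_top
  · rw [hΦ (k + 1) (hfeas k)]
    by_cases hk : N.Feasible (x k)
    · rw [hΦ k hk, ← EReal.coe_sub, EReal.coe_le_coe_iff]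
      exact hdec' k hk
    · rw [N.Φ_of_not_feasible hk, EReal.top_sub_coe]; exact le_top
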